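/- Let $k\ge 1$ be fixed and $h=\lfloor k/2\rfloor+1$. For $l=1,\dots,h$ let $\xi_l$ be a probability law on $\mathbb{C}$ with mean $0$ and $\int |z|^2\,d\xi_l=1$, and $\zeta_l$ a probability law on $\mathbb{R}$. On one probability space, let for every $n\ge 1$ the random matrices $A_n(1),\dots,A_n(h)$ be independent, where $A_n(l)=\frac{1}{\sqrt n}(X^{(n,l)}_{ij})_{i,j=1}^n$ is a $\mathrm{Wigner}(n,1)$ matrix, that is, it is Hermitian, the entries $X^{(n,l)}_{ij}$, $1\le i\le j\le n$, are independent, those with $i<j$ have law $\xi_l$, and those with $i=j$ are real with law $\zeta_l$. (The laws do not depend on $n$; nothing is assumed on the joint law of the matrices for different $n$.) Put $a_j=A_n(j)$ for $1\le j\le h$ and $a_j=a_{k-j+2}$ for $2\le j\le k$, and let $$\mathbb{C}_k(A_n(1),\dots,A_n(h))=\frac{1}{\sqrt k}\begin{pmatrix} a_1&a_2&a_3&\cdots&a_k\\ a_k&a_1&a_2&\cdots&a_{k-1}\\ a_{k-1}&a_k&a_1&\cdots&a_{k-2}\\ \vdots&\vdots&\vdots&\ddots&\vdots\\ a_2&a_3&a_4&\cdots&a_1\end{pmatrix},$$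 a Hermitian matrix of order $nk$. For a Hermitian matrix $M$ of order $N$ with eigenvalues $\lambda_1,\dots,\lambda_N$, counted with multiplicity, let $\mu_M=\frac1N\sum_{j=1}^N\delta_{\lambda_j}$. For $v>0$ let $\gamma_{0,v}$ be the semicircle law $\gamma_{0,v}(dx)=\frac{1}{2\pi v}\sqrt{4v-x^2}\,\mathbf 1_{[-2\sqrt v,2\sqrt v]}(x)\,dx$, and let $\gamma_{0,0}=\delta_0$. Then, almost surely, $\mu_{\mathbb{C}_k(A_n(1),\dots,A_n(h))}$ converges weakly to $\nu_k$ as $n\to\infty$, where $$\nu_k=\begin{cases}\frac{k-1}{k}\,\gamma_{0,\frac{k-1}{k}}+\frac1k\,\gamma_{0,\frac{2k-1}{k}}, & k\text{ odd},\\[4pt] \frac{k-2}{k}\,\gamma_{0,\frac{k-2}{k}}+\frac2k\,\gamma_{0,\frac{2k-2}{k}}, & k\text{ even}.\end{cases}$$ -/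

import Mathlib

open MeasureTheory ProbabilityTheory Filter Topology
open scoped ENNReal

/-- The density `(2πv)⁻¹ √(4v - (x-α)²) 𝟙_{[α-2√v, α+2√v]}(x)` of the semicircle law centred at `α`
with variance `v`. -/
noncomputable def semicirclePDF (α v x : ℝ) : ℝ :=
  (Set.Icc (α - 2 * √v) (α + 2 * √v)).indicator
    (fun y => 1 / (2 * Real.pi * v) * √(4 * v - (y - α) ^ 2)) x

/-- The semicircle law `γ_{α,v}` centred at `α` with variance `v`; for `v = 0` it is the point mass
at `α`. -/
noncomputable def semicircleLaw (α v : ℝ) : Measure ℝ :=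
  if v = 0 then Measure.dirac α
  else volume.withDensity (fun x => ENNReal.ofReal (semicirclePDF α v x))

theorem isProbabilityMeasure_semicircleLaw (α : ℝ) {v : ℝ} (hv : 0 ≤ v) :
    IsProbabilityMeasure (semicircleLaw α v) := by
  unfold semicircleLaw
  split_ifs with h0
  · infer_instance
  have hv : 0 < v := lt_of_le_of_ne hv (Ne.symm h0)
  have hs : 0 < √v := Real.sqrt_pos.2 hv
  set c : ℝ := 2 * √v with hc
  have hc0 : 0 < c := by positivity
  have hcv : c ^ 2 = 4 * v := by rw [hc, mul_pow, Real.sq_sqrt hv.le]; norm_num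
  constructor
  rw [withDensity_apply _ MeasurableSet.univ, Measure.restrict_univ]
  have h1 : (fun x => ENNReal.ofReal (semicirclePDF α v x)) =
      (Set.Icc (α - c) (α + c)).indicator
        (fun y => ENNReal.ofReal (1 / (2 * Real.pi * v) * √(4 * v - (y - α) ^ 2))) := by
    funext x
    by_cases hx : x ∈ Set.Icc (α - c) (α + c)
    · rw [Set.indicator_of_mem hx, semicirclePDF, Set.indicator_of_mem hx]
    · rw [Set.indicator_of_notMem hx, semicirclePDF, Set.indicator_of_notMem hx,
        ENNReal.ofReal_zero]
  have hcont : Continuous (fun y : ℝ => 1 / (2 * Real.pi * v) * √(4 * v - (y - α) ^ 2)) := by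
    fun_prop
  rw [h1, lintegral_indicator measurableSet_Icc,
    ← ofReal_integral_eq_lintegral_ofReal (hcont.continuousOn.integrableOn_Icc)
      (Eventually.of_forall fun y => by positivity),
    integral_Icc_eq_integral_Ioc, ← intervalIntegral.integral_of_le (by linarith),
    intervalIntegral.integral_const_mul]
  have h2 : ∀ y : ℝ, √(4 * v - (y - α) ^ 2) = c * √(1 - (y / c - α / c) ^ 2) := by
    intro y
    have e : 4 * v - (y - α) ^ 2 = c ^ 2 * (1 - (y / c - α / c) ^ 2) := by
      rw [← hcv]; field_simp
    rw [e, Real.sqrt_mul (sq_nonneg c), Real.sqrt_sq hc0.le]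
  simp_rw [h2]
  rw [intervalIntegral.integral_const_mul,
    intervalIntegral.integral_comp_div_sub (fun u => √(1 - u ^ 2)) hc0.ne']
  have e1 : (α - c) / c - α / c = -1 := by field_simp; ring
  have e2 : (α + c) / c - α / c = 1 := by field_simp; ring
  rw [e1, e2, integral_sqrt_one_sub_sq, smul_eq_mul]
  have : 1 / (2 * Real.pi * v) * (c * (c * (Real.pi / 2))) = 1 := by
    have : c * (c * (Real.pi / 2)) = c ^ 2 * (Real.pi / 2) := by ring
    rw [this, hcv]
    have := Real.pi_pos
    field_simp
    norm_num
  rw [this, ENNReal.ofReal_one]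

/-- The mixture `ν_k` of two semicircle laws. -/
noncomputable def circulantLimit (k : ℕ) : Measure ℝ :=
  if Odd k then
    ENNReal.ofReal (((k : ℝ) - 1) / k) • semicircleLaw 0 (((k : ℝ) - 1) / k) +
      ENNReal.ofReal (1 / (k : ℝ)) • semicircleLaw 0 ((2 * (k : ℝ) - 1) / k)
  else
    ENNReal.ofReal (((k : ℝ) - 2) / k) • semicircleLaw 0 (((k : ℝ) - 2) / k) +
      ENNReal.ofReal (2 / (k : ℝ)) • semicircleLaw 0 ((2 * (k : ℝ) - 2) / k)

instance isProbabilityMeasure_circulantLimit (k : ℕ) [NeZero k] :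
    IsProbabilityMeasure (circulantLimit k) := by
  have hk : 1 ≤ k := Nat.one_le_iff_ne_zero.2 (NeZero.ne k)
  have hk1 : (1 : ℝ) ≤ k := by exact_mod_cast hk
  have hk0 : (0 : ℝ) < k := by linarith
  have key : ∀ (a b s t : ℝ), 0 ≤ a → 0 ≤ b → a + b = 1 → 0 ≤ s → 0 ≤ t →
      IsProbabilityMeasure
        (ENNReal.ofReal a • semicircleLaw 0 s + ENNReal.ofReal b • semicircleLaw 0 t) := by
    intro a b s t ha hb hab hs ht
    have := isProbabilityMeasure_semicircleLaw 0 hs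
    have := isProbabilityMeasure_semicircleLaw 0 ht
    constructor
    simp only [Measure.add_apply, Measure.smul_apply, measure_univ, smul_eq_mul, mul_one]
    rw [← ENNReal.ofReal_add ha hb, hab, ENNReal.ofReal_one]
  unfold circulantLimit
  split_ifs with h
  · exact key _ _ _ _ (div_nonneg (by linarith) hk0.le) (by positivity) (by field_simp; ring)
      (div_nonneg (by linarith) hk0.le) (div_nonneg (by linarith) hk0.le)
  · have hk2 : (2 : ℝ) ≤ k := by
      have : 2 ≤ k := by
        rcases Nat.lt_or_ge k 2 with h' | h'
        · exact absurd (by obtain rfl : k = 1 := by omega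
                           exact odd_one) h
        · exact h'
      exact_mod_cast this
    exact key _ _ _ _ (div_nonneg (by linarith) hk0.le) (by positivity) (by field_simp; ring)
      (div_nonneg (by linarith) hk0.le) (div_nonneg (by linarith) hk0.le)

/-- The spectral measure of a Hermitian matrix: the uniform distribution on its eigenvalues, counted
with multiplicity. -/
noncomputable def spectralMeasure {ι : Type*} [Fintype ι] [DecidableEq ι]
    (A : Matrix ι ι ℂ) (hA : A.IsHermitian) : Measure ℝ :=
  (Fintype.card ι : ℝ≥0∞)⁻¹ • ∑ i, Measure.dirac (hA.eigenvalues i)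

instance isProbabilityMeasure_spectralMeasure {ι : Type*} [Fintype ι] [DecidableEq ι] [Nonempty ι]
    (A : Matrix ι ι ℂ) (hA : A.IsHermitian) : IsProbabilityMeasure (spectralMeasure A hA) := by
  constructor
  simp only [spectralMeasure, Measure.smul_apply, Measure.finsetSum_apply, measure_univ,
    Finset.sum_const, Finset.card_univ, nsmul_eq_mul, mul_one, smul_eq_mul]
  exact ENNReal.inv_mul_cancel (by simp) (ENNReal.natCast_ne_top _)

/-- `A` is a random Hermitian `n × n` matrix `n^{-1/2} (X_{ij})` on the probability space `(Ω, P)`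
such that the entries `X_{ij}`, `i ≤ j`, are independent, those with `i < j` have the common
complex law `ξ` with mean `0` and `E|X|² = v`, and those with `i = j` have the common real law `ζ`.
That is, `A` is a Wigner matrix of order `n` and variance `v`, with entry laws `ξ` and `ζ`. -/
structure IsWigner {Ω : Type*} [MeasurableSpace Ω] (P : Measure Ω) (n : ℕ) (v : ℝ)
    (ξ : Measure ℂ) (ζ : Measure ℝ) (A : Ω → Matrix (Fin n) (Fin n) ℂ) : Prop where
  measurable : ∀ i j, Measurable fun ω => A ω i j
  isHermitian : ∀ ω, (A ω).IsHermitian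
  map_offDiag : ∀ i j, i < j → P.map (fun ω => (√(n : ℝ) : ℂ) * A ω i j) = ξ
  map_diag : ∀ i, P.map (fun ω => √(n : ℝ) * (A ω i i).re) = ζ
  indep : iIndepFun (fun (p : {p : Fin n × Fin n // p.1 ≤ p.2}) ω => A ω p.1.1 p.1.2) P
  memLp : MemLp id 2 ξ
  mean : ∫ z, z ∂ξ = 0
  variance : ∫ z, ‖z‖ ^ 2 ∂ξ = v

/-- The `k × k` circulant matrix whose first row is `a 0, a 1, …, a (k-1)` and each of whose further
rows is the cyclic right shift of the previous one (subtraction in `Fin k` is modulo `k`). -/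
def rowCirculant {M : Type*} (k : ℕ) (a : Fin k → M) : Matrix (Fin k) (Fin k) M :=
  Matrix.of fun i j => a (j - i)

/-- The extension of `a 0, …, a ⌊k/2⌋` to a sequence `a 0, …, a (k-1)` with `a d = a (k - d)` for
`1 ≤ d ≤ k - 1`. -/
def symmExtend {M : Type*} (k : ℕ) (a : Fin (k / 2 + 1) → M) (d : Fin k) : M :=
  a ⟨min (d : ℕ) (k - d), by omega⟩

/-- The symmetric circulant block-matrix `ℂ_k(A 0, …, A ⌊k/2⌋)`, including the factor `1/√k`, as a
matrix of order `nk`. -/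
noncomputable def circulantBlockMatrix (k n : ℕ)
    (A : Fin (k / 2 + 1) → Matrix (Fin n) (Fin n) ℂ) :
    Matrix (Fin k × Fin n) (Fin k × Fin n) ℂ :=
  ((1 / √(k : ℝ) : ℝ) : ℂ) •
    Matrix.comp (Fin k) (Fin k) (Fin n) (Fin n) ℂ (rowCirculant k (symmExtend k A))

theorem symmExtend_sub_comm {M : Type*} (k : ℕ) (a : Fin (k / 2 + 1) → M) (i j : Fin k) :
    symmExtend k a (i - j) = symmExtend k a (j - i) := by
  unfold symmExtend
  congr 2
  rcases lt_trichotomy i j with h | h | h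
  · rw [Fin.coe_sub_iff_lt.2 h, Fin.coe_sub_iff_le.2 h.le]
    have := i.2; have := j.2
    have : (i : ℕ) < j := h
    omega
  · rw [h]
  · rw [Fin.coe_sub_iff_lt.2 h, Fin.coe_sub_iff_le.2 h.le]
    have := i.2; have := j.2
    have : (j : ℕ) < i := h
    omega

theorem isHermitian_circulantBlockMatrix {k n : ℕ}
    {A : Fin (k / 2 + 1) → Matrix (Fin n) (Fin n) ℂ} (hA : ∀ l, (A l).IsHermitian) :
    (circulantBlockMatrix k n A).IsHermitian := by
  ext p q
  have h : ∀ d, (symmExtend k A d).IsHermitian := fun d => hA _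
  simp only [circulantBlockMatrix, Matrix.conjTranspose_apply, Matrix.smul_apply, Matrix.comp_apply,
    rowCirculant, Matrix.of_apply, smul_eq_mul, star_mul', Complex.star_def, Complex.conj_ofReal]
  rw [symmExtend_sub_comm k A p.1 q.1]
  congr 1
  exact (h (q.1 - p.1)).apply p.2 q.2

/-! A block circulant is diagonalised by the characters of ℤ/k acting on the block index: the
discrete Fourier transform turns the matrix into the direct sum, over m mod k, of blocks B_m = Σ_l
c_l A_n(l) whose coefficients depend on η = exp(2πim/k) (`circulantBlockMatrix_mul_fourierBlock`).
The symmetry a_d = a_{k-d} makes the c_l real, so B_m is a real combination of independent Wigner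
matrices, hence a Wigner matrix of variance Σ c_l² (`IsWigner.linearCombination`). Put w = 1 for odd
k and w = 2 for even k. The double-angle formula gives variance (2k-w)/k if η² = 1 and (k-w)/k
otherwise (`sum_circulantCoeff_sq`), and exactly w of the k values of m satisfy η² = 1. The
normalized resolvent trace of the whole matrix is the average of those of the blocks, so Wigner's
theorem for each block separately yields the mixture ν_k; the joint law of the blocks plays no role.

Wigner's theorem is proved through s = n⁻¹ tr (A - z)⁻¹, with only second moments off the diagonal
and no moments on it. The diagonal is deleted at a vanishing cost. Taking the trace of A (A - z)⁻¹ =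
1 + z (A - z)⁻¹ and expanding in each pair of conjugate entries gives E(1 + z s + v s²) → 0
(`IsWigner.norm_integral_loop_le`). McDiarmid's inequality over the rows makes Re s and Im s
sub-Gaussian with variance proxy O(1/n). Hence E s² may be replaced by (E s)², and s - E s → 0
almost surely by Borel–Cantelli, whatever the joint law over n. The limiting equation v m² + z m + 1
= 0 is satisfied by the Stieltjes transform of the semicircle law and is stable under perturbation
for Im m ≥ 0, which identifies the limit of E s.

Convergence of Stieltjes transforms at the points of a countable dense set extends to the upper
half-plane by equicontinuity, and there it implies weak convergence by Poisson inversion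
(`tendsto_of_tendsto_stieltjes`). -/

open scoped NNReal

/-! ### Stieltjes transforms and weak convergence. -/

/-- The Stieltjes transform `∫ (x - z)⁻¹ dμ(x)` of a measure on the real line. -/
noncomputable def stieltjes (μ : Measure ℝ) (z : ℂ) : ℂ := ∫ x, ((x : ℂ) - z)⁻¹ ∂μ

theorem ofReal_sub_ne_zero {z : ℂ} (hz : 0 < z.im) (x : ℝ) : (x : ℂ) - z ≠ 0 := by
  intro h
  have := congrArg Complex.im h
  simp at this
  exact hz.ne' this

theorem im_le_norm_ofReal_sub {z : ℂ} (hz : 0 < z.im) (x : ℝ) : z.im ≤ ‖(x : ℂ) - z‖ := by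
  have := Complex.abs_im_le_norm ((x : ℂ) - z)
  simp only [Complex.sub_im, Complex.ofReal_im, zero_sub, abs_neg, abs_of_pos hz] at this
  exact this

theorem norm_inv_ofReal_sub_le {z : ℂ} (hz : 0 < z.im) (x : ℝ) :
    ‖((x : ℂ) - z)⁻¹‖ ≤ z.im⁻¹ := by
  rw [norm_inv]
  exact inv_anti₀ hz (im_le_norm_ofReal_sub hz x)

theorem continuous_inv_ofReal_sub {z : ℂ} (hz : 0 < z.im) :
    Continuous fun x : ℝ => ((x : ℂ) - z)⁻¹ :=
  Continuous.inv₀ (by fun_prop) (ofReal_sub_ne_zero hz)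

theorem integrable_inv_ofReal_sub (μ : Measure ℝ) [IsFiniteMeasure μ] {z : ℂ} (hz : 0 < z.im) :
    Integrable (fun x : ℝ => ((x : ℂ) - z)⁻¹) μ :=
  Integrable.of_bound (continuous_inv_ofReal_sub hz).aestronglyMeasurable _
    (Eventually.of_forall (norm_inv_ofReal_sub_le hz))

theorem norm_stieltjes_le (μ : Measure ℝ) [IsProbabilityMeasure μ] {z : ℂ} (hz : 0 < z.im) :
    ‖stieltjes μ z‖ ≤ z.im⁻¹ := by
  exact (norm_integral_le_of_norm_le_const (μ := μ)
    (Eventually.of_forall (norm_inv_ofReal_sub_le hz))).trans (by simp)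

/-- The resolvent identity for scalars. The bound is uniform in μ, so Stieltjes transforms of
probability measures are equi-Lipschitz on every half-plane Im z ≥ δ > 0. -/
theorem norm_stieltjes_sub_le (μ : Measure ℝ) [IsProbabilityMeasure μ] {z w : ℂ}
    (hz : 0 < z.im) (hw : 0 < w.im) :
    ‖stieltjes μ z - stieltjes μ w‖ ≤ z.im⁻¹ * w.im⁻¹ * ‖z - w‖ := by
  unfold stieltjes
  rw [← integral_sub (integrable_inv_ofReal_sub μ hz) (integrable_inv_ofReal_sub μ hw)]
  refine (norm_integral_le_of_norm_le_const (C := z.im⁻¹ * w.im⁻¹ * ‖z - w‖)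
    (Eventually.of_forall fun x => ?_)).trans (by simp)
  have e : ((x : ℂ) - z)⁻¹ - ((x : ℂ) - w)⁻¹
      = ((x : ℂ) - z)⁻¹ * ((x : ℂ) - w)⁻¹ * (z - w) := by
    have := ofReal_sub_ne_zero hz x
    have := ofReal_sub_ne_zero hw x
    field_simp
    ring
  rw [e, norm_mul, norm_mul]
  gcongr
  · exact norm_inv_ofReal_sub_le hz x
  · exact norm_inv_ofReal_sub_le hw x

theorem im_inv_ofReal_sub (x t η : ℝ) :
    (((x : ℂ) - (t + η * Complex.I))⁻¹).im = η / ((x - t) ^ 2 + η ^ 2) := by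
  rw [Complex.inv_im, Complex.normSq_apply]
  simp
  ring

/-- The right-hand side is π times the Poisson integral of μ at height η; this is what makes
inversion possible. -/
theorem im_stieltjes (μ : Measure ℝ) [IsFiniteMeasure μ] {t η : ℝ} (hη : 0 < η) :
    (stieltjes μ (t + η * Complex.I)).im = ∫ x, η / ((x - t) ^ 2 + η ^ 2) ∂μ := by
  have h := integral_im (𝕜 := ℂ)
    (integrable_inv_ofReal_sub μ (z := t + η * Complex.I) (by simpa using hη))
  simp only [RCLike.im_to_complex] at h
  unfold stieltjes
  rw [← h]
  simp_rw [im_inv_ofReal_sub]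

theorem im_stieltjes_nonneg (μ : Measure ℝ) [IsFiniteMeasure μ] {z : ℂ} (hz : 0 < z.im) :
    0 ≤ (stieltjes μ z).im := by
  have := im_stieltjes μ (t := z.re) hz
  rw [Complex.re_add_im] at this
  rw [this]
  exact integral_nonneg fun x => by positivity

/-- Equicontinuity carries convergence from S to the whole half-plane. With S countable, a single
null set serves all z. -/
theorem tendsto_stieltjes_of_dense {ι : Type*} {l : Filter ι} {μs : ι → ProbabilityMeasure ℝ}
    {μ : ProbabilityMeasure ℝ} {S : Set ℂ} (hS : Dense S)
    (h : ∀ z ∈ S, 0 < z.im →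
      Tendsto (fun i => stieltjes (μs i) z) l (𝓝 (stieltjes μ z))) {z : ℂ} (hz : 0 < z.im) :
    Tendsto (fun i => stieltjes (μs i) z) l (𝓝 (stieltjes μ z)) := by
  rw [Metric.tendsto_nhds]
  intro ε hε
  set η := z.im
  -- The first term keeps Im w ≥ η/2; the second makes the Lipschitz bound η⁻¹ (η/2)⁻¹ r at most
  -- ε/4.
  set r := min (η / 2) (ε * η ^ 2 / 8) with hr
  have hr0 : 0 < r := by positivity
  obtain ⟨w, hwS, hw⟩ := hS.exists_dist_lt z hr0
  have hd : ‖z - w‖ < r := by rwa [← dist_eq_norm]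
  have him : η / 2 ≤ w.im := by
    have h1 := Complex.abs_im_le_norm (z - w)
    rw [Complex.sub_im] at h1
    have h2 := (abs_le.1 (h1.trans (hd.le.trans (min_le_left _ _)))).2
    change η - w.im ≤ η / 2 at h2
    linarith
  have hw0 : 0 < w.im := by linarith [half_pos hz]
  have key : ∀ ν : ProbabilityMeasure ℝ, ‖stieltjes ν z - stieltjes ν w‖ ≤ ε / 4 := by
    intro ν
    refine (norm_stieltjes_sub_le (ν : Measure ℝ) hz hw0).trans ?_
    calc z.im⁻¹ * w.im⁻¹ * ‖z - w‖ ≤ η⁻¹ * (η / 2)⁻¹ * (ε * η ^ 2 / 8) := by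
          gcongr
          exact hd.le.trans (min_le_right _ _)
      _ = ε / 4 := by
          have : η ≠ 0 := hz.ne'
          field_simp
          norm_num
  filter_upwards [(Metric.tendsto_nhds.1 (h w hwS hw0)) (ε / 4) (by positivity)] with i hi
  rw [dist_eq_norm] at hi ⊢
  have e : stieltjes (μs i) z - stieltjes μ z = (stieltjes (μs i) z - stieltjes (μs i) w)
    + (stieltjes (μs i) w - stieltjes μ w) - (stieltjes μ z - stieltjes μ w) := by ring
  rw [e]
  have h1 := norm_sub_le ((stieltjes (μs i) z - stieltjes (μs i) w)
    + (stieltjes (μs i) w - stieltjes μ w)) (stieltjes μ z - stieltjes μ w)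
  have h2 := norm_add_le (stieltjes (μs i) z - stieltjes (μs i) w)
    (stieltjes (μs i) w - stieltjes μ w)
  have := key (μs i)
  have := key μ
  linarith

/-- The Poisson integrals of a uniformly continuous bounded function converge uniformly. -/
theorem exists_poisson_approx {f : ℝ → ℝ} (hf : UniformContinuous f) {M : ℝ}
    (hM : ∀ x, |f x| ≤ M) {ε : ℝ} (hε : 0 < ε) :
    ∃ η > 0, ∀ x, |(∫ t, f t * (η / ((x - t) ^ 2 + η ^ 2))) - Real.pi * f x| ≤ ε := by
  -- The substitution t = x + ηu turns the kernel into (1 + u²)⁻¹. Convergence along `𝓝[>] 0 ×ˢ ⊤`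
  -- means η → 0 uniformly in x, so dominated convergence along this filter gives the uniform
  -- statement at once.
  have hlim : Tendsto (fun p : ℝ × ℝ => ∫ u, (f (p.2 + p.1 * u) - f p.2) * (1 + u ^ 2)⁻¹)
      (𝓝[>] 0 ×ˢ ⊤) (𝓝 (∫ _ : ℝ, (0 : ℝ))) := by
    refine tendsto_integral_filter_of_dominated_convergence
      (fun u => (2 * M) * (1 + u ^ 2)⁻¹) ?_ ?_ ?_ ?_
    · refine Eventually.of_forall fun p => Continuous.aestronglyMeasurable ?_
      have := hf.continuous
      refine Continuous.mul (by fun_prop) (Continuous.inv₀ (by fun_prop) fun u => by positivity)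
    · refine Eventually.of_forall fun p => Eventually.of_forall fun u => ?_
      rw [norm_mul, Real.norm_eq_abs, Real.norm_of_nonneg (by positivity : 0 ≤ (1 + u ^ 2)⁻¹)]
      gcongr
      have := abs_sub (f (p.2 + p.1 * u)) (f p.2)
      linarith [hM (p.2 + p.1 * u), hM p.2]
    · exact integrable_inv_one_add_sq.const_mul _
    · refine Eventually.of_forall fun u => ?_
      suffices Tendsto (fun p : ℝ × ℝ => f (p.2 + p.1 * u) - f p.2) (𝓝[>] 0 ×ˢ ⊤) (𝓝 0) by
        simpa using this.mul_const ((1 + u ^ 2)⁻¹)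
      rw [Metric.tendsto_nhds]
      intro δ hδ
      obtain ⟨r, hr, hfr⟩ := Metric.uniformContinuous_iff.1 hf δ hδ
      have h1 : Tendsto (fun p : ℝ × ℝ => p.1 * u) (𝓝[>] 0 ×ˢ ⊤) (𝓝 (0 * u)) :=
        ((tendsto_id.mono_left nhdsWithin_le_nhds).comp tendsto_fst).mul_const u
      rw [zero_mul] at h1
      filter_upwards [(Metric.tendsto_nhds.1 h1) r hr] with p hp
      have := @hfr (p.2 + p.1 * u) p.2 (by simpa [dist_eq_norm] using hp)
      simpa [dist_eq_norm] using this
  rw [integral_zero] at hlim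
  have h2 := (Metric.tendsto_nhds.1 hlim) ε hε
  rw [← principal_univ, eventually_prod_principal_iff] at h2
  obtain ⟨η, hη, hη0⟩ := (h2.and self_mem_nhdsWithin).exists
  have hη0 : 0 < η := hη0
  refine ⟨η, hη0, fun x => ?_⟩
  have h3 := hη x (Set.mem_univ _)
  simp only [dist_zero_right, Real.norm_eq_abs] at h3
  refine le_trans (le_of_eq ?_) h3.le
  congr 1
  have hint1 : Integrable (fun u : ℝ => f (x + η * u) * (1 + u ^ 2)⁻¹) := by
    refine integrable_inv_one_add_sq.bdd_mul (c := M) ?_ (Eventually.of_forall fun u => hM _)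
    have := hf.continuous
    exact Continuous.aestronglyMeasurable (by fun_prop)
  simp_rw [sub_mul]
  rw [integral_sub hint1 (integrable_inv_one_add_sq.const_mul _), integral_const_mul,
    integral_univ_inv_one_add_sq, mul_comm Real.pi]
  congr 1
  have h4 := Measure.integral_comp_mul_left (fun s => f (x + s) * (η / (s ^ 2 + η ^ 2))) η
  have h5 := integral_add_left_eq_self (μ := volume)
    (fun t => f t * (η / ((x - t) ^ 2 + η ^ 2))) x
  rw [← h5]
  simp only [sub_add_cancel_left, neg_sq]
  rw [abs_of_pos (inv_pos.2 hη0), smul_eq_mul] at h4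
  rw [show ∀ a b : ℝ, a = b ↔ η⁻¹ * a = η⁻¹ * b from fun a b => by
    rw [mul_right_inj' (inv_pos.2 hη0).ne'], ← h4, ← integral_const_mul]
  congr 1
  funext u
  field_simp
  ring

/-- By Fubini, ∫ f(t) Im s_ν(t + iη) dt is the ν-integral of the Poisson integral of f, which is
uniformly close to π f. At fixed η the left side converges by dominated convergence, with |f|/η as
the bound. -/
theorem tendsto_integral_of_tendsto_stieltjes {ι : Type*} {l : Filter ι} [l.IsCountablyGenerated]
    {μs : ι → ProbabilityMeasure ℝ} {μ : ProbabilityMeasure ℝ}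
    (h : ∀ z : ℂ, 0 < z.im → Tendsto (fun i => stieltjes (μs i) z) l (𝓝 (stieltjes μ z)))
    {f : ℝ → ℝ} (hf : Continuous f) (hc : HasCompactSupport f) :
    Tendsto (fun i => ∫ x, f x ∂(μs i : Measure ℝ)) l (𝓝 (∫ x, f x ∂(μ : Measure ℝ))) := by
  obtain ⟨M, hM⟩ := hc.exists_bound_of_continuous hf
  have hfi : Integrable f := hf.integrable_of_hasCompactSupport hc
  have huc := hc.uniformContinuous_of_continuous hf
  have hfub : ∀ (ν : ProbabilityMeasure ℝ) (η : ℝ), 0 < η →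
      ∫ t : ℝ, f t * (stieltjes ν (t + η * Complex.I)).im =
        ∫ x, (∫ t, f t * (η / ((x - t) ^ 2 + η ^ 2))) ∂(ν : Measure ℝ) := by
    intro ν η hη
    simp_rw [im_stieltjes (ν : Measure ℝ) hη, ← integral_const_mul]
    refine integral_integral_swap ?_
    have h1 : Integrable (fun p : ℝ × ℝ => f p.1) (volume.prod (ν : Measure ℝ)) := hfi.comp_fst _
    refine Integrable.mul_bdd (c := η⁻¹) h1 ?_ (Eventually.of_forall fun p => ?_)
    · refine Continuous.aestronglyMeasurable (Continuous.div (by fun_prop) (by fun_prop) ?_)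
      exact fun p => by positivity
    · rw [Real.norm_of_nonneg (by positivity), div_le_iff₀ (by positivity)]
      field_simp
      nlinarith [sq_nonneg (p.2 - p.1)]
  rw [Metric.tendsto_nhds]
  intro ε hε
  obtain ⟨η, hη, happ⟩ := exists_poisson_approx huc hM (ε := ε / 4) (by positivity)
  have hclose : ∀ ν : ProbabilityMeasure ℝ,
      |(∫ t : ℝ, f t * (stieltjes ν (t + η * Complex.I)).im)
        - Real.pi * ∫ x, f x ∂(ν : Measure ℝ)| ≤ ε / 4 := by
    intro ν
    have hfν : Integrable f (ν : Measure ℝ) :=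
      Integrable.of_bound hf.aestronglyMeasurable M (Eventually.of_forall hM)
    rw [hfub ν η hη, ← integral_const_mul, ← integral_sub ?_ (hfν.const_mul _)]
    · simpa using norm_integral_le_of_norm_le_const (μ := (ν : Measure ℝ))
        (f := fun x => (∫ t, f t * (η / ((x - t) ^ 2 + η ^ 2))) - Real.pi * f x)
        (Eventually.of_forall happ)
    · refine Integrable.of_bound (C := ε / 4 + Real.pi * M) ?_ (Eventually.of_forall fun x => ?_)
      · refine StronglyMeasurable.aestronglyMeasurable ?_
        refine StronglyMeasurable.integral_prod_right
          (f := fun x t : ℝ => f t * (η / ((x - t) ^ 2 + η ^ 2))) (Continuous.stronglyMeasurable ?_)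
        simp only [Function.uncurry_def]
        exact (hf.comp continuous_snd).mul
          (Continuous.div (by fun_prop) (by fun_prop) fun p => by positivity)
      · have h1 := happ x
        have h2 := hM x
        rw [Real.norm_eq_abs] at h2 ⊢
        have h3 := abs_sub_abs_le_abs_sub (∫ t, f t * (η / ((x - t) ^ 2 + η ^ 2)))
          (Real.pi * f x)
        rw [abs_mul Real.pi, abs_of_pos Real.pi_pos] at h3
        have h4 := mul_le_mul_of_nonneg_left h2 Real.pi_pos.le
        linarith
  have hF : Tendsto (fun i => ∫ t : ℝ, f t * (stieltjes (μs i) (t + η * Complex.I)).im) l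
      (𝓝 (∫ t : ℝ, f t * (stieltjes μ (t + η * Complex.I)).im)) := by
    have him : ∀ t : ℝ, 0 < ((t : ℂ) + η * Complex.I).im := fun t => by simpa using hη
    refine tendsto_integral_filter_of_dominated_convergence (fun t => |f t| * η⁻¹) ?_ ?_
      (hfi.abs.mul_const _) ?_
    · refine Eventually.of_forall fun i => Continuous.aestronglyMeasurable (hf.mul ?_)
      refine Complex.continuous_im.comp ?_
      have : LipschitzWith (Real.toNNReal (η⁻¹ * η⁻¹))
          (fun t : ℝ => stieltjes (μs i) (t + η * Complex.I)) := by
        refine LipschitzWith.of_dist_le_mul fun s t => ?_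
        rw [dist_eq_norm, Real.coe_toNNReal _ (by positivity)]
        refine (norm_stieltjes_sub_le _ (him s) (him t)).trans (le_of_eq ?_)
        simp [dist_eq_norm, ← Complex.ofReal_sub]
      exact this.continuous
    · refine Eventually.of_forall fun i => Eventually.of_forall fun t => ?_
      rw [norm_mul, Real.norm_eq_abs, Real.norm_eq_abs]
      gcongr
      refine (Complex.abs_im_le_norm _).trans ((norm_stieltjes_le _ (him t)).trans ?_)
      simp
    · refine Eventually.of_forall fun t => Tendsto.const_mul _ ?_
      exact (Complex.continuous_im.tendsto _).comp (h _ (him t))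
  filter_upwards [(Metric.tendsto_nhds.1 hF) (ε / 4) (by positivity)] with i hi
  rw [Real.dist_eq] at hi ⊢
  have h1 := abs_le.1 (hclose (μs i))
  have h2 := abs_le.1 (hclose μ)
  have h3 := abs_lt.1 hi
  have h4 : |Real.pi * ((∫ x, f x ∂(μs i : Measure ℝ)) - ∫ x, f x ∂(μ : Measure ℝ))| < ε := by
    rw [mul_sub, abs_lt]
    constructor <;> linarith [h1.1, h1.2, h2.1, h2.2, h3.1, h3.2]
  -- Three errors of size ε/4 bound π times the difference; π > 1 absorbs the factor.
  rw [abs_mul, abs_of_pos Real.pi_pos] at h4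
  have := Real.pi_gt_three
  nlinarith [abs_nonneg ((∫ x, f x ∂(μs i : Measure ℝ)) - ∫ x, f x ∂(μ : Measure ℝ))]

/-- Pointwise convergence of the Stieltjes transforms on the upper half-plane implies weak
convergence. -/
theorem tendsto_of_tendsto_stieltjes {ι : Type*} {l : Filter ι} [l.IsCountablyGenerated]
    {μs : ι → ProbabilityMeasure ℝ} {μ : ProbabilityMeasure ℝ}
    (h : ∀ z : ℂ, 0 < z.im → Tendsto (fun i => stieltjes (μs i) z) l (𝓝 (stieltjes μ z))) :
    Tendsto μs l (𝓝 μ) := by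
  -- Portmanteau: lower semicontinuity on open sets suffices. Inner regularity supplies a compact K
  -- ⊆ G, and a compactly supported bump between K and G is an admissible test function. No
  -- tightness argument is needed because the limit is already a probability measure.
  refine tendsto_of_forall_isOpen_le_liminf' fun G hG => ?_
  rw [hG.measure_eq_iSup_isCompact]
  refine iSup₂_le fun K hKG => iSup_le fun hK => ?_
  rcases l.eq_or_neBot with rfl | hl
  · simp
  obtain ⟨f, hfK, hfc, hfG, hf01⟩ := exists_continuousMap_one_of_isCompact_subset_isOpen hK hG hKG
  have hfi : ∀ ν : ProbabilityMeasure ℝ, Integrable f (ν : Measure ℝ) := fun ν =>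
    Integrable.of_bound f.continuous.aestronglyMeasurable 1 (Eventually.of_forall fun x => by
      rw [Real.norm_of_nonneg (hf01 x).1]; exact (hf01 x).2)
  have hof : ∀ ν : ProbabilityMeasure ℝ,
      ENNReal.ofReal (∫ x, f x ∂(ν : Measure ℝ)) = ∫⁻ x, ENNReal.ofReal (f x) ∂(ν : Measure ℝ) :=
    fun ν => ofReal_integral_eq_lintegral_ofReal (hfi ν) (Eventually.of_forall fun x => (hf01 x).1)
  have hlow : (μ : Measure ℝ) K ≤ ENNReal.ofReal (∫ x, f x ∂(μ : Measure ℝ)) := by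
    rw [hof, ← lintegral_indicator_one hK.measurableSet]
    refine lintegral_mono fun x => ?_
    by_cases hx : x ∈ K
    · simp [hx, hfK hx]
    · simp [hx]
  have hup : ∀ i, ENNReal.ofReal (∫ x, f x ∂(μs i : Measure ℝ)) ≤ (μs i : Measure ℝ) G := by
    intro i
    rw [hof, ← lintegral_indicator_one hG.measurableSet]
    refine lintegral_mono fun x => ?_
    by_cases hx : x ∈ G
    · simpa [hx] using (hf01 x).2
    · have : f x = 0 := image_eq_zero_of_notMem_tsupport fun h' => hx (hfG h')
      simp [hx, this]
  have hlim := (ENNReal.continuous_ofReal.tendsto _).comp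
    (tendsto_integral_of_tendsto_stieltjes h f.continuous hfc)
  refine hlow.trans ?_
  rw [← hlim.liminf_eq]
  exact liminf_le_liminf (Eventually.of_forall hup)

/-! ### The Stieltjes transform of the semicircle law. -/

theorem norm_mul_exp_lt {w : ℂ} (hw : ‖w‖ < 1) (θ : ℝ) :
    ‖w * Complex.exp (θ * Complex.I)‖ < 1 := by
  rw [norm_mul, Complex.norm_exp_ofReal_mul_I, mul_one]; exact hw

theorem one_sub_two_mul_cos_add_sq (w : ℂ) (θ : ℝ) :
    1 - 2 * w * (Real.cos θ : ℂ) + w ^ 2 =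
      (1 - w * Complex.exp (θ * Complex.I)) * (1 - w * Complex.exp (-(θ * Complex.I))) := by
  have h : Complex.exp (θ * Complex.I) * Complex.exp (-(θ * Complex.I)) = 1 := by
    rw [← Complex.exp_add]; simp
  rw [Complex.ofReal_cos, Complex.cos]
  rw [show -(θ : ℂ) * Complex.I = -(θ * Complex.I) by ring]
  linear_combination (-w ^ 2) * h

theorem one_sub_two_mul_cos_add_sq_ne_zero {w : ℂ} (hw : ‖w‖ < 1) (θ : ℝ) :
    1 - 2 * w * (Real.cos θ : ℂ) + w ^ 2 ≠ 0 := by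
  rw [one_sub_two_mul_cos_add_sq]
  have h1 : ∀ u : ℂ, ‖u‖ < 1 → 1 - u ≠ 0 := by
    intro u hu h
    rw [sub_eq_zero] at h
    rw [← h] at hu
    simp at hu
  refine mul_ne_zero (h1 _ (norm_mul_exp_lt hw θ)) (h1 _ ?_)
  have := norm_mul_exp_lt hw (-θ)
  simpa using this

/-- The expansion of `sin θ / (1 - 2 w cos θ + w ^ 2)` in powers of `w`. -/
theorem hasSum_pow_mul_sin {w : ℂ} (hw : ‖w‖ < 1) (θ : ℝ) :
    HasSum (fun n : ℕ => w ^ n * (Real.sin ((n + 1) * θ) : ℂ))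
      ((Real.sin θ : ℂ) / (1 - 2 * w * (Real.cos θ : ℂ) + w ^ 2)) := by
  set u := Complex.exp (θ * Complex.I) with hu
  set v := Complex.exp (-(θ * Complex.I)) with hv
  have hwu : ‖w * u‖ < 1 := norm_mul_exp_lt hw θ
  have hwv : ‖w * v‖ < 1 := by simpa [hv] using norm_mul_exp_lt hw (-θ)
  have h0 := one_sub_two_mul_cos_add_sq_ne_zero hw θ
  have h1 := ((hasSum_geometric_of_norm_lt_one hwv).mul_left v).sub
    ((hasSum_geometric_of_norm_lt_one hwu).mul_left u)
  have h2 := h1.mul_right (Complex.I / 2)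
  have hsin : (Real.sin θ : ℂ) = (v - u) * Complex.I / 2 := by
    rw [Complex.ofReal_sin, Complex.sin]
    rw [show -(θ : ℂ) * Complex.I = -(θ * Complex.I) by ring]
  have huv : u * v = 1 := by rw [hu, hv, ← Complex.exp_add]; simp
  have hterm : (fun n : ℕ => w ^ n * (Real.sin ((n + 1) * θ) : ℂ)) =
      fun n => (v * (w * v) ^ n - u * (w * u) ^ n) * (Complex.I / 2) := by
    funext n
    rw [Complex.ofReal_sin, Complex.sin]
    have e1 : Complex.exp (-(((n + 1) * θ : ℝ) : ℂ) * Complex.I) = v ^ (n + 1) := by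
      rw [hv, ← Complex.exp_nat_mul]; congr 1; push_cast; ring
    have e2 : Complex.exp ((((n + 1) * θ : ℝ) : ℂ) * Complex.I) = u ^ (n + 1) := by
      rw [hu, ← Complex.exp_nat_mul]; congr 1; push_cast; ring
    rw [e1, e2, mul_pow, mul_pow]
    ring
  -- Partial fractions for the factorised denominator; each of the two fractions is a geometric
  -- series.
  have hval : (Real.sin θ : ℂ) / (1 - 2 * w * (Real.cos θ : ℂ) + w ^ 2) =
      (v * (1 - w * v)⁻¹ - u * (1 - w * u)⁻¹) * (Complex.I / 2) := by
    rw [one_sub_two_mul_cos_add_sq, ← hu, ← hv] at *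
    have ha := left_ne_zero_of_mul h0
    have hb := right_ne_zero_of_mul h0
    rw [hsin, div_eq_iff h0]
    linear_combination (Complex.I / 2) * u * (1 - w * v) * inv_mul_cancel₀ ha -
      (Complex.I / 2) * v * (1 - w * u) * inv_mul_cancel₀ hb
  rw [hterm, hval]
  exact h2

theorem integral_sin_mul_sin_succ (n : ℕ) :
    ∫ θ in (0 : ℝ)..Real.pi, Real.sin θ * Real.sin ((n + 1) * θ) =
      if n = 0 then Real.pi / 2 else 0 := by
  split_ifs with h
  · subst h
    have := integral_sin_sq (a := 0) (b := Real.pi)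
    simp only [Real.sin_zero, Real.sin_pi] at this
    simp only [Nat.cast_zero, zero_add, one_mul, ← sq, this]
    simp
  · have e : ∀ θ : ℝ, Real.sin θ * Real.sin ((n + 1) * θ) =
        (Real.cos (n * θ) - Real.cos ((n + 2 : ℝ) * θ)) / 2 := by
      intro θ
      have h1 : (n : ℝ) * θ = (n + 1) * θ - θ := by ring
      have h2 : ((n : ℝ) + 2) * θ = (n + 1) * θ + θ := by ring
      rw [h1, h2, Real.cos_sub, Real.cos_add]; ring
    have hn : (n : ℝ) ≠ 0 := by exact_mod_cast h
    have hn2 : (n : ℝ) + 2 ≠ 0 := by positivity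
    simp_rw [e]
    rw [intervalIntegral.integral_div, intervalIntegral.integral_sub
      (Continuous.intervalIntegrable (by fun_prop) _ _)
      (Continuous.intervalIntegrable (by fun_prop) _ _),
      intervalIntegral.integral_comp_mul_left _ hn, intervalIntegral.integral_comp_mul_left _ hn2]
    have h3 : Real.sin (((n : ℝ) + 2) * Real.pi) = 0 := by
      have := Real.sin_nat_mul_pi (n + 2)
      push_cast at this; exact this
    simp [integral_cos, h3]

/-- Integrate the power series in w term by term: orthogonality of the sines leaves only the
constant term, so the value does not depend on w. -/
theorem integral_sin_sq_div {w : ℂ} (hw : ‖w‖ < 1) :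
    ∫ θ in (0 : ℝ)..Real.pi,
      (Real.sin θ : ℂ) ^ 2 / (1 - 2 * w * (Real.cos θ : ℂ) + w ^ 2) = (Real.pi / 2 : ℂ) := by
  have h := intervalIntegral.hasSum_integral_of_dominated_convergence
    (a := 0) (b := Real.pi) (μ := volume)
    (F := fun (n : ℕ) (θ : ℝ) => (Real.sin θ : ℂ) * (w ^ n * (Real.sin ((n + 1) * θ) : ℂ)))
    (f := fun θ => (Real.sin θ : ℂ) ^ 2 / (1 - 2 * w * (Real.cos θ : ℂ) + w ^ 2))
    (fun n _ => ‖w‖ ^ n) (fun n => Continuous.aestronglyMeasurable (by fun_prop))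
    (fun n => Eventually.of_forall fun θ _ => ?_)
    (Eventually.of_forall fun θ _ => summable_geometric_of_lt_one (norm_nonneg _) hw)
    intervalIntegrable_const (Eventually.of_forall fun θ _ => ?_)
  · refine h.unique ?_
    have e : ∀ n : ℕ, ∫ θ in (0 : ℝ)..Real.pi,
        (Real.sin θ : ℂ) * (w ^ n * (Real.sin ((n + 1) * θ) : ℂ))
          = if n = 0 then (Real.pi / 2 : ℂ) else 0 := by
      intro n
      have : ∀ θ : ℝ, (Real.sin θ : ℂ) * (w ^ n * (Real.sin ((n + 1) * θ) : ℂ))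
          = w ^ n * ((Real.sin θ * Real.sin ((n + 1) * θ) : ℝ) : ℂ) := by
        intro θ; push_cast; ring
      simp_rw [this]
      rw [intervalIntegral.integral_const_mul, intervalIntegral.integral_ofReal,
        integral_sin_mul_sin_succ]
      split_ifs with h0 <;> simp [h0]
    simp_rw [e]
    exact hasSum_ite_eq 0 _
  · rw [norm_mul, norm_mul, norm_pow, Complex.norm_real, Complex.norm_real]
    have h1 := Real.abs_sin_le_one θ
    have h2 := Real.abs_sin_le_one ((n + 1) * θ)
    rw [← Real.norm_eq_abs] at h1 h2
    calc _ ≤ 1 * (‖w‖ ^ n * 1) := by gcongr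
      _ = _ := by ring
  · have := (hasSum_pow_mul_sin hw θ).mul_left (Real.sin θ : ℂ)
    rwa [← mul_div_assoc, ← sq] at this

/-- The substitution x = 2√v cos θ; the density and the Jacobian each contribute one factor sin θ.
-/
theorem integral_semicircleLaw {v : ℝ} (hv : 0 < v) (g : ℝ → ℂ) (hg : Continuous g) :
    ∫ x, g x ∂(semicircleLaw 0 v) =
      (2 / Real.pi : ℝ) * ∫ θ in (0 : ℝ)..Real.pi,
        (Real.sin θ : ℂ) ^ 2 * g (2 * √v * Real.cos θ) := by
  have hs : 0 < √v := Real.sqrt_pos.2 hv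
  have hsv : √v ^ 2 = v := Real.sq_sqrt hv.le
  have hpi := Real.pi_pos
  rw [semicircleLaw, if_neg hv.ne']
  have hm : Measurable (semicirclePDF 0 v) := by
    unfold semicirclePDF
    exact Measurable.indicator (by fun_prop) measurableSet_Icc
  have hnn : ∀ x, 0 ≤ semicirclePDF 0 v x := fun x =>
    Set.indicator_nonneg (fun y _ => by positivity) x
  rw [integral_withDensity_eq_integral_toReal_smul (by fun_prop) (by simp)]
  simp_rw [ENNReal.toReal_ofReal (hnn _)]
  set F : ℝ → ℂ := fun x => ((1 / (2 * Real.pi * v) * √(4 * v - x ^ 2) : ℝ) : ℂ) * g x with hF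
  have hFc : Continuous F := by fun_prop
  have e1 : (fun x => semicirclePDF 0 v x • g x) =
      (Set.Icc (-(2 * √v)) (2 * √v)).indicator F := by
    funext x
    unfold semicirclePDF
    by_cases hx : x ∈ Set.Icc (-(2 * √v)) (2 * √v)
    · rw [Set.indicator_of_mem hx, Set.indicator_of_mem (by simpa using hx)]
      simp [hF, Complex.real_smul]
    · rw [Set.indicator_of_notMem hx, Set.indicator_of_notMem (by simpa using hx), zero_smul]
  rw [e1, integral_indicator measurableSet_Icc, integral_Icc_eq_integral_Ioc,
    ← intervalIntegral.integral_of_le (by linarith)]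
  have h2 := intervalIntegral.integral_deriv_smul_comp (a := 0) (b := Real.pi)
    (f := fun θ => 2 * √v * Real.cos θ) (f' := fun θ => 2 * √v * (-Real.sin θ)) (g := F)
    (fun θ _ => (Real.hasDerivAt_cos θ).const_mul _) (by fun_prop) hFc
  simp only [Real.cos_zero, Real.cos_pi, mul_one, mul_neg_one] at h2
  rw [intervalIntegral.integral_symm, ← h2, ← intervalIntegral.integral_const_mul,
    ← intervalIntegral.integral_neg]
  refine intervalIntegral.integral_congr fun θ hθ => ?_
  rw [Set.uIcc_of_le hpi.le] at hθ
  have hsin : 0 ≤ Real.sin θ := Real.sin_nonneg_of_mem_Icc hθ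
  have e2 : √(4 * v - (2 * √v * Real.cos θ) ^ 2) = 2 * √v * Real.sin θ := by
    rw [show 4 * v - (2 * √v * Real.cos θ) ^ 2 = (2 * √v * Real.sin θ) ^ 2 by
      rw [mul_pow, mul_pow (2 * √v) (Real.sin θ), Real.sin_sq, mul_pow, hsv]; ring]
    exact Real.sqrt_sq (by positivity)
  simp only [hF, Function.comp_apply, e2, Complex.real_smul]
  have e3 : (1 / (2 * Real.pi * v) * (2 * √v * Real.sin θ)) * (2 * √v * Real.sin θ)
      = 2 / Real.pi * Real.sin θ ^ 2 := by
    field_simp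
    rw [hsv]
  have e3' := congrArg (fun r : ℝ => (r : ℂ)) e3
  push_cast at e3' ⊢
  linear_combination (g (2 * √v * Real.cos θ)) * e3'

/-- Joukowski parametrisation. The roots of w² - zw + 1 are inverse to each other, and on the unit
circle w + w⁻¹ = 2 Re w would be real, so one root lies strictly inside. -/
theorem exists_add_inv_eq {z : ℂ} (hz : 0 < z.im) : ∃ w : ℂ, w ≠ 0 ∧ ‖w‖ < 1 ∧ w + w⁻¹ = z := by
  obtain ⟨w, hw⟩ : ∃ w : ℂ, w * w - z * w + 1 = 0 := by
    obtain ⟨s, hs⟩ := IsAlgClosed.exists_eq_mul_self (z ^ 2 - 4)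
    exact ⟨(z + s) / 2, by linear_combination -hs / 4⟩
  have hw0 : w ≠ 0 := by rintro rfl; simp at hw
  have hwz : w + w⁻¹ = z := by field_simp; linear_combination hw
  have hne : ‖w‖ ≠ 1 := by
    intro h1
    have : w⁻¹ = (starRingEnd ℂ) w := Complex.inv_eq_conj h1
    rw [this, Complex.add_conj] at hwz
    rw [← hwz] at hz
    simp at hz
  rcases lt_or_gt_of_ne hne with h | h
  · exact ⟨w, hw0, h, hwz⟩
  · exact ⟨w⁻¹, inv_ne_zero hw0, by rw [norm_inv]; exact inv_lt_one_of_one_lt₀ h,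
      by rw [inv_inv, add_comm]; exact hwz⟩

/-- The quadratic equation satisfied by the Stieltjes transform of the semicircle law. -/
theorem stieltjes_semicircleLaw_quadratic {v : ℝ} (hv : 0 < v) {z : ℂ} (hz : 0 < z.im) :
    v * stieltjes (semicircleLaw 0 v) z ^ 2 + z * stieltjes (semicircleLaw 0 v) z + 1 = 0 := by
  have hs : 0 < √v := Real.sqrt_pos.2 hv
  have hsv : ((√v : ℝ) : ℂ) ^ 2 = v := by
    rw [← Complex.ofReal_pow, Real.sq_sqrt hv.le]
  have hs' : ((√v : ℝ) : ℂ) ≠ 0 := by exact_mod_cast hs.ne'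
  obtain ⟨w, hw0, hw1, hwz⟩ := exists_add_inv_eq (z := z / (√v : ℝ)) (by
    rw [Complex.div_ofReal_im]; positivity)
  have hz' : z = √v * (w + w⁻¹) := by rw [hwz]; field_simp
  -- With z = √v (w + w⁻¹), the factor 2√v cos θ - z equals -(√v/w)(1 - 2w cos θ + w²), which
  -- reduces the transform to the integral just computed.
  have hm : stieltjes (semicircleLaw 0 v) z = -w / √v := by
    unfold stieltjes
    rw [integral_semicircleLaw hv _ (continuous_inv_ofReal_sub hz)]
    have e : ∀ θ : ℝ, (Real.sin θ : ℂ) ^ 2 * (((2 * √v * Real.cos θ : ℝ) : ℂ) - z)⁻¹ =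
        (-w / √v) * ((Real.sin θ : ℂ) ^ 2 / (1 - 2 * w * (Real.cos θ : ℂ) + w ^ 2)) := by
      intro θ
      have h1 := one_sub_two_mul_cos_add_sq_ne_zero hw1 θ
      have h2 : ((2 * √v * Real.cos θ : ℝ) : ℂ) - z =
          -(√v / w) * (1 - 2 * w * (Real.cos θ : ℂ) + w ^ 2) := by
        rw [hz']; push_cast; field_simp; ring
      rw [h2]
      field_simp
    simp_rw [e]
    rw [intervalIntegral.integral_const_mul, integral_sin_sq_div hw1]
    have : (Real.pi : ℂ) ≠ 0 := by exact_mod_cast Real.pi_ne_zero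
    push_cast
    field_simp
  rw [hm, hz', ← hsv]
  field_simp
  ring

/-- A sequence with nonnegative imaginary parts which asymptotically solves the quadratic equation
of the semicircle law converges to its Stieltjes transform. -/
theorem tendsto_stieltjes_semicircleLaw {ι : Type*} {l : Filter ι} {v : ℝ} (hv : 0 < v) {z : ℂ}
    (hz : 0 < z.im) {s : ι → ℂ} (hs : ∀ i, 0 ≤ (s i).im)
    (h : Tendsto (fun i => v * s i ^ 2 + z * s i + 1) l (𝓝 0)) :
    Tendsto s l (𝓝 (stieltjes (semicircleLaw 0 v) z)) := by
  set m := stieltjes (semicircleLaw 0 v) z with hm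
  have hq := stieltjes_semicircleLaw_quadratic hv hz
  rw [← hm] at hq
  have := isProbabilityMeasure_semicircleLaw 0 hv.le
  have hmi : 0 ≤ m.im := im_stieltjes_nonneg _ hz
  have hv' : (v : ℂ) ≠ 0 := by exact_mod_cast hv.ne'
  -- Subtracting the two quadratics gives the factor v s + v m + z, whose imaginary part is at least
  -- Im z because Im s and Im m are nonnegative. This excludes the other root of the quadratic
  -- without choosing a branch.
  have hb : ∀ i, ‖s i - m‖ ≤ ‖v * s i ^ 2 + z * s i + 1‖ / z.im := by
    intro i
    have e : v * s i ^ 2 + z * s i + 1 = (s i - m) * (v * s i + v * m + z) := by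
      linear_combination hq
    rw [e, norm_mul, le_div_iff₀ hz]
    gcongr
    have h1 := Complex.abs_im_le_norm (v * s i + v * m + z)
    have h2 : (v * s i + v * m + z).im = v * (s i).im + v * m.im + z.im := by simp
    rw [h2] at h1
    have := le_abs_self (v * (s i).im + v * m.im + z.im)
    have := mul_nonneg hv.le (hs i)
    have := mul_nonneg hv.le hmi
    linarith
  rw [tendsto_iff_norm_sub_tendsto_zero]
  refine squeeze_zero (fun i => norm_nonneg _) hb ?_
  have := h.norm.div_const z.im
  simpa using this

/-! ### Bounded differences and grouping of independent families. -/

theorem integrable_exp_mul_of_abs_le {Ω : Type*} [MeasurableSpace Ω] {μ : Measure Ω}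
    [IsFiniteMeasure μ] {X : Ω → ℝ} (hX : Measurable X) {M : ℝ} (hM : ∀ x, |X x| ≤ M) (t : ℝ) :
    Integrable (fun x => Real.exp (t * X x)) μ := by
  refine Integrable.of_bound (by fun_prop) (Real.exp (|t| * M)) (Eventually.of_forall fun x => ?_)
  rw [Real.norm_of_nonneg (Real.exp_pos _).le, Real.exp_le_exp]
  refine (le_abs_self _).trans ?_
  rw [abs_mul]
  gcongr
  exact hM x

/-- **McDiarmid's inequality**: a function of independent variables with bounded differences is
sub-Gaussian. -/
theorem hasSubgaussianMGF_pi_of_bounded_differences {E : Type*} [MeasurableSpace E] {c : ℝ≥0}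
    {M : ℝ} : ∀ (n : ℕ) (μ : Fin n → Measure E) [∀ i, IsProbabilityMeasure (μ i)]
    {f : (Fin n → E) → ℝ}, Measurable f → (∀ x, |f x| ≤ M) →
    (∀ x i e, |f (Function.update x i e) - f x| ≤ c) →
    HasSubgaussianMGF (fun x => f x - ∫ y, f y ∂(Measure.pi μ)) (n * c ^ 2) (Measure.pi μ)
  | 0, μ, _, f, hf, hM, hb => by
    have h : (fun x => f x - ∫ y, f y ∂(Measure.pi μ)) = fun _ => 0 := by
      funext x
      have : ∀ y, f y = f x := fun y => congrArg f (Subsingleton.elim _ _)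
      simp_rw [this]
      simp
    rw [h]
    simp
  | n + 1, μ, _, f, hf, hM, hb => by
    set ν := Measure.pi fun j : Fin n => μ j.succ with hν
    set F : E × (Fin n → E) → ℝ := fun p => f (Fin.cons p.1 p.2) with hF
    have hmp := measurePreserving_piFinSuccAbove μ 0
    have hsymm : ∀ p, (MeasurableEquiv.piFinSuccAbove (fun _ : Fin (n + 1) => E) 0).symm p
        = Fin.cons p.1 p.2 := fun p => by
      simp [MeasurableEquiv.piFinSuccAbove_symm_apply, Fin.insertNthEquiv]
    have hFm : Measurable F := by
      have := hf.comp (MeasurableEquiv.piFinSuccAbove (fun _ : Fin (n + 1) => E) 0).symm.measurable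
      rwa [show f ∘ _ = F from funext fun p => congrArg f (hsymm p)] at this
    have hfF : ∀ x, f x = F (MeasurableEquiv.piFinSuccAbove (fun _ : Fin (n + 1) => E) 0 x) := by
      intro x
      simp only [hF]
      rw [← hsymm, MeasurableEquiv.symm_apply_apply]
    have hFi : Integrable F ((μ 0).prod ν) :=
      Integrable.of_bound hFm.aestronglyMeasurable M (Eventually.of_forall fun p => hM _)
    have hint : ∫ y, f y ∂(Measure.pi μ) = ∫ p, F p ∂((μ 0).prod ν) := by
      simp_rw [hfF]
      exact hmp.integral_comp' F
    -- The first coordinate is integrated out. The average g inherits the bounds and differences of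
    -- f, so the induction applies to it, while F - g is the martingale increment of this
    -- coordinate.
    set g : (Fin n → E) → ℝ := fun y => ∫ e, F (e, y) ∂(μ 0) with hg
    have hgm : Measurable g :=
      (hFm.stronglyMeasurable.integral_prod_left' (μ := μ 0)).measurable
    have hFy : ∀ y, Measurable fun e => F (e, y) := fun y => hFm.comp measurable_prodMk_right
    have hslice : ∀ y, Integrable (fun e => F (e, y)) (μ 0) := fun y =>
      Integrable.of_bound (hFy y).aestronglyMeasurable M (Eventually.of_forall fun p => hM _)
    have hgM : ∀ y, |g y| ≤ M := fun y =>
      (norm_integral_le_of_norm_le_const (μ := μ 0) (f := fun e => F (e, y))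
        (Eventually.of_forall fun e => hM _)).trans (by simp)
    have hgb : ∀ y i e, |g (Function.update y i e) - g y| ≤ c := by
      intro y i e
      simp only [hg]
      rw [← integral_sub (hslice _) (hslice _)]
      have h := norm_integral_le_of_norm_le_const (μ := μ 0) (C := c)
        (f := fun e' => F (e', Function.update y i e) - F (e', y))
        (Eventually.of_forall fun e' => by
          simp only [hF, Fin.cons_update]
          exact hb _ _ _)
      simpa using h
    have hgint : ∫ p, F p ∂((μ 0).prod ν) = ∫ y, g y ∂ν := integral_prod_symm F hFi
    have ih := hasSubgaussianMGF_pi_of_bounded_differences n (fun j => μ j.succ) hgm hgM hgb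
    have hcond : ∀ y, HasSubgaussianMGF (fun e => F (e, y) - g y) (c ^ 2) (μ 0) := by
      intro y
      obtain ⟨e₀⟩ : Nonempty E := nonempty_of_isProbabilityMeasure (μ 0)
      -- Hoeffding's lemma on an interval of half-length c around the value at an arbitrary
      -- reference point e₀; the proxy c² is not optimal but suffices.
      have h := hasSubgaussianMGF_of_mem_Icc (μ := μ 0) (X := fun e => F (e, y))
        (a := F (e₀, y) - c) (b := F (e₀, y) + c) (hFy y).aemeasurable
        (Eventually.of_forall fun e => by
          have := hb (Fin.cons e₀ y) 0 e
          rw [Fin.update_cons_zero] at this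
          have := abs_le.1 this
          simp only [hF]
          constructor <;> linarith [this.1, this.2])
      have hc : (‖F (e₀, y) + c - (F (e₀, y) - c)‖₊ / 2) ^ 2 = c ^ 2 := by
        congr 1
        apply NNReal.eq
        rw [show F (e₀, y) + (c : ℝ) - (F (e₀, y) - c) = 2 * c by ring]
        simp
      rwa [hc] at h
    have hmain : HasSubgaussianMGF (fun p => F p - ∫ y, g y ∂ν) ((n + 1 : ℕ) * c ^ 2)
        ((μ 0).prod ν) := by
      have hexp : ∀ t, Integrable (fun p => Real.exp (t * (F p - ∫ y, g y ∂ν)))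
          ((μ 0).prod ν) := fun t => by
        refine integrable_exp_mul_of_abs_le (M := M + |∫ y, g y ∂ν|) (by fun_prop) (fun p => ?_) t
        refine (abs_sub _ _).trans ?_
        gcongr
        exact hM _
      refine ⟨hexp, fun t => ?_⟩
      rw [mgf, integral_prod_symm _ (hexp t)]
      have h1 : ∀ y, ∫ e, Real.exp (t * (F (e, y) - ∫ y, g y ∂ν)) ∂(μ 0) ≤
          Real.exp (c ^ 2 * t ^ 2 / 2) * Real.exp (t * (g y - ∫ y, g y ∂ν)) := by
        intro y
        have e : ∀ e, Real.exp (t * (F (e, y) - ∫ y, g y ∂ν)) =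
            Real.exp (t * (F (e, y) - g y)) * Real.exp (t * (g y - ∫ y, g y ∂ν)) := by
          intro e; rw [← Real.exp_add]; congr 1; ring
        simp_rw [e]
        rw [integral_mul_const]
        gcongr
        simpa [mgf] using (hcond y).mgf_le t
      calc _ ≤ ∫ y, Real.exp (c ^ 2 * t ^ 2 / 2) * Real.exp (t * (g y - ∫ y, g y ∂ν)) ∂ν := by
            refine integral_mono_of_nonneg (Eventually.of_forall fun y => ?_)
              ((ih.integrable_exp_mul t).const_mul _) (Eventually.of_forall h1)
            exact integral_nonneg fun e => (Real.exp_pos _).le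
        _ ≤ Real.exp (c ^ 2 * t ^ 2 / 2) * Real.exp ((n * c ^ 2 : ℝ≥0) * t ^ 2 / 2) := by
            rw [integral_const_mul]
            gcongr
            exact ih.mgf_le t
        _ = _ := by
            rw [← Real.exp_add]; congr 1; push_cast; ring
    have := HasSubgaussianMGF.of_map (Y := MeasurableEquiv.piFinSuccAbove (fun _ => E) 0)
      (μ := Measure.pi μ) (X := fun p => F p - ∫ y, g y ∂ν) (c := (n + 1 : ℕ) * c ^ 2)
      (MeasurableEquiv.measurable _).aemeasurable (by rw [hmp.map_eq]; exact hmain)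
    convert this using 1
    funext x
    rw [Function.comp_apply, hint, hgint, hfF]

/-- Grouping the members of an independent family into disjoint blocks gives an independent family
of blocks. -/
theorem iIndepFun_curry {Ω ι : Type*} {κ : ι → Type*} {𝓧 : (i : ι) → κ i → Type*}
    [MeasurableSpace Ω] {P : Measure Ω} [∀ i j, MeasurableSpace (𝓧 i j)]
    {X : (i : ι) → (j : κ i) → Ω → 𝓧 i j} (mX : ∀ i j, Measurable (X i j))
    (h : iIndepFun (fun (p : (i : ι) × κ i) ω => X p.1 p.2 ω) P) :
    iIndepFun (fun i ω j => X i j ω) P := by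
  have := h.isProbabilityMeasure
  have : ∀ i j, IsProbabilityMeasure (P.map (X i j)) :=
    fun i j => Measure.isProbabilityMeasure_map (mX i j).aemeasurable
  have : ∀ i, IsProbabilityMeasure (P.map (fun ω => (X i · ω))) :=
    fun i => Measure.isProbabilityMeasure_map (Measurable.aemeasurable (by fun_prop))
  have hi : ∀ i, iIndepFun (X i) P := fun i =>
    h.precomp (g := fun j => (⟨i, j⟩ : (i : ι) × κ i)) sigma_mk_injective
  have hcurry : (MeasurableEquiv.piCurry 𝓧) ∘ (fun ω p => X p.1 p.2 ω) = fun ω i j => X i j ω := by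
    ext; simp [Sigma.curry]
  -- Independence means that the joint law is a product measure, and currying carries a product over
  -- pairs to a product of products.
  rw [iIndepFun_iff_map_fun_eq_infinitePi_map (by fun_prop)]
  rw [← hcurry, ← Measure.map_map (by fun_prop) (by fun_prop),
    (iIndepFun_iff_map_fun_eq_infinitePi_map (by fun_prop)).1 h,
    Measure.infinitePi_map_piCurry (fun i j => P.map (X i j))]
  congr 1
  funext i
  rw [(iIndepFun_iff_map_fun_eq_infinitePi_map (by fun_prop)).1 (hi i)]

/-! ### Resolvents of Hermitian matrices and their perturbations. -/

section Resolvent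

open Matrix

variable {ι : Type*} [DecidableEq ι]

/-- The matrix `M` with the entries `(i, j)` and `(j, i)` replaced by zero. -/
def zeroPair (M : Matrix ι ι ℂ) (i j : ι) : Matrix ι ι ℂ :=
  Matrix.of fun a b => if a = i ∧ b = j ∨ a = j ∧ b = i then 0 else M a b

theorem zeroPair_comm (M : Matrix ι ι ℂ) (i j : ι) : zeroPair M i j = zeroPair M j i := by
  ext a b
  simp only [zeroPair, of_apply, or_comm]

theorem isHermitian_zeroPair {M : Matrix ι ι ℂ} (hM : M.IsHermitian) (i j : ι) :
    (zeroPair M i j).IsHermitian := by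
  ext a b
  have h : (b = i ∧ a = j ∨ b = j ∧ a = i) ↔ (a = i ∧ b = j ∨ a = j ∧ b = i) := by tauto
  simp only [conjTranspose_apply, zeroPair, of_apply, h]
  split_ifs
  · simp
  · exact hM.apply a b

theorem sub_zeroPair (M : Matrix ι ι ℂ) {i j : ι} (hij : i ≠ j) :
    M - zeroPair M i j = Matrix.single i j (M i j) + Matrix.single j i (M j i) := by
  ext a b
  simp only [Matrix.sub_apply, Matrix.add_apply, zeroPair, of_apply, Matrix.single_apply]
  by_cases h1 : i = a ∧ j = b
  · obtain ⟨rfl, rfl⟩ := h1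
    simp [hij, hij.symm]
  · by_cases h2 : j = a ∧ i = b
    · obtain ⟨rfl, rfl⟩ := h2
      simp [hij, hij.symm]
    · rw [if_neg (by tauto), if_neg h1, if_neg h2]
      simp

variable [Fintype ι]

/-- The resolvent `(M - z)⁻¹` of a matrix. -/
noncomputable def matrixResolvent (M : Matrix ι ι ℂ) (z : ℂ) : Matrix ι ι ℂ :=
  (M - z • (1 : Matrix ι ι ℂ))⁻¹

/-- Since ⟨u, Mu⟩ is real, Im ⟨u, (M - z)u⟩ = -Im z ‖u‖²; then Cauchy–Schwarz. Both the
invertibility of M - z and the norm bound (Im z)⁻¹ for the resolvent follow. -/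
theorem im_mul_norm_le_norm_toEuclideanLin_sub {M : Matrix ι ι ℂ} (hM : M.IsHermitian) {z : ℂ}
    (hz : 0 < z.im) (u : EuclideanSpace ℂ ι) :
    z.im * ‖u‖ ≤ ‖toEuclideanLin (M - z • (1 : Matrix ι ι ℂ)) u‖ := by
  rcases eq_or_ne u 0 with rfl | hu
  · simp
  have hu' : 0 < ‖u‖ := norm_pos_iff.2 hu
  have hsym := isSymmetric_toEuclideanLin_iff.2 hM
  have hreal : (inner ℂ u (toEuclideanLin M u)).im = 0 := by
    have := hsym.conj_inner_sym u u
    rw [hsym u u] at this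
    exact Complex.conj_eq_iff_im.1 this
  have hmap : toEuclideanLin (M - z • (1 : Matrix ι ι ℂ)) u = toEuclideanLin M u - z • u := by
    rw [map_sub, map_smul]
    simp [toEuclideanLin_eq_toLin_orthonormal]
  have him : (inner ℂ u (toEuclideanLin (M - z • (1 : Matrix ι ι ℂ)) u)).im
      = -(z.im * ‖u‖ ^ 2) := by
    rw [hmap, inner_sub_right, inner_smul_right, inner_self_eq_norm_sq_to_K, Complex.sub_im, hreal]
    simp [← Complex.ofReal_pow]
  have h1 := (Complex.abs_im_le_norm _).trans
    (norm_inner_le_norm (𝕜 := ℂ) u (toEuclideanLin (M - z • (1 : Matrix ι ι ℂ)) u))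
  rw [him, abs_neg, abs_of_nonneg (by positivity)] at h1
  have h2 : ‖u‖ * (z.im * ‖u‖) ≤ ‖u‖ * ‖toEuclideanLin (M - z • (1 : Matrix ι ι ℂ)) u‖ := by
    linarith
  exact le_of_mul_le_mul_left h2 hu'

theorem isUnit_det_sub_smul_one {M : Matrix ι ι ℂ} (hM : M.IsHermitian) {z : ℂ}
    (hz : 0 < z.im) : IsUnit (M - z • (1 : Matrix ι ι ℂ)).det := by
  rw [← isUnit_iff_isUnit_det, ← mulVec_injective_iff_isUnit]
  rw [← coe_mulVecLin, ← LinearMap.ker_eq_bot, LinearMap.ker_eq_bot']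
  intro u hu
  have h := im_mul_norm_le_norm_toEuclideanLin_sub hM hz (WithLp.toLp 2 u)
  rw [toLpLin_apply] at h
  rw [mulVecLin_apply] at hu
  simp only [hu, WithLp.toLp_zero, norm_zero] at h
  have : ‖WithLp.toLp 2 u‖ = 0 :=
    le_antisymm (by nlinarith [norm_nonneg (WithLp.toLp 2 u)]) (norm_nonneg _)
  simpa using this

theorem sub_mul_matrixResolvent {M : Matrix ι ι ℂ} (hM : M.IsHermitian) {z : ℂ}
    (hz : 0 < z.im) : (M - z • (1 : Matrix ι ι ℂ)) * matrixResolvent M z = 1 :=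
  mul_nonsing_inv _ (isUnit_det_sub_smul_one hM hz)

theorem matrixResolvent_mul_sub {M : Matrix ι ι ℂ} (hM : M.IsHermitian) {z : ℂ}
    (hz : 0 < z.im) : matrixResolvent M z * (M - z • (1 : Matrix ι ι ℂ)) = 1 :=
  nonsing_inv_mul _ (isUnit_det_sub_smul_one hM hz)

theorem mul_matrixResolvent {M : Matrix ι ι ℂ} (hM : M.IsHermitian) {z : ℂ}
    (hz : 0 < z.im) : M * matrixResolvent M z = 1 + z • matrixResolvent M z := by
  have := sub_mul_matrixResolvent hM hz
  rw [sub_mul, smul_mul_assoc, one_mul] at this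
  rw [← this]; abel

/-- The second resolvent identity. -/
theorem matrixResolvent_sub_matrixResolvent {M N : Matrix ι ι ℂ} (hM : M.IsHermitian)
    (hN : N.IsHermitian) {z : ℂ} (hz : 0 < z.im) :
    matrixResolvent M z - matrixResolvent N z =
      matrixResolvent M z * (N - M) * matrixResolvent N z := by
  have h1 := matrixResolvent_mul_sub hM hz
  have h2 := sub_mul_matrixResolvent hN hz
  calc _ = matrixResolvent M z * ((N - z • (1 : Matrix ι ι ℂ)) * matrixResolvent N z) -
        (matrixResolvent M z * (M - z • (1 : Matrix ι ι ℂ))) * matrixResolvent N z := by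
        rw [h1, h2, mul_one, one_mul]
    _ = _ := by noncomm_ring

theorem norm_toEuclideanLin_matrixResolvent_le {M : Matrix ι ι ℂ} (hM : M.IsHermitian) {z : ℂ}
    (hz : 0 < z.im) (u : EuclideanSpace ℂ ι) :
    ‖toEuclideanLin (matrixResolvent M z) u‖ ≤ z.im⁻¹ * ‖u‖ := by
  have h := im_mul_norm_le_norm_toEuclideanLin_sub hM hz (toEuclideanLin (matrixResolvent M z) u)
  have e : toEuclideanLin (M - z • (1 : Matrix ι ι ℂ)) (toEuclideanLin (matrixResolvent M z) u)
      = u := by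
    rw [toLpLin_apply, toLpLin_apply, mulVec_mulVec, sub_mul_matrixResolvent hM hz, one_mulVec]
  rw [e] at h
  rw [inv_mul_eq_div, le_div_iff₀ hz]
  linarith

/-- A column is the image of a unit vector. In the loop equation this makes the n² terms |G_ji|² add
up to O(n) only. -/
theorem sum_norm_sq_matrixResolvent_le {M : Matrix ι ι ℂ} (hM : M.IsHermitian) {z : ℂ}
    (hz : 0 < z.im) (b : ι) : ∑ a, ‖matrixResolvent M z a b‖ ^ 2 ≤ (z.im⁻¹) ^ 2 := by
  have h := norm_toEuclideanLin_matrixResolvent_le hM hz (EuclideanSpace.single b 1)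
  have e : ‖toEuclideanLin (matrixResolvent M z) (EuclideanSpace.single b 1)‖ ^ 2
      = ∑ a, ‖matrixResolvent M z a b‖ ^ 2 := by
    rw [EuclideanSpace.norm_sq_eq]
    simp [toLpLin_apply]
  rw [← e]
  rw [PiLp.norm_single, norm_one, mul_one] at h
  gcongr

theorem norm_matrixResolvent_apply_le {M : Matrix ι ι ℂ} (hM : M.IsHermitian) {z : ℂ}
    (hz : 0 < z.im) (a b : ι) : ‖matrixResolvent M z a b‖ ≤ z.im⁻¹ := by
  have h := sum_norm_sq_matrixResolvent_le hM hz b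
  have h2 := Finset.single_le_sum (f := fun a => ‖matrixResolvent M z a b‖ ^ 2)
    (fun i _ => by positivity) (Finset.mem_univ a)
  exact (sq_le_sq₀ (norm_nonneg _) (inv_nonneg.2 hz.le)).1 (h2.trans h)

/-- The trace of a matrix is bounded by its rank times its operator norm. -/
theorem norm_trace_le_rank_mul (K : Matrix ι ι ℂ) {C : ℝ}
    (hK : ∀ u : EuclideanSpace ℂ ι, ‖toEuclideanLin K u‖ ≤ C * ‖u‖) :
    ‖K.trace‖ ≤ K.rank * C := by
  set T := toEuclideanLin K with hT
  set p := LinearMap.range T with hp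
  have htr : LinearMap.trace ℂ _ T = K.trace := by
    change LinearMap.trace ℂ _ (toLpLin 2 2 K) = _
    rw [toLpLin_eq_toLin, trace_toLin_eq]
  have hrank : K.rank = Module.finrank ℂ p := by
    change _ = Module.finrank ℂ (LinearMap.range (toLpLin 2 2 K))
    rw [toLpLin_eq_toLin, ← rank_eq_finrank_range_toLin]
  have hres := LinearMap.trace_restrict_eq_of_forall_mem p T (fun x => LinearMap.mem_range_self T x)
  rw [← htr, ← hres, LinearMap.trace_eq_sum_inner _ (stdOrthonormalBasis ℂ p), hrank]
  refine (norm_sum_le _ _).trans ?_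
  refine (Finset.sum_le_card_nsmul _ _ C fun i _ => ?_).trans (by simp)
  refine (norm_inner_le_norm _ _).trans ?_
  have h1 : ‖(stdOrthonormalBasis ℂ p) i‖ = 1 := (stdOrthonormalBasis ℂ p).norm_eq_one i
  rw [h1, one_mul]
  have h2 := hK ((stdOrthonormalBasis ℂ p) i : p)
  rw [Submodule.coe_norm] at h1
  rw [h1, mul_one] at h2
  exact h2

/-- By the second resolvent identity the difference has rank at most r, and its norm is at most 2
(Im z)⁻¹. The size of N - M does not enter, so unbounded entries are harmless. -/
theorem norm_trace_matrixResolvent_sub_le {M N : Matrix ι ι ℂ} (hM : M.IsHermitian)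
    (hN : N.IsHermitian) {z : ℂ} (hz : 0 < z.im) {r : ℕ} (hr : (N - M).rank ≤ r) :
    ‖(matrixResolvent M z).trace - (matrixResolvent N z).trace‖ ≤ r * (2 * z.im⁻¹) := by
  rw [← trace_sub]
  refine (norm_trace_le_rank_mul _ (C := 2 * z.im⁻¹) fun u => ?_).trans ?_
  · rw [map_sub, LinearMap.sub_apply]
    refine (norm_sub_le _ _).trans ?_
    linarith [norm_toEuclideanLin_matrixResolvent_le hM hz u,
      norm_toEuclideanLin_matrixResolvent_le hN hz u]
  · gcongr
    rw [matrixResolvent_sub_matrixResolvent hM hN hz]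
    exact ((rank_mul_le_left _ _).trans (rank_mul_le_right _ _)).trans hr

/-- Changing one row and the corresponding column of a matrix is a perturbation of rank two. -/
theorem rank_le_two_of_cross {D : Matrix ι ι ℂ} (i : ι) (h : ∀ a b, a ≠ i → b ≠ i → D a b = 0) :
    D.rank ≤ 2 := by
  have e : D = (Matrix.of fun a => ![if a = i then 1 else 0, if a = i then 0 else D a i]) *
      (Matrix.of ![fun b => D i b, Pi.single i 1]) := by
    ext a b
    simp only [mul_apply, Fin.sum_univ_two, of_apply, cons_val_zero, cons_val_one, Pi.single_apply]
    by_cases ha : a = i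
    · subst ha; simp
    · by_cases hb : b = i
      · subst hb; simp [ha]
      · simp [ha, hb, h a b ha hb]
  rw [e]
  exact (rank_mul_le_left _ _).trans ((rank_le_card_width _).trans (by simp))

/-- The complement of the rank bound for small d: the difference has rank at most one and norm at
most |d| (Im z)⁻². -/
theorem norm_trace_matrixResolvent_sub_le_of_diag {M N : Matrix ι ι ℂ} (hM : M.IsHermitian)
    (hN : N.IsHermitian) {z : ℂ} (hz : 0 < z.im) (i : ι) (d : ℂ)
    (h : N - M = Matrix.single i i d) :
    ‖(matrixResolvent M z).trace - (matrixResolvent N z).trace‖ ≤ ‖d‖ * (z.im⁻¹) ^ 2 := by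
  rw [← trace_sub, matrixResolvent_sub_matrixResolvent hM hN hz, h]
  refine (norm_trace_le_rank_mul _ (C := ‖d‖ * (z.im⁻¹) ^ 2) fun u => ?_).trans ?_
  · set w := toEuclideanLin (matrixResolvent N z) u with hw
    have e : toEuclideanLin (matrixResolvent M z * Matrix.single i i d * matrixResolvent N z) u =
        toEuclideanLin (matrixResolvent M z) (EuclideanSpace.single i (d * w i)) := by
      rw [toLpLin_apply, toLpLin_apply, mul_assoc, ← mulVec_mulVec, ← mulVec_mulVec]
      congr 2
      ext a
      rw [single_mulVec]
      simp [hw, toLpLin_apply, Function.update_apply]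
    rw [e]
    refine (norm_toEuclideanLin_matrixResolvent_le hM hz _).trans ?_
    rw [PiLp.norm_single, norm_mul]
    have h1 : ‖w i‖ ≤ z.im⁻¹ * ‖u‖ :=
      (PiLp.norm_apply_le w i).trans (norm_toEuclideanLin_matrixResolvent_le hN hz u)
    calc z.im⁻¹ * (‖d‖ * ‖w i‖) ≤ z.im⁻¹ * (‖d‖ * (z.im⁻¹ * ‖u‖)) := by
          have := hz.le
          gcongr
      _ = _ := by ring
  · have h1 : (matrixResolvent M z * Matrix.single i i d * matrixResolvent N z).rank ≤ 1 := by
      refine (rank_mul_le_left _ _).trans ((rank_mul_le_right _ _).trans ?_)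
      rw [show Matrix.single i i d = vecMulVec (Pi.single i d) (Pi.single i 1) by
        ext a b
        simp only [Matrix.single_apply, vecMulVec_apply, Pi.single_apply]
        grind]
      exact rank_vecMulVec_le _ _
    have h2 : ((matrixResolvent M z * Matrix.single i i d * matrixResolvent N z).rank : ℝ) ≤ 1 := by
      exact_mod_cast h1
    nlinarith [mul_nonneg (norm_nonneg d) (sq_nonneg z.im⁻¹)]

theorem mul_single_add_single_mul_apply (X Y : Matrix ι ι ℂ) (i j : ι) (b c : ℂ) (p q : ι) :
    (X * (Matrix.single i j b + Matrix.single j i c) * Y) p q =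
      X p i * b * Y j q + X p j * c * Y i q := by
  rw [mul_add, add_mul, Matrix.add_apply]
  congr 1
  · rw [mul_assoc, mul_apply, Finset.sum_eq_single i]
    · rw [single_mul_apply_same, mul_assoc]
    · intro k _ hk
      rw [single_mul_apply_of_ne (h := hk), mul_zero]
    · simp
  · rw [mul_assoc, mul_apply, Finset.sum_eq_single j]
    · rw [single_mul_apply_same, mul_assoc]
    · intro k _ hk
      rw [single_mul_apply_of_ne (h := hk), mul_zero]
    · simp

theorem matrixResolvent_sub_zeroPair_apply {M : Matrix ι ι ℂ} (hM : M.IsHermitian) {z : ℂ}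
    (hz : 0 < z.im) {i j : ι} (hij : i ≠ j) (p q : ι) :
    matrixResolvent (zeroPair M i j) z p q - matrixResolvent M z p q =
      matrixResolvent (zeroPair M i j) z p i * M i j * matrixResolvent M z j q +
      matrixResolvent (zeroPair M i j) z p j * M j i * matrixResolvent M z i q := by
  have h := matrixResolvent_sub_matrixResolvent (isHermitian_zeroPair hM i j) hM hz
  rw [sub_zeroPair M hij] at h
  have h2 := congrFun (congrFun h p) q
  rw [mul_single_add_single_mul_apply] at h2
  exact h2

theorem norm_matrixResolvent_sub_zeroPair_le {M : Matrix ι ι ℂ} (hM : M.IsHermitian) {z : ℂ}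
    (hz : 0 < z.im) {i j : ι} (hij : i ≠ j) (p q : ι) :
    ‖matrixResolvent (zeroPair M i j) z p q - matrixResolvent M z p q‖ ≤
      2 * (z.im⁻¹) ^ 2 * ‖M i j‖ := by
  rw [matrixResolvent_sub_zeroPair_apply hM hz hij]
  have hji : ‖M j i‖ = ‖M i j‖ := by rw [← hM.apply j i, norm_star]
  have hM0 := isHermitian_zeroPair hM i j
  have hi : 0 ≤ z.im⁻¹ := inv_nonneg.2 hz.le
  refine (norm_add_le _ _).trans ?_
  rw [norm_mul, norm_mul, norm_mul, norm_mul, hji]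
  calc _ ≤ z.im⁻¹ * ‖M i j‖ * z.im⁻¹ + z.im⁻¹ * ‖M i j‖ * z.im⁻¹ := by
        gcongr <;> apply norm_matrixResolvent_apply_le <;> assumption
    _ = _ := by ring

/-- Second-order expansion of `M i j * (M - z)⁻¹ j i` around the matrix with the entries `(i, j)`
and `(j, i)` removed. -/
theorem norm_entry_expansion_le {M : Matrix ι ι ℂ} (hM : M.IsHermitian) {z : ℂ}
    (hz : 0 < z.im) {i j : ι} (hij : i ≠ j) :
    ‖M i j * matrixResolvent M z j i - M i j * matrixResolvent (zeroPair M i j) z j i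
        + M i j ^ 2 * matrixResolvent (zeroPair M i j) z j i ^ 2
        + (‖M i j‖ : ℂ) ^ 2 * (matrixResolvent (zeroPair M i j) z j j *
          matrixResolvent (zeroPair M i j) z i i)‖ ≤
      (4 * z.im⁻¹ ^ 3 + 2 * z.im⁻¹ ^ 2 + 2 * z.im⁻¹) * (‖M i j‖ ^ 2 * min 1 ‖M i j‖) := by
  set G := matrixResolvent M z with hG
  set H := matrixResolvent (zeroPair M i j) z with hH
  set β := ‖M i j‖ with hβ
  have hi : 0 ≤ z.im⁻¹ := inv_nonneg.2 hz.le
  have hβ0 : 0 ≤ β := norm_nonneg _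
  have hM0 := isHermitian_zeroPair hM i j
  have hHle : ∀ p q, ‖H p q‖ ≤ z.im⁻¹ := norm_matrixResolvent_apply_le hM0 hz
  have hGle : ∀ p q, ‖G p q‖ ≤ z.im⁻¹ := norm_matrixResolvent_apply_le hM hz
  have hsub := norm_matrixResolvent_sub_zeroPair_le hM hz hij
  have hji : M j i = (starRingEnd ℂ) (M i j) := (hM.apply j i).symm
  have hnji : ‖M j i‖ = β := by rw [hji, Complex.norm_conj]
  have hsq : M i j * M j i = (β : ℂ) ^ 2 := by
    rw [hji, Complex.mul_conj, hβ, Complex.normSq_eq_norm_sq]; push_cast; rfl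
  have h1 := matrixResolvent_sub_zeroPair_apply hM hz hij j i
  rw [← hG, ← hH] at h1
  -- What is left after using the first-order identity and replacing every entry of G on its
  -- right-hand side by that of H.
  set R := M i j * (H j i * M i j * (H j i - G j i) + H j j * M j i * (H i i - G i i)) with hR
  have e : M i j * G j i - M i j * H j i + M i j ^ 2 * H j i ^ 2 + (β : ℂ) ^ 2 * (H j j * H i i)
      = R := by
    rw [hR, ← hsq]
    linear_combination (-M i j) * h1
  rw [e]
  have hmul : ‖R‖ ≤ β * (z.im⁻¹ * β * ‖H j i - G j i‖ + z.im⁻¹ * β * ‖H i i - G i i‖) := by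
    rw [hR, norm_mul]
    refine mul_le_mul_of_nonneg_left ((norm_add_le _ _).trans ?_) hβ0
    rw [norm_mul, norm_mul, norm_mul, norm_mul, hnji]
    gcongr <;> apply hHle
  -- For β ≤ 1 the first-order bound on H - G gives a remainder of order β³. For β ≥ 1 the trivial
  -- bound 2 (Im z)⁻¹ gives order β², and 4y² ≤ 2y³ + 2y puts it under the common constant. This
  -- truncation replaces a third-moment assumption.
  rcases le_total β 1 with h | h
  · rw [min_eq_right h]
    calc ‖R‖ ≤ _ := hmul
      _ ≤ β * (z.im⁻¹ * β * (2 * (z.im⁻¹) ^ 2 * β) + z.im⁻¹ * β * (2 * (z.im⁻¹) ^ 2 * β)) := by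
          gcongr <;> apply hsub
      _ = (4 * z.im⁻¹ ^ 3) * (β ^ 2 * β) := by ring
      _ ≤ _ := by
          gcongr
          nlinarith [sq_nonneg z.im⁻¹]
  · rw [min_eq_left h, mul_one]
    have hd : ∀ p q, ‖H p q - G p q‖ ≤ 2 * z.im⁻¹ := fun p q => by
      linarith [norm_sub_le (H p q) (G p q), hHle p q, hGle p q]
    calc ‖R‖ ≤ _ := hmul
      _ ≤ β * (z.im⁻¹ * β * (2 * z.im⁻¹) + z.im⁻¹ * β * (2 * z.im⁻¹)) := by
          gcongr <;> apply hd
      _ = (4 * z.im⁻¹ ^ 2) * β ^ 2 := by ring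
      _ ≤ _ := by
          gcongr
          nlinarith [mul_nonneg hi (sq_nonneg (z.im⁻¹ - 1)), pow_nonneg hi 3]

/-- The eigenvector unitary diagonalises M - z and hence its inverse; the trace does not see the
conjugation. -/
theorem stieltjes_spectralMeasure {M : Matrix ι ι ℂ} (hM : M.IsHermitian) {z : ℂ}
    (hz : 0 < z.im) :
    stieltjes (spectralMeasure M hM) z =
      (Fintype.card ι : ℂ)⁻¹ * (matrixResolvent M z).trace := by
  have h1 : stieltjes (spectralMeasure M hM) z =
      (Fintype.card ι : ℂ)⁻¹ * ∑ i, ((hM.eigenvalues i : ℂ) - z)⁻¹ := by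
    unfold stieltjes spectralMeasure
    rw [integral_smul_measure, integral_finsetSum_measure
      (fun i _ => integrable_inv_ofReal_sub _ hz)]
    simp [Complex.real_smul]
  rw [h1]
  congr 1
  set U := hM.eigenvectorUnitary
  set D : Matrix ι ι ℂ := diagonal fun i => ((hM.eigenvalues i : ℂ) - z)⁻¹ with hD
  have hU : (U : Matrix ι ι ℂ) * star (U : Matrix ι ι ℂ) = 1 := Unitary.mul_star_self_of_mem U.2
  have hU' : star (U : Matrix ι ι ℂ) * (U : Matrix ι ι ℂ) = 1 := Unitary.star_mul_self_of_mem U.2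
  have hspec : M - z • (1 : Matrix ι ι ℂ) =
      U * diagonal (fun i => (hM.eigenvalues i : ℂ) - z) * star (U : Matrix ι ι ℂ) := by
    have h2 := hM.spectral_theorem
    rw [Unitary.conjStarAlgAut_apply] at h2
    have h3 : (diagonal fun i => (hM.eigenvalues i : ℂ) - z) =
        diagonal (RCLike.ofReal ∘ hM.eigenvalues) - z • (1 : Matrix ι ι ℂ) := by
      ext a b
      by_cases hab : a = b
      · subst hab; simp
      · simp [hab]
    rw [h3, mul_sub, sub_mul, ← h2, mul_smul_comm, smul_mul_assoc, mul_one, hU]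
  have hres : matrixResolvent M z = U * D * star (U : Matrix ι ι ℂ) := by
    refine inv_eq_right_inv ?_
    rw [hspec]
    have h4 : (diagonal fun i => (hM.eigenvalues i : ℂ) - z) * D = 1 := by
      rw [hD, diagonal_mul_diagonal, ← diagonal_one]
      congr 1
      funext i
      exact mul_inv_cancel₀ (ofReal_sub_ne_zero hz _)
    calc _ = (U : Matrix ι ι ℂ) * (diagonal fun i => (hM.eigenvalues i : ℂ) - z) *
          (star (U : Matrix ι ι ℂ) * U) * D * star (U : Matrix ι ι ℂ) := by
          simp only [mul_assoc]
      _ = 1 := by rw [hU', mul_one, mul_assoc (U : Matrix ι ι ℂ), h4, mul_one, hU]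
  rw [hres, trace_mul_comm, ← mul_assoc, hU', one_mul, hD, trace_diagonal]

/-- The inverse is det⁻¹ times the adjugate, with 0⁻¹ = 0 at singular matrices, so measurability
holds on all matrices and not only on Hermitian ones. -/
theorem measurable_matrixResolvent_apply (z : ℂ) (a b : ι) :
    Measurable fun M : ι → ι → ℂ => matrixResolvent (Matrix.of M) z a b := by
  have hc : Continuous fun M : ι → ι → ℂ => (Matrix.of M - z • (1 : Matrix ι ι ℂ)) :=
    Continuous.sub (by exact continuous_id) continuous_const
  simp only [matrixResolvent, inv_def, Ring.inverse_eq_inv', Matrix.smul_apply, smul_eq_mul]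
  refine Measurable.mul ?_ ?_
  · exact (hc.matrix_det.measurable).inv
  · exact (hc.matrix_adjugate.matrix_elem a b).measurable

end Resolvent

/-! ### Entries of Wigner matrices: independence and moments. -/

section Wigner

variable {Ω : Type*} [MeasurableSpace Ω] {P : Measure Ω} {n : ℕ} {v : ℝ} {ξ : Measure ℂ}
  {ζ : Measure ℝ} {A : Ω → Matrix (Fin n) (Fin n) ℂ}

theorem IsWigner.entry_conj (hA : IsWigner P n v ξ ζ A) (ω : Ω) (i j : Fin n) :
    A ω j i = (starRingEnd ℂ) (A ω i j) := ((hA.isHermitian ω).apply j i).symm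

/-- An off-diagonal entry of a Wigner matrix is independent of the other entries. -/
theorem IsWigner.indepFun_zeroPair (hA : IsWigner P n v ξ ζ A) {i j : Fin n} (hij : i ≠ j) :
    IndepFun (fun ω => A ω i j) (fun ω a b => zeroPair (A ω) i j a b) P := by
  have main : ∀ {i j : Fin n}, i < j →
      IndepFun (fun ω => A ω i j) (fun ω a b => zeroPair (A ω) i j a b) P := by
    intro i j hij
    set p₀ : {p : Fin n × Fin n // p.1 ≤ p.2} := ⟨(i, j), hij.le⟩ with hp₀
    set T : Finset {p : Fin n × Fin n // p.1 ≤ p.2} := Finset.univ.erase p₀ with hT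
    have h := hA.indep.indepFun_finset {p₀} T (by simp [hT]) (fun p => hA.measurable _ _)
    -- Padding by zero at p₀ and reflecting across the diagonal (the map ψ) rebuilds the truncated
    -- matrix from the upper-triangular entries other than p₀.
    set e : (T → ℂ) → {p : Fin n × Fin n // p.1 ≤ p.2} → ℂ :=
      fun x p => if hp : p ∈ T then x ⟨p, hp⟩ else 0 with he
    have hem : ∀ p, Measurable fun x => e x p := by
      intro p
      by_cases hp : p ∈ T
      · simp only [he, hp, dif_pos]; fun_prop
      · simp only [he, hp, dif_neg, not_false_eq_true]; fun_prop
    set ψ : (T → ℂ) → Fin n → Fin n → ℂ := fun x a b =>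
      if hab : a ≤ b then e x ⟨(a, b), hab⟩
      else (starRingEnd ℂ) (e x ⟨(b, a), (not_le.1 hab).le⟩) with hψ
    have hψm : Measurable ψ := by
      refine measurable_pi_iff.2 fun a => measurable_pi_iff.2 fun b => ?_
      by_cases hab : a ≤ b
      · simp only [hψ, hab, dif_pos]; exact hem _
      · simp only [hψ, hab, dif_neg, not_false_eq_true]
        exact (Complex.continuous_conj.measurable).comp (hem _)
    have hφm : Measurable fun x : ({p₀} : Finset {p : Fin n × Fin n // p.1 ≤ p.2}) → ℂ =>
        x ⟨p₀, Finset.mem_singleton_self _⟩ := measurable_pi_apply _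
    have h2 := h.comp hφm hψm
    have e2 : (fun ω a b => zeroPair (A ω) i j a b) = ψ ∘ fun ω (p : T) => A ω p.1.1.1 p.1.1.2 := by
      funext ω a b
      simp only [hψ, he, hT, Function.comp_apply, zeroPair, Matrix.of_apply, Finset.mem_erase,
        Finset.mem_univ, and_true, hp₀, ne_eq, Subtype.mk.injEq, Prod.mk.injEq]
      by_cases hab : a ≤ b
      · rw [dif_pos hab]
        have h3 : ¬ (a = j ∧ b = i) := by
          rintro ⟨rfl, rfl⟩; exact absurd hij (not_lt.2 hab)
        by_cases h4 : a = i ∧ b = j <;> simp [h3, h4]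
      · rw [dif_neg hab]
        have h3 : ¬ (a = i ∧ b = j) := by
          rintro ⟨rfl, rfl⟩; exact hab hij.le
        by_cases h4 : a = j ∧ b = i
        · simp [h4]
        · have h5 : ¬ (b = i ∧ a = j) := fun h => h4 h.symm
          simp [h3, h4, h5, hA.entry_conj ω b a]
    rw [e2]
    exact h2
  rcases lt_or_gt_of_ne hij with h | h
  · exact main h
  · have h2 := (main h).comp (φ := starRingEnd ℂ) (ψ := id)
      Complex.continuous_conj.measurable measurable_id
    simp_rw [zeroPair_comm _ i j]
    rw [show (fun ω => A ω i j) = starRingEnd ℂ ∘ fun ω => A ω j i from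
      funext fun ω => hA.entry_conj ω j i]
    exact h2

/-- The expectation of a function of the modulus of an off-diagonal entry of a Wigner matrix. -/
theorem IsWigner.integral_norm_entry (hA : IsWigner P n v ξ ζ A) {i j : Fin n} (hij : i ≠ j)
    {g : ℝ → ℝ} (hg : Measurable g) :
    ∫ ω, g (√(n : ℝ) * ‖A ω i j‖) ∂P = ∫ x, g ‖x‖ ∂ξ := by
  have main : ∀ {i j : Fin n}, i < j → ∫ ω, g (√(n : ℝ) * ‖A ω i j‖) ∂P = ∫ x, g ‖x‖ ∂ξ := by
    intro i j hij
    have hm := hA.measurable i j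
    rw [← hA.map_offDiag i j hij, integral_map (by fun_prop)
      (by exact (hg.comp measurable_norm).aestronglyMeasurable)]
    refine integral_congr_ae (Eventually.of_forall fun ω => ?_)
    simp [abs_of_nonneg (Real.sqrt_nonneg _)]
  rcases lt_or_gt_of_ne hij with h | h
  · exact main h
  · rw [← main h]
    simp_rw [hA.entry_conj _ j i, Complex.norm_conj]

theorem IsWigner.memLp_entry (hA : IsWigner P n v ξ ζ A) (hn : 0 < n) {i j : Fin n}
    (hij : i ≠ j) : MemLp (fun ω => A ω i j) 2 P := by
  have main : ∀ {i j : Fin n}, i < j → MemLp (fun ω => A ω i j) 2 P := by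
    intro i j hij
    have hm := hA.measurable i j
    have h := hA.memLp
    rw [← hA.map_offDiag i j hij, memLp_map_measure_iff (by fun_prop) (by fun_prop)] at h
    have h2 := h.const_mul ((√(n : ℝ) : ℂ)⁻¹)
    have hs : ((√(n : ℝ) : ℝ) : ℂ) ≠ 0 := by
      have : 0 < √(n : ℝ) := Real.sqrt_pos.2 (by exact_mod_cast hn)
      exact_mod_cast this.ne'
    convert h2 using 1
    funext ω
    simp only [Function.comp_apply, id_eq]
    rw [← mul_assoc, inv_mul_cancel₀ hs, one_mul]
  rcases lt_or_gt_of_ne hij with h | h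
  · exact main h
  · refine (main h).of_le (hA.measurable i j).aestronglyMeasurable
      (Eventually.of_forall fun ω => ?_)
    rw [hA.entry_conj ω j i, Complex.norm_conj]

theorem IsWigner.integral_entry (hA : IsWigner P n v ξ ζ A) (hn : 0 < n) {i j : Fin n}
    (hij : i ≠ j) : ∫ ω, A ω i j ∂P = 0 := by
  have hs : ((√(n : ℝ) : ℝ) : ℂ) ≠ 0 := by
    have : 0 < √(n : ℝ) := Real.sqrt_pos.2 (by exact_mod_cast hn)
    exact_mod_cast this.ne'
  have main : ∀ {i j : Fin n}, i < j → ∫ ω, A ω i j ∂P = 0 := by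
    intro i j hij
    have hm := hA.measurable i j
    have h := hA.mean
    rw [← hA.map_offDiag i j hij, integral_map (by fun_prop) (by fun_prop),
      integral_const_mul] at h
    exact (mul_eq_zero.1 h).resolve_left hs
  rcases lt_or_gt_of_ne hij with h | h
  · exact main h
  · simp_rw [hA.entry_conj _ j i]
    rw [integral_conj, main h, map_zero]

theorem IsWigner.integral_norm_sq_entry (hA : IsWigner P n v ξ ζ A) (hn : 0 < n) {i j : Fin n}
    (hij : i ≠ j) : ∫ ω, ‖A ω i j‖ ^ 2 ∂P = v / n := by
  have hn' : (0 : ℝ) < n := by exact_mod_cast hn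
  have h := hA.integral_norm_entry hij (g := fun x => x ^ 2) (by fun_prop)
  rw [hA.variance] at h
  simp_rw [mul_pow, Real.sq_sqrt hn'.le] at h
  rw [integral_const_mul] at h
  rw [eq_div_iff hn'.ne', mul_comm]
  exact h

theorem IsWigner.integrable_norm_sq_entry (hA : IsWigner P n v ξ ζ A) (hn : 0 < n) {i j : Fin n}
    (hij : i ≠ j) : Integrable (fun ω => ‖A ω i j‖ ^ 2) P :=
  (hA.memLp_entry hn hij).norm.integrable_sq

/-- Shows that the remainder of the entry expansion is o(1/n) in mean, since the integral on the
right tends to zero. -/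
theorem IsWigner.integral_norm_sq_mul_min_entry (hA : IsWigner P n v ξ ζ A) (hn : 0 < n)
    {i j : Fin n} (hij : i ≠ j) :
    ∫ ω, ‖A ω i j‖ ^ 2 * min 1 ‖A ω i j‖ ∂P =
      (∫ x, ‖x‖ ^ 2 * min 1 (‖x‖ / √(n : ℝ)) ∂ξ) / n := by
  have hn' : (0 : ℝ) < n := by exact_mod_cast hn
  have hs : √(n : ℝ) ≠ 0 := (Real.sqrt_pos.2 hn').ne'
  have h := hA.integral_norm_entry hij (g := fun x => x ^ 2 * min 1 (x / √(n : ℝ))) (by fun_prop)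
  rw [← h, eq_div_iff hn'.ne', ← integral_mul_const]
  refine integral_congr_ae (Eventually.of_forall fun ω => ?_)
  simp only
  rw [mul_pow, Real.sq_sqrt hn'.le, mul_div_cancel_left₀ _ hs]
  ring

/-- The random matrix with its diagonal replaced by zero. -/
def zeroDiag {ι : Type*} [DecidableEq ι] (M : Matrix ι ι ℂ) : Matrix ι ι ℂ :=
  Matrix.of fun a b => if a = b then 0 else M a b

/-- The law ζ need not have any moment, so the loop equation is derived only for the matrix without
its diagonal. -/
theorem IsWigner.zeroDiag [IsProbabilityMeasure P] (hA : IsWigner P n v ξ ζ A) :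
    IsWigner P n v ξ (Measure.dirac 0) fun ω => zeroDiag (A ω) where
  measurable i j := by
    have := hA.measurable i j
    simp only [_root_.zeroDiag, Matrix.of_apply]
    split_ifs
    · fun_prop
    · exact this
  isHermitian ω := by
    ext a b
    simp only [_root_.zeroDiag, Matrix.of_apply, Matrix.conjTranspose_apply]
    by_cases h : a = b
    · simp [h]
    · rw [if_neg h, if_neg (Ne.symm h)]
      exact (hA.isHermitian ω).apply a b
  map_offDiag i j hij := by
    simp only [_root_.zeroDiag, Matrix.of_apply, if_neg hij.ne]
    exact hA.map_offDiag i j hij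
  map_diag i := by
    simp [_root_.zeroDiag]
  indep := by
    have h := hA.indep.comp (fun p x => if p.1.1 = p.1.2 then (0 : ℂ) else x) (fun p => by
      split_ifs <;> fun_prop)
    exact h
  memLp := hA.memLp
  mean := hA.mean
  variance := hA.variance

end Wigner

/-! ### Concentration of the normalized resolvent trace. -/

section Concentration

open Matrix

/-- The normalized trace of the resolvent of a matrix. -/
noncomputable def resolventMean {ι : Type*} [Fintype ι] [DecidableEq ι] (M : Matrix ι ι ℂ) (z : ℂ) :
    ℂ :=
  (Fintype.card ι : ℂ)⁻¹ * (matrixResolvent M z).trace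

theorem norm_resolventMean_le {ι : Type*} [Fintype ι] [DecidableEq ι] [Nonempty ι]
    {M : Matrix ι ι ℂ} (hM : M.IsHermitian) {z : ℂ} (hz : 0 < z.im) :
    ‖resolventMean M z‖ ≤ z.im⁻¹ := by
  rw [resolventMean, ← stieltjes_spectralMeasure hM hz]
  exact norm_stieltjes_le _ hz

theorem im_resolventMean_nonneg {ι : Type*} [Fintype ι] [DecidableEq ι] [Nonempty ι]
    {M : Matrix ι ι ℂ} (hM : M.IsHermitian) {z : ℂ} (hz : 0 < z.im) :
    0 ≤ (resolventMean M z).im := by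
  rw [resolventMean, ← stieltjes_spectralMeasure hM hz]
  exact im_stieltjes_nonneg _ hz

theorem measurable_resolventMean {ι : Type*} [Fintype ι] [DecidableEq ι] (z : ℂ) :
    Measurable fun M : ι → ι → ℂ => resolventMean (Matrix.of M) z := by
  simp only [resolventMean, trace, diag_apply]
  exact (Finset.measurable_fun_sum _ fun i _ => measurable_matrixResolvent_apply z i i).const_mul _

variable {n : ℕ}

/-- The Hermitian matrix determined by the rows `x i` of its upper triangle. -/
noncomputable def hermitianOfRows (x : Fin n → Fin n → ℂ) : Matrix (Fin n) (Fin n) ℂ :=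
  Matrix.of fun i j =>
    if i < j then x i j else if j < i then (starRingEnd ℂ) (x j i) else ((x i i).re : ℂ)

/-- No condition on x: the part below the diagonal is ignored and the diagonal made real.
McDiarmid's inequality needs the bounded differences at every point of the product space. -/
theorem isHermitian_hermitianOfRows (x : Fin n → Fin n → ℂ) : (hermitianOfRows x).IsHermitian := by
  ext i j
  simp only [conjTranspose_apply, hermitianOfRows, of_apply]
  rcases lt_trichotomy i j with h | rfl | h
  · simp [h, h.not_gt]
  · simp
  · simp [h, h.not_gt]

theorem measurable_hermitianOfRows :
    Measurable fun (x : Fin n → Fin n → ℂ) (a b : Fin n) => hermitianOfRows x a b := by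
  refine measurable_pi_iff.2 fun a => measurable_pi_iff.2 fun b => ?_
  simp only [hermitianOfRows, of_apply]
  have hm : ∀ a b : Fin n, Measurable fun x : Fin n → Fin n → ℂ => x a b := fun a b => by fun_prop
  split_ifs
  · exact hm a b
  · exact Complex.continuous_conj.measurable.comp (hm b a)
  · exact Complex.measurable_ofReal.comp (Complex.measurable_re.comp (hm a a))

/-- A new row x i changes only row i and column i of the matrix, a perturbation of rank at most two.
-/
theorem norm_resolventMean_update_sub_le (hn : 0 < n) (x : Fin n → Fin n → ℂ) (i : Fin n)
    (e : Fin n → ℂ) {z : ℂ} (hz : 0 < z.im) :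
    ‖resolventMean (hermitianOfRows (Function.update x i e)) z -
      resolventMean (hermitianOfRows x) z‖ ≤ 4 * z.im⁻¹ / n := by
  have hn' : (0 : ℝ) < n := by exact_mod_cast hn
  have hr : (hermitianOfRows x - hermitianOfRows (Function.update x i e)).rank ≤ 2 := by
    refine rank_le_two_of_cross i fun a b ha hb => ?_
    simp [hermitianOfRows, Function.update_of_ne ha, Function.update_of_ne hb]
  have h := norm_trace_matrixResolvent_sub_le (isHermitian_hermitianOfRows (Function.update x i e))
    (isHermitian_hermitianOfRows x) hz hr
  rw [resolventMean, resolventMean, ← mul_sub, norm_mul, norm_inv, Complex.norm_natCast,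
    Fintype.card_fin, inv_mul_eq_div]
  gcongr
  push_cast at h
  linarith

variable {Ω : Type*} [MeasurableSpace Ω] {P : Measure Ω} {v : ℝ} {ξ : Measure ℂ}
  {ζ : Measure ℝ} {A : Ω → Matrix (Fin n) (Fin n) ℂ}

theorem IsWigner.measurable_matrix (hA : IsWigner P n v ξ ζ A) :
    Measurable fun ω (a b : Fin n) => A ω a b :=
  measurable_pi_iff.2 fun a => measurable_pi_iff.2 fun b => hA.measurable a b

theorem IsWigner.measurable_resolventMean (hA : IsWigner P n v ξ ζ A) (z : ℂ) :
    Measurable fun ω => resolventMean (A ω) z :=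
  (_root_.measurable_resolventMean z).comp hA.measurable_matrix

theorem IsWigner.integrable_resolventMean [IsProbabilityMeasure P] (hA : IsWigner P n v ξ ζ A)
    (hn : 0 < n) {z : ℂ} (hz : 0 < z.im) : Integrable (fun ω => resolventMean (A ω) z) P := by
  have : Nonempty (Fin n) := ⟨⟨0, hn⟩⟩
  exact Integrable.of_bound (hA.measurable_resolventMean z).aestronglyMeasurable _
    (Eventually.of_forall fun ω => norm_resolventMean_le (hA.isHermitian ω) hz)

/-- Grouping by rows matters: n blocks with differences O(1/n) give the variance proxy n · O(n⁻²) =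
O(1/n), while the same differences over the individual entries would give only O(1). -/
theorem IsWigner.iIndepFun_rows (hA : IsWigner P n v ξ ζ A) :
    iIndepFun (fun (i : Fin n) ω (j : Fin n) => if i ≤ j then A ω i j else 0) P := by
  have h := hA.indep.precomp
    (g := fun q : (i : Fin n) × {j : Fin n // i ≤ j} =>
      (⟨(q.1, q.2.1), q.2.2⟩ : {p : Fin n × Fin n // p.1 ≤ p.2}))
    (by
      rintro ⟨a, b, hb⟩ ⟨c, d, hd⟩ h
      simp only [Subtype.mk.injEq, Prod.mk.injEq] at h
      obtain ⟨rfl, rfl⟩ := h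
      rfl)
  have h2 := iIndepFun_curry (X := fun (i : Fin n) (j : {j : Fin n // i ≤ j}) ω => A ω i j)
    (fun i j => hA.measurable _ _) h
  have h3 := h2.comp (fun i x (j : Fin n) => if h : i ≤ j then x ⟨j, h⟩ else 0) (fun i => by
    refine measurable_pi_iff.2 fun j => ?_
    split_ifs
    · exact measurable_pi_apply _
    · fun_prop)
  exact h3

theorem IsWigner.hermitianOfRows_eq (hA : IsWigner P n v ξ ζ A) (ω : Ω) :
    hermitianOfRows (fun i j => if i ≤ j then A ω i j else 0) = A ω := by
  ext i j
  simp only [hermitianOfRows, of_apply]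
  rcases lt_trichotomy i j with h | rfl | h
  · simp [h, h.le]
  · simp only [lt_self_iff_false, if_false, le_refl, if_true]
    exact (hA.isHermitian ω).coe_re_apply_self i
  · simp [h, h.le, h.not_gt, hA.entry_conj ω j i]

/-- Sub-Gaussian concentration of the normalized trace of the resolvent of a Wigner matrix. -/
theorem IsWigner.hasSubgaussianMGF_resolventMean [IsProbabilityMeasure P]
    (hA : IsWigner P n v ξ ζ A) (hn : 0 < n) {z : ℂ} (hz : 0 < z.im) {φ : ℂ → ℝ}
    (hφ : LipschitzWith 1 φ) (hφ0 : φ 0 = 0) :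
    HasSubgaussianMGF (fun ω => φ (resolventMean (A ω) z) - ∫ ω, φ (resolventMean (A ω) z) ∂P)
      (16 * (z.im.toNNReal⁻¹) ^ 2 / n) P := by
  have hn' : (0 : ℝ) < n := by exact_mod_cast hn
  have : Nonempty (Fin n) := ⟨⟨0, hn⟩⟩
  set X : Fin n → Ω → Fin n → ℂ := fun i ω j => if i ≤ j then A ω i j else 0 with hX
  have hXm : ∀ i, Measurable (X i) := fun i => measurable_pi_iff.2 fun j => by
    simp only [hX]
    split_ifs
    · exact hA.measurable i j
    · fun_prop
  have hmap := hA.iIndepFun_rows.map_fun_eq_pi_map (fun i => (hXm i).aemeasurable)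
  have : ∀ i, IsProbabilityMeasure (P.map (X i)) :=
    fun i => Measure.isProbabilityMeasure_map (hXm i).aemeasurable
  have hφ1 : ∀ u w, |φ u - φ w| ≤ ‖u - w‖ := fun u w => by
    simpa [dist_eq_norm] using hφ.dist_le_mul u w
  set f : (Fin n → Fin n → ℂ) → ℝ := fun x => φ (resolventMean (hermitianOfRows x) z) with hf
  have hfm : Measurable f := by
    refine hφ.continuous.measurable.comp ?_
    exact (_root_.measurable_resolventMean z).comp measurable_hermitianOfRows
  have hfA : ∀ ω, φ (resolventMean (A ω) z) = f fun i => X i ω := by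
    intro ω
    simp only [hf, hX]
    rw [hA.hermitianOfRows_eq ω]
  set c : ℝ≥0 := 4 * z.im.toNNReal⁻¹ / n with hc
  have hmc := hasSubgaussianMGF_pi_of_bounded_differences (c := c) (M := z.im⁻¹) n
    (fun i => P.map (X i)) hfm (fun x => by
      have h1 := hφ1 (resolventMean (hermitianOfRows x) z) 0
      rw [hφ0, sub_zero, sub_zero] at h1
      exact h1.trans (norm_resolventMean_le (isHermitian_hermitianOfRows x) hz))
    (fun x i e => by
      refine (hφ1 _ _).trans ((norm_resolventMean_update_sub_le hn x i e hz).trans_eq ?_)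
      simp [hc, Real.coe_toNNReal _ hz.le])
  rw [← hmap] at hmc
  have hXM : Measurable fun ω i => X i ω := measurable_pi_iff.2 hXm
  rw [integral_map hXM.aemeasurable hfm.aestronglyMeasurable] at hmc
  have h := HasSubgaussianMGF.of_map hXM.aemeasurable hmc
  have hcc : n * c ^ 2 = 16 * (z.im.toNNReal⁻¹) ^ 2 / n := by
    rw [hc]
    have : (n : ℝ≥0) ≠ 0 := by exact_mod_cast hn.ne'
    field_simp
    norm_num
  rw [hcc] at h
  simp_rw [hfA]
  exact h

/-- The second moment of a sub-Gaussian random variable. -/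
theorem integral_sq_le_of_hasSubgaussianMGF [IsProbabilityMeasure P] {X : Ω → ℝ} {c : ℝ≥0}
    (h : HasSubgaussianMGF X c P) : ∫ ω, X ω ^ 2 ∂P ≤ 4 * (Real.exp (c / 2) - 1) := by
  have h1 := h.integrable_exp_mul 1
  have h2 := h.integrable_exp_mul (-1)
  have hm1 := h.mgf_le 1
  have hm2 := h.mgf_le (-1)
  rw [mgf] at hm1 hm2
  -- From e^|x| ≥ 1 + |x| + x²/2 and e^(-|x|) ≥ 1 - |x|; only the moment generating function at ±1
  -- is used.
  have hb : ∀ ω, X ω ^ 2 ≤ 2 * (Real.exp (1 * X ω) + Real.exp (-1 * X ω)) - 4 := by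
    intro ω
    have e1 := Real.quadratic_le_exp_of_nonneg (abs_nonneg (X ω))
    have e2 := Real.add_one_le_exp (-|X ω|)
    rw [sq_abs] at e1
    rcases abs_cases (X ω) with ⟨h, _⟩ | ⟨h, _⟩ <;> rw [h] at e1 e2 <;>
      simp only [one_mul, neg_one_mul, neg_neg] at e1 e2 ⊢ <;> linarith
  calc _ ≤ ∫ ω, 2 * (Real.exp (1 * X ω) + Real.exp (-1 * X ω)) - 4 ∂P :=
        integral_mono_of_nonneg (Eventually.of_forall fun ω => sq_nonneg _)
          (((h1.add h2).const_mul 2).sub (integrable_const _)) (Eventually.of_forall hb)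
    _ = 2 * (∫ ω, Real.exp (1 * X ω) ∂P + ∫ ω, Real.exp (-1 * X ω) ∂P) - 4 := by
        rw [integral_sub (by exact (h1.add h2).const_mul 2) (integrable_const _),
          integral_const_mul, integral_add h1 h2]
        simp
    _ ≤ _ := by
        norm_num at hm1 hm2 ⊢
        linarith

end Concentration

/-! ### The loop equation for a single pair of entries. -/

section Expectation

open Matrix

/-- The error in the approximate loop equation for Wigner matrices, with `y = (Im z)⁻¹`. -/
noncomputable def wignerError (ξ : Measure ℂ) (v y : ℝ) (n : ℕ) : ℝ :=
  (4 * y ^ 3 + 2 * y ^ 2 + 2 * y) * ∫ x, ‖x‖ ^ 2 * min 1 (‖x‖ / √(n : ℝ)) ∂ξ +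
    8 * v ^ 2 * y ^ 4 / n + 2 * v * (1 + v) * y ^ 3 / √(n : ℝ)

/-- Dominated convergence with bound |x|²: a Lindeberg-type condition, automatic because the law
does not depend on n. -/
theorem tendsto_integral_sq_mul_min (ξ : Measure ℂ) (hξ : MemLp id 2 ξ) :
    Tendsto (fun n : ℕ => ∫ x, ‖x‖ ^ 2 * min 1 (‖x‖ / √(n : ℝ)) ∂ξ) atTop (𝓝 0) := by
  have hsqrt : Tendsto (fun n : ℕ => √(n : ℝ)) atTop atTop :=
    Real.tendsto_sqrt_atTop.comp tendsto_natCast_atTop_atTop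
  have h := tendsto_integral_of_dominated_convergence (μ := ξ)
    (F := fun (n : ℕ) x => ‖x‖ ^ 2 * min 1 (‖x‖ / √(n : ℝ))) (f := fun _ => (0 : ℝ))
    (fun x => ‖x‖ ^ 2) (fun n => by fun_prop) hξ.norm.integrable_sq
    (fun n => Eventually.of_forall fun x => ?_) (Eventually.of_forall fun x => ?_)
  · simpa using h
  · rw [Real.norm_of_nonneg (by positivity)]
    exact mul_le_of_le_one_right (by positivity) (min_le_left _ _)
  · have h1 : Tendsto (fun n : ℕ => ‖x‖ / √(n : ℝ)) atTop (𝓝 0) :=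
      tendsto_const_nhds.div_atTop hsqrt
    have h2 := (tendsto_const_nhds (x := (1 : ℝ))).min h1
    have h3 := h2.const_mul (‖x‖ ^ 2)
    simpa using h3

theorem tendsto_wignerError (ξ : Measure ℂ) (hξ : MemLp id 2 ξ) (v y : ℝ) :
    Tendsto (wignerError ξ v y) atTop (𝓝 0) := by
  have hsqrt : Tendsto (fun n : ℕ => √(n : ℝ)) atTop atTop :=
    Real.tendsto_sqrt_atTop.comp tendsto_natCast_atTop_atTop
  have h1 := (tendsto_integral_sq_mul_min ξ hξ).const_mul (4 * y ^ 3 + 2 * y ^ 2 + 2 * y)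
  have h2 : Tendsto (fun n : ℕ => 8 * v ^ 2 * y ^ 4 / (n : ℝ)) atTop (𝓝 0) :=
    tendsto_const_nhds.div_atTop tendsto_natCast_atTop_atTop
  have h3 : Tendsto (fun n : ℕ => 2 * v * (1 + v) * y ^ 3 / √(n : ℝ)) atTop (𝓝 0) :=
    tendsto_const_nhds.div_atTop hsqrt
  have h := (h1.add h2).add h3
  simp only [mul_zero, add_zero] at h
  exact h

theorem wignerError_nonneg (ξ : Measure ℂ) {v y : ℝ} (hv : 0 ≤ v) (hy : 0 ≤ y) (n : ℕ) :
    0 ≤ wignerError ξ v y n := by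
  unfold wignerError
  have : 0 ≤ ∫ x, ‖x‖ ^ 2 * min 1 (‖x‖ / √(n : ℝ)) ∂ξ := integral_nonneg fun x => by positivity
  positivity

variable {Ω : Type*} [MeasurableSpace Ω] {P : Measure Ω} [IsProbabilityMeasure P] {n : ℕ} {v : ℝ}
  {ξ : Measure ℂ} {ζ : Measure ℝ} {A : Ω → Matrix (Fin n) (Fin n) ℂ}

/-- The contribution of a pair of off-diagonal entries to the loop equation. -/
theorem IsWigner.norm_integral_entry_mul_resolvent_le (hA : IsWigner P n v ξ ζ A) (hn : 0 < n)
    {z : ℂ} (hz : 0 < z.im) {i j : Fin n} (hij : i ≠ j) :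
    ‖∫ ω, A ω i j * matrixResolvent (A ω) z j i ∂P + (v / n : ℝ) *
      ∫ ω, matrixResolvent (A ω) z j j * matrixResolvent (A ω) z i i ∂P‖ ≤
    (wignerError ξ v z.im⁻¹ n + 2 * v * ∫ ω, ‖matrixResolvent (A ω) z j i‖ ^ 2 ∂P) / n := by
  have hn' : (0 : ℝ) < n := by exact_mod_cast hn
  set y := z.im⁻¹ with hy
  have hy0 : 0 ≤ y := inv_nonneg.2 hz.le
  have hvn := hA.integral_norm_sq_entry hn hij
  have hv : 0 ≤ v / n := hvn ▸ integral_nonneg fun ω => sq_nonneg _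
  have hv0 : 0 ≤ v := by
    have := mul_nonneg hv hn'.le
    rwa [div_mul_cancel₀ _ hn'.ne'] at this
  have hsqi := hA.integrable_norm_sq_entry hn hij
  set G : Fin n → Fin n → Ω → ℂ := fun a b ω => matrixResolvent (A ω) z a b with hG
  set H : Fin n → Fin n → Ω → ℂ := fun a b ω => matrixResolvent (zeroPair (A ω) i j) z a b with hH
  set b : Ω → ℂ := fun ω => A ω i j with hb
  have hbm : Measurable b := hA.measurable i j
  have hind := hA.indepFun_zeroPair hij
  have hGm : ∀ p q, Measurable (G p q) := fun p q =>
    (measurable_matrixResolvent_apply z p q).comp hA.measurable_matrix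
  have hzm : Measurable fun ω a b => zeroPair (A ω) i j a b := by
    refine measurable_pi_iff.2 fun a => measurable_pi_iff.2 fun b => ?_
    simp only [zeroPair, of_apply]
    split_ifs
    · fun_prop
    · exact hA.measurable a b
  have hHm : ∀ p q, Measurable (H p q) := fun p q =>
    (measurable_matrixResolvent_apply z p q).comp hzm
  have hGle : ∀ p q ω, ‖G p q ω‖ ≤ y := fun p q ω =>
    norm_matrixResolvent_apply_le (hA.isHermitian ω) hz p q
  have hHle : ∀ p q ω, ‖H p q ω‖ ≤ y := fun p q ω =>
    norm_matrixResolvent_apply_le (isHermitian_zeroPair (hA.isHermitian ω) i j) hz p q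
  have hHG : ∀ p q ω, ‖H p q ω - G p q ω‖ ≤ 2 * y ^ 2 * ‖b ω‖ := fun p q ω =>
    norm_matrixResolvent_sub_zeroPair_le (hA.isHermitian ω) hz hij p q
  have hbL : MemLp b 2 P := hA.memLp_entry hn hij
  have hbi : Integrable b P := hbL.integrable (by norm_num)
  have hsq1 : Integrable (fun ω => b ω ^ 2) P := by
    refine hsqi.mono' (by fun_prop) (Eventually.of_forall fun ω => ?_)
    exact (norm_pow _ _).le
  have hsq2 : Integrable (fun ω => (‖b ω‖ : ℂ) ^ 2) P := by
    refine hsqi.mono' (by fun_prop) (Eventually.of_forall fun ω => ?_)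
    simp [hb]
  -- independence
  have t1 : ∫ ω, b ω * H j i ω ∂P = 0 := by
    have h := (hind.comp (φ := id) (ψ := fun M => matrixResolvent (Matrix.of M) z j i)
      measurable_id (measurable_matrixResolvent_apply z j i)).integral_fun_mul_eq_mul_integral
      hbm.aestronglyMeasurable (hHm j i).aestronglyMeasurable
    have h0 : ∫ ω, b ω ∂P = 0 := hA.integral_entry hn hij
    simp only [Function.comp_def, id_eq] at h
    rw [h0, zero_mul] at h
    exact h
  have t2 : ∫ ω, b ω ^ 2 * H j i ω ^ 2 ∂P = (∫ ω, b ω ^ 2 ∂P) * ∫ ω, H j i ω ^ 2 ∂P := by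
    exact (hind.comp (φ := fun x => x ^ 2)
      (ψ := fun M => matrixResolvent (Matrix.of M) z j i ^ 2) (by fun_prop)
      ((measurable_matrixResolvent_apply z j i).pow_const 2)).integral_fun_mul_eq_mul_integral
      (by exact (hbm.pow_const 2).aestronglyMeasurable)
      (by exact ((hHm j i).pow_const 2).aestronglyMeasurable)
  have t3 : ∫ ω, (‖b ω‖ : ℂ) ^ 2 * (H j j ω * H i i ω) ∂P =
      (v / n : ℝ) * ∫ ω, H j j ω * H i i ω ∂P := by
    have h := (hind.comp (φ := fun x => (‖x‖ : ℂ) ^ 2)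
      (ψ := fun M => matrixResolvent (Matrix.of M) z j j * matrixResolvent (Matrix.of M) z i i)
      (by fun_prop) ((measurable_matrixResolvent_apply z j j).mul
        (measurable_matrixResolvent_apply z i i))).integral_fun_mul_eq_mul_integral
      (by exact hsq2.aestronglyMeasurable)
      (by exact ((hHm j j).mul (hHm i i)).aestronglyMeasurable)
    have h0 : ∫ ω, (‖b ω‖ : ℂ) ^ 2 ∂P = (v / n : ℝ) := by
      rw [← hvn, ← integral_complex_ofReal]
      push_cast
      rfl
    rw [← h0]
    exact h
  -- integrability of the terms
  have iG : Integrable (fun ω => b ω * G j i ω) P :=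
    hbi.mul_bdd (c := y) (hGm j i).aestronglyMeasurable (Eventually.of_forall (hGle j i))
  have iH1 : Integrable (fun ω => b ω * H j i ω) P :=
    hbi.mul_bdd (c := y) (hHm j i).aestronglyMeasurable (Eventually.of_forall (hHle j i))
  have iH2 : Integrable (fun ω => b ω ^ 2 * H j i ω ^ 2) P :=
    hsq1.mul_bdd (c := y ^ 2) ((hHm j i).pow_const 2).aestronglyMeasurable
      (Eventually.of_forall fun ω => by
        rw [norm_pow]
        exact pow_le_pow_left₀ (norm_nonneg _) (hHle j i ω) 2)
  have bHH : ∀ ω, ‖H j j ω * H i i ω‖ ≤ y * y := fun ω => by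
    rw [norm_mul]; exact mul_le_mul (hHle _ _ _) (hHle _ _ _) (norm_nonneg _) hy0
  have bGG : ∀ ω, ‖G j j ω * G i i ω‖ ≤ y * y := fun ω => by
    rw [norm_mul]; exact mul_le_mul (hGle _ _ _) (hGle _ _ _) (norm_nonneg _) hy0
  have iH3 : Integrable (fun ω => (‖b ω‖ : ℂ) ^ 2 * (H j j ω * H i i ω)) P :=
    hsq2.mul_bdd (c := y * y) ((hHm j j).mul (hHm i i)).aestronglyMeasurable
      (Eventually.of_forall bHH)
  have iHH : Integrable (fun ω => H j j ω * H i i ω) P :=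
    Integrable.of_bound ((hHm j j).mul (hHm i i)).aestronglyMeasurable _ (Eventually.of_forall bHH)
  have iGG : Integrable (fun ω => G j j ω * G i i ω) P :=
    Integrable.of_bound ((hGm j j).mul (hGm i i)).aestronglyMeasurable _ (Eventually.of_forall bGG)
  have iHsq : Integrable (fun ω => ‖H j i ω‖ ^ 2) P :=
    Integrable.of_bound ((hHm j i).norm.pow_const 2).aestronglyMeasurable (y ^ 2)
      (Eventually.of_forall fun ω => by
        rw [norm_pow, norm_norm]; exact pow_le_pow_left₀ (norm_nonneg _) (hHle j i ω) 2)
  have iGsq : Integrable (fun ω => ‖G j i ω‖ ^ 2) P :=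
    Integrable.of_bound ((hGm j i).norm.pow_const 2).aestronglyMeasurable (y ^ 2)
      (Eventually.of_forall fun ω => by
        rw [norm_pow, norm_norm]; exact pow_le_pow_left₀ (norm_nonneg _) (hGle j i ω) 2)
  -- the remainder
  set R : Ω → ℂ := fun ω => b ω * G j i ω - b ω * H j i ω + b ω ^ 2 * H j i ω ^ 2 +
    (‖b ω‖ : ℂ) ^ 2 * (H j j ω * H i i ω) with hR
  have hRint : ∫ ω, R ω ∂P = ∫ ω, b ω * G j i ω ∂P + (∫ ω, b ω ^ 2 ∂P) * ∫ ω, H j i ω ^ 2 ∂P +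
      (v / n : ℝ) * ∫ ω, H j j ω * H i i ω ∂P := by
    simp only [hR]
    rw [integral_add (by exact (iG.sub iH1).add iH2) iH3,
      integral_add (by exact iG.sub iH1) iH2, integral_sub iG iH1, t1, t2, t3, sub_zero]
  have hRle : ‖∫ ω, R ω ∂P‖ ≤ (4 * y ^ 3 + 2 * y ^ 2 + 2 * y) *
      ((∫ x, ‖x‖ ^ 2 * min 1 (‖x‖ / √(n : ℝ)) ∂ξ) / n) := by
    rw [← hA.integral_norm_sq_mul_min_entry hn hij, ← integral_const_mul]
    refine norm_integral_le_of_norm_le ?_ (Eventually.of_forall fun ω =>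
      norm_entry_expansion_le (hA.isHermitian ω) hz hij)
    refine Integrable.const_mul ?_ _
    refine hsqi.mono' (Measurable.aestronglyMeasurable
      (f := fun ω => ‖b ω‖ ^ 2 * min 1 ‖b ω‖) (by fun_prop)) (Eventually.of_forall fun ω => ?_)
    rw [Real.norm_of_nonneg (by positivity)]
    exact mul_le_of_le_one_right (by positivity) (min_le_left _ _)
  -- For complex entries E b² is unspecified and only its size is controlled. The term is harmless
  -- because its other factor E H_ji² is small after summation over j.
  have hbb : ‖∫ ω, b ω ^ 2 ∂P‖ ≤ v / n := by
    rw [← hvn]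
    refine (norm_integral_le_integral_norm _).trans_eq ?_
    simp [hb]
  -- Return from H to G by (a + b)² ≤ 2a² + 2b² with b = 2y²|A_ij|, which explains the constant 8y⁴.
  have hHH : ‖∫ ω, H j i ω ^ 2 ∂P‖ ≤ 2 * ∫ ω, ‖G j i ω‖ ^ 2 ∂P + 8 * y ^ 4 * (v / n) := by
    rw [← hvn, ← integral_const_mul, ← integral_const_mul,
      ← integral_add (iGsq.const_mul _) (hsqi.const_mul _)]
    refine norm_integral_le_of_norm_le ((iGsq.const_mul _).add (hsqi.const_mul _))
      (Eventually.of_forall fun ω => ?_)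
    rw [norm_pow]
    have h1 := hHG j i ω
    have h2 : ‖H j i ω‖ ≤ ‖G j i ω‖ + ‖H j i ω - G j i ω‖ := by
      have := norm_add_le (G j i ω) (H j i ω - G j i ω)
      simpa using this
    have h3 : ‖H j i ω‖ ^ 2 ≤ (‖G j i ω‖ + 2 * y ^ 2 * ‖b ω‖) ^ 2 :=
      pow_le_pow_left₀ (norm_nonneg _) (by linarith) 2
    simp only [hb] at h3 ⊢
    nlinarith [sq_nonneg (‖G j i ω‖ - 2 * y ^ 2 * ‖A ω i j‖)]
  have hdiff : ‖∫ ω, H j j ω * H i i ω ∂P - ∫ ω, G j j ω * G i i ω ∂P‖ ≤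
      2 * (1 + v) * y ^ 3 / √(n : ℝ) := by
    have hs : 0 < √(n : ℝ) := Real.sqrt_pos.2 hn'
    have hss : √(n : ℝ) ^ 2 = n := Real.sq_sqrt hn'.le
    rw [← integral_sub iHH iGG]
    refine (norm_integral_le_of_norm_le (g := fun ω => 2 * y ^ 3 / √(n : ℝ) +
      (2 * y ^ 3 * √(n : ℝ)) * ‖b ω‖ ^ 2) ((integrable_const _).add (hsqi.const_mul _))
      (Eventually.of_forall fun ω => ?_)).trans_eq ?_
    · have e : H j j ω * H i i ω - G j j ω * G i i ω =
          (H j j ω - G j j ω) * H i i ω + G j j ω * (H i i ω - G i i ω) := by ring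
      have h1 : ‖H j j ω * H i i ω - G j j ω * G i i ω‖ ≤ 4 * y ^ 3 * ‖b ω‖ := by
        rw [e]
        refine (norm_add_le _ _).trans ?_
        rw [norm_mul, norm_mul]
        calc _ ≤ (2 * y ^ 2 * ‖b ω‖) * y + y * (2 * y ^ 2 * ‖b ω‖) := by
              gcongr
              · exact hHG _ _ _
              · exact hHle _ _ _
              · exact hGle _ _ _
              · exact hHG _ _ _
          _ = _ := by ring
      refine h1.trans ?_
      -- AM–GM with weight √n: since E|b|² = v/n, both terms then have mean of order n^(-1/2).
      have h2 : 2 * ‖b ω‖ ≤ 1 / √(n : ℝ) + √(n : ℝ) * ‖b ω‖ ^ 2 := by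
        rw [div_add' _ _ _ hs.ne', le_div_iff₀ hs]
        nlinarith [sq_nonneg (1 - √(n : ℝ) * ‖b ω‖)]
      have h3 := mul_le_mul_of_nonneg_left h2 (by positivity : 0 ≤ 2 * y ^ 3)
      calc _ = 2 * y ^ 3 * (2 * ‖b ω‖) := by ring
        _ ≤ _ := h3
        _ = _ := by ring
    · rw [integral_add (integrable_const _) (hsqi.const_mul _), integral_const_mul, hvn]
      simp only [integral_const, probReal_univ, one_smul]
      field_simp
      rw [hss]
      ring
  have hfin : ∫ ω, b ω * G j i ω ∂P + (v / n : ℝ) * ∫ ω, G j j ω * G i i ω ∂P =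
      ∫ ω, R ω ∂P - (∫ ω, b ω ^ 2 ∂P) * ∫ ω, H j i ω ^ 2 ∂P -
        (v / n : ℝ) * (∫ ω, H j j ω * H i i ω ∂P - ∫ ω, G j j ω * G i i ω ∂P) := by
    rw [hRint]; ring
  rw [hfin]
  refine (norm_sub_le _ _).trans (le_trans (add_le_add_left (norm_sub_le _ _) _) ?_)
  rw [norm_mul, norm_mul, Complex.norm_real, Real.norm_of_nonneg hv]
  calc _ ≤ (4 * y ^ 3 + 2 * y ^ 2 + 2 * y) *
        ((∫ x, ‖x‖ ^ 2 * min 1 (‖x‖ / √(n : ℝ)) ∂ξ) / n) +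
        v / n * (2 * ∫ ω, ‖G j i ω‖ ^ 2 ∂P + 8 * y ^ 4 * (v / n)) +
        v / n * (2 * (1 + v) * y ^ 3 / √(n : ℝ)) := by gcongr
    _ = _ := by
        rw [wignerError]
        field_simp
        ring

end Expectation

/-! ### Wigner's theorem: the limit of the expectation and almost sure convergence. -/

section AlmostSure

open Matrix

variable {Ω : Type*} [MeasurableSpace Ω] {P : Measure Ω} [IsProbabilityMeasure P]

/-- The expected loop equation for a Wigner matrix with zero diagonal. -/
theorem IsWigner.norm_integral_loop_le {n : ℕ} {v : ℝ} {ξ : Measure ℂ} {ζ : Measure ℝ}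
    {A : Ω → Matrix (Fin n) (Fin n) ℂ} (hA : IsWigner P n v ξ ζ A) (hv : 0 ≤ v) (hn : 0 < n)
    (hd : ∀ ω i, A ω i i = 0) {z : ℂ} (hz : 0 < z.im) :
    ‖∫ ω, (1 + z * resolventMean (A ω) z + v * resolventMean (A ω) z ^ 2) ∂P‖ ≤
      wignerError ξ v z.im⁻¹ n + 2 * v * z.im⁻¹ ^ 2 / n := by
  have hn' : (0 : ℝ) < n := by exact_mod_cast hn
  have hnc : (n : ℂ) ≠ 0 := by exact_mod_cast hn.ne'
  set y := z.im⁻¹ with hy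
  have hy0 : 0 ≤ y := inv_nonneg.2 hz.le
  set G : Fin n → Fin n → Ω → ℂ := fun a b ω => matrixResolvent (A ω) z a b with hG
  have hGm : ∀ p q, Measurable (G p q) := fun p q =>
    (measurable_matrixResolvent_apply z p q).comp hA.measurable_matrix
  have hGle : ∀ p q ω, ‖G p q ω‖ ≤ y := fun p q ω =>
    norm_matrixResolvent_apply_le (hA.isHermitian ω) hz p q
  have iA : ∀ i j, Integrable (fun ω => A ω i j) P := fun i j => by
    by_cases hij : i = j
    · subst hij; simp [hd]
    · exact (hA.memLp_entry hn hij).integrable (by norm_num)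
  have iAG : ∀ i j, Integrable (fun ω => A ω i j * G j i ω) P := fun i j =>
    (iA i j).mul_bdd (c := y) (hGm j i).aestronglyMeasurable (Eventually.of_forall (hGle j i))
  have bGG : ∀ i j ω, ‖G j j ω * G i i ω‖ ≤ y * y := fun i j ω => by
    rw [norm_mul]; exact mul_le_mul (hGle _ _ _) (hGle _ _ _) (norm_nonneg _) hy0
  have iGG : ∀ i j, Integrable (fun ω => G j j ω * G i i ω) P := fun i j =>
    Integrable.of_bound ((hGm j j).mul (hGm i i)).aestronglyMeasurable _
      (Eventually.of_forall (bGG i j))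
  have iGsq : ∀ i j, Integrable (fun ω => ‖G j i ω‖ ^ 2) P := fun i j =>
    Integrable.of_bound ((hGm j i).norm.pow_const 2).aestronglyMeasurable (y ^ 2)
      (Eventually.of_forall fun ω => by
        rw [norm_pow, norm_norm]; exact pow_le_pow_left₀ (norm_nonneg _) (hGle j i ω) 2)
  have iT : ∀ i j, Integrable
      (fun ω => (n : ℂ)⁻¹ * (A ω i j * G j i ω + (v / n : ℝ) * (G j j ω * G i i ω))) P :=
    fun i j => ((iAG i j).add ((iGG i j).const_mul _)).const_mul _
  -- The trace of A G = 1 + z G gives 1 + z s = n⁻¹ Σ A_ij G_ji, and s² = n⁻² Σ G_jj G_ii, so the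
  -- expression is a sum over pairs of indices.
  have hpt : ∀ ω, 1 + z * resolventMean (A ω) z + v * resolventMean (A ω) z ^ 2 =
      ∑ i, ∑ j, (n : ℂ)⁻¹ * (A ω i j * G j i ω + (v / n : ℝ) * (G j j ω * G i i ω)) := by
    intro ω
    have h1 : ∑ i, ∑ j, A ω i j * G j i ω = n + z * ∑ i, G i i ω := by
      have h := congrArg trace (mul_matrixResolvent (hA.isHermitian ω) hz)
      rw [trace_add, trace_smul, trace_one, Fintype.card_fin] at h
      simpa [trace, mul_apply] using h
    have h2 : ∑ i, ∑ j, G j j ω * G i i ω = (∑ i, G i i ω) ^ 2 := by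
      rw [sq, Finset.sum_mul_sum, Finset.sum_comm]
    simp_rw [mul_add, Finset.sum_add_distrib, ← mul_assoc, mul_assoc _ (G _ _ ω),
      mul_assoc _ (A _ _ _), ← Finset.mul_sum]
    rw [h1, h2]
    have hs : resolventMean (A ω) z = (n : ℂ)⁻¹ * ∑ i, G i i ω := by
      simp [resolventMean, trace, hG]
    rw [hs]
    push_cast
    field_simp
  have hpair : ∀ i j, ‖∫ ω, A ω i j * G j i ω ∂P + (v / n : ℝ) * ∫ ω, G j j ω * G i i ω ∂P‖ ≤
      (wignerError ξ v y n + 2 * v * ∫ ω, ‖G j i ω‖ ^ 2 ∂P) / n := by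
    intro i j
    -- On the diagonal the entry vanishes, and (v/n) E G_ii² is covered by the term 2v E|G_ii|²
    -- already present in the bound.
    by_cases hij : i = j
    · subst hij
      have herr := wignerError_nonneg ξ hv hy0 n
      have h0 : 0 ≤ ∫ ω, ‖G i i ω‖ ^ 2 ∂P := integral_nonneg fun ω => sq_nonneg _
      have h1 : ‖∫ ω, G i i ω * G i i ω ∂P‖ ≤ ∫ ω, ‖G i i ω‖ ^ 2 ∂P := by
        refine (norm_integral_le_integral_norm _).trans_eq ?_
        simp_rw [norm_mul, sq]
      simp only [hd, zero_mul, integral_zero, zero_add]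
      rw [norm_mul, Complex.norm_real, Real.norm_of_nonneg (by positivity), div_mul_eq_mul_div]
      gcongr
      have := mul_le_mul_of_nonneg_left h1 hv
      nlinarith
    · exact hA.norm_integral_entry_mul_resolvent_le hn hz hij
  have hint : ∫ ω, (1 + z * resolventMean (A ω) z + v * resolventMean (A ω) z ^ 2) ∂P =
      ∑ i, ∑ j, (n : ℂ)⁻¹ * (∫ ω, A ω i j * G j i ω ∂P +
        (v / n : ℝ) * ∫ ω, G j j ω * G i i ω ∂P) := by
    simp_rw [hpt]
    rw [integral_finsetSum _ fun i _ => integrable_finsetSum _ fun j _ => iT i j]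
    refine Finset.sum_congr rfl fun i _ => ?_
    rw [integral_finsetSum _ fun j _ => iT i j]
    refine Finset.sum_congr rfl fun j _ => ?_
    rw [integral_const_mul, integral_add (iAG i j) ((iGG i j).const_mul _), integral_const_mul]
  have hcol : ∀ i, ∑ j, ∫ ω, ‖G j i ω‖ ^ 2 ∂P ≤ y ^ 2 := by
    intro i
    rw [← integral_finsetSum _ fun j _ => iGsq i j]
    have h := integral_mono (μ := P) (integrable_finsetSum _ fun j _ => iGsq i j)
      (integrable_const (y ^ 2)) fun ω =>
        sum_norm_sq_matrixResolvent_le (hA.isHermitian ω) hz i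
    simpa using h
  rw [hint]
  calc _ ≤ ∑ i, ∑ j, (n : ℝ)⁻¹ * ((wignerError ξ v y n + 2 * v * ∫ ω, ‖G j i ω‖ ^ 2 ∂P) / n) := by
        refine (norm_sum_le _ _).trans (Finset.sum_le_sum fun i _ => (norm_sum_le _ _).trans
          (Finset.sum_le_sum fun j _ => ?_))
        rw [norm_mul, norm_inv, Complex.norm_natCast]
        gcongr
        exact hpair i j
    _ = ∑ i : Fin n, ((n : ℝ)⁻¹ * wignerError ξ v y n +
          2 * v / n ^ 2 * ∑ j, ∫ ω, ‖G j i ω‖ ^ 2 ∂P) := by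
        refine Finset.sum_congr rfl fun i _ => ?_
        rw [Finset.mul_sum, ← Finset.mul_sum, ← Finset.sum_div, Finset.sum_add_distrib,
          ← Finset.mul_sum, ← Finset.mul_sum]
        simp only [Finset.sum_const, Finset.card_univ, Fintype.card_fin, nsmul_eq_mul]
        field_simp
    _ ≤ ∑ i : Fin n, ((n : ℝ)⁻¹ * wignerError ξ v y n + 2 * v / n ^ 2 * y ^ 2) := by
        gcongr
        exact hcol _
    _ = _ := by
        simp only [Finset.sum_const, Finset.card_univ, Fintype.card_fin, nsmul_eq_mul]
        field_simp

/-- Passing from E s² to (E s)² costs E(s - E s)², at most the sum of the variances of Re s and Im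
s. Each is bounded through the variance proxy 16y²/n, y = (Im z)⁻¹, whence the exponent 8y²/n. -/
theorem IsWigner.norm_quadratic_integral_le {n : ℕ} {v : ℝ} {ξ : Measure ℂ} {ζ : Measure ℝ}
    {A : Ω → Matrix (Fin n) (Fin n) ℂ} (hA : IsWigner P n v ξ ζ A) (hv : 0 ≤ v) (hn : 0 < n)
    (hd : ∀ ω i, A ω i i = 0) {z : ℂ} (hz : 0 < z.im) :
    ‖v * (∫ ω, resolventMean (A ω) z ∂P) ^ 2 + z * (∫ ω, resolventMean (A ω) z ∂P) + 1‖ ≤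
      wignerError ξ v z.im⁻¹ n + 2 * v * z.im⁻¹ ^ 2 / n +
        v * (8 * (Real.exp (8 * z.im⁻¹ ^ 2 / n) - 1)) := by
  have hne : Nonempty (Fin n) := ⟨⟨0, hn⟩⟩
  set s : Ω → ℂ := fun ω => resolventMean (A ω) z with hs
  have hsi : Integrable s P := hA.integrable_resolventMean hn hz
  have hsm : Measurable s := hA.measurable_resolventMean z
  have hsb : ∀ ω, ‖s ω‖ ≤ z.im⁻¹ := fun ω => norm_resolventMean_le (hA.isHermitian ω) hz
  have hssi : Integrable (fun ω => s ω ^ 2) P :=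
    Integrable.of_bound (hsm.pow_const 2).aestronglyMeasurable (z.im⁻¹ ^ 2)
      (Eventually.of_forall fun ω => by
        rw [norm_pow]; exact pow_le_pow_left₀ (norm_nonneg _) (hsb ω) 2)
  set e := ∫ ω, s ω ∂P with he
  have h1 := hA.norm_integral_loop_le hv hn hd hz
  have hsplit : ∫ ω, (1 + z * s ω + v * s ω ^ 2) ∂P = 1 + z * e + v * ∫ ω, s ω ^ 2 ∂P := by
    rw [integral_add (by exact (integrable_const _).add (hsi.const_mul _)) (hssi.const_mul _),
      integral_add (integrable_const _) (hsi.const_mul _), integral_const_mul, integral_const_mul,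
      ← he]
    simp
  have hvar : ∫ ω, (s ω - e) ^ 2 ∂P = ∫ ω, s ω ^ 2 ∂P - e ^ 2 := by
    have : ∀ ω, (s ω - e) ^ 2 = s ω ^ 2 - (2 * e) * s ω + e ^ 2 := fun ω => by ring
    simp_rw [this]
    rw [integral_add (by exact hssi.sub (hsi.const_mul _)) (integrable_const _),
      integral_sub hssi (hsi.const_mul _), integral_const_mul, ← he]
    simp
    ring
  have hre : ∫ ω, (s ω).re ∂P = e.re := integral_re hsi
  have him : ∫ ω, (s ω).im ∂P = e.im := integral_im hsi
  have hsub : ∀ {φ : ℂ → ℝ}, LipschitzWith 1 φ → φ 0 = 0 →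
      Integrable (fun ω => (φ (s ω) - ∫ ω, φ (s ω) ∂P) ^ 2) P ∧
      ∫ ω, (φ (s ω) - ∫ ω, φ (s ω) ∂P) ^ 2 ∂P ≤ 4 * (Real.exp (8 * z.im⁻¹ ^ 2 / n) - 1) := by
    intro φ hφ hφ0
    have h := hA.hasSubgaussianMGF_resolventMean hn hz hφ hφ0
    refine ⟨(h.memLp 2).integrable_sq, ?_⟩
    have h2 := integral_sq_le_of_hasSubgaussianMGF h
    have hc : ((16 * (z.im.toNNReal⁻¹) ^ 2 / n : ℝ≥0) : ℝ) / 2 = 8 * z.im⁻¹ ^ 2 / n := by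
      simp [Real.coe_toNNReal _ hz.le]
      ring
    rw [hc] at h2
    exact h2
  have hlre : LipschitzWith 1 Complex.re := by
    refine LipschitzWith.of_dist_le_mul fun a b => ?_
    rw [Real.dist_eq, dist_eq_norm, NNReal.coe_one, one_mul, ← Complex.sub_re]
    exact Complex.abs_re_le_norm _
  have hlim : LipschitzWith 1 Complex.im := by
    refine LipschitzWith.of_dist_le_mul fun a b => ?_
    rw [Real.dist_eq, dist_eq_norm, NNReal.coe_one, one_mul, ← Complex.sub_im]
    exact Complex.abs_im_le_norm _
  obtain ⟨i1, b1⟩ := hsub hlre rfl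
  obtain ⟨i2, b2⟩ := hsub hlim rfl
  rw [hre] at i1 b1
  rw [him] at i2 b2
  have hV : ‖∫ ω, (s ω - e) ^ 2 ∂P‖ ≤ 8 * (Real.exp (8 * z.im⁻¹ ^ 2 / n) - 1) := by
    calc _ ≤ ∫ ω, (((s ω).re - e.re) ^ 2 + ((s ω).im - e.im) ^ 2) ∂P := by
          refine norm_integral_le_of_norm_le (i1.add i2) (Eventually.of_forall fun ω => ?_)
          rw [norm_pow, ← Complex.normSq_eq_norm_sq, Complex.normSq_apply]
          simp [sq]
      _ ≤ _ := by rw [integral_add i1 i2]; linarith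
  have hfin : v * e ^ 2 + z * e + 1 =
      ∫ ω, (1 + z * s ω + v * s ω ^ 2) ∂P - v * ∫ ω, (s ω - e) ^ 2 ∂P := by
    rw [hsplit, hvar]; ring
  rw [hfin]
  refine (norm_sub_le _ _).trans (add_le_add h1 ?_)
  rw [norm_mul, Complex.norm_real, Real.norm_of_nonneg hv]
  gcongr

section Diagonal

variable {ι : Type*} [Fintype ι] [DecidableEq ι]

/-- The diagonal entries are deleted one at a time. Each deletion costs the smaller of the rank
bound and the linear bound, so large entries cost no more than a constant. -/
theorem norm_trace_matrixResolvent_zeroDiag_sub_le {M : Matrix ι ι ℂ} (hM : M.IsHermitian) {z : ℂ}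
    (hz : 0 < z.im) :
    ‖(matrixResolvent (zeroDiag M) z).trace - (matrixResolvent M z).trace‖ ≤
      ∑ i, min (4 * z.im⁻¹) (‖M i i‖ * z.im⁻¹ ^ 2) := by
  set Z : Finset ι → Matrix ι ι ℂ := fun S =>
    Matrix.of fun a b => if a = b ∧ a ∈ S then 0 else M a b with hZ
  have hZh : ∀ S, (Z S).IsHermitian := by
    intro S
    ext a b
    simp only [hZ, conjTranspose_apply, of_apply]
    by_cases h : a = b
    · subst h
      split_ifs
      · simp
      · exact hM.apply a a
    · rw [if_neg (fun h' => h h'.1.symm), if_neg (fun h' => h h'.1)]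
      exact hM.apply a b
  have key : ∀ S : Finset ι, ‖(matrixResolvent (Z S) z).trace - (matrixResolvent M z).trace‖ ≤
      ∑ i ∈ S, min (4 * z.im⁻¹) (‖M i i‖ * z.im⁻¹ ^ 2) := by
    intro S
    induction S using Finset.induction_on with
    | empty =>
      have : Z ∅ = M := by ext a b; simp [hZ]
      simp [this]
    | insert i S hi ih =>
      rw [Finset.sum_insert hi]
      have hdiff : Z S - Z (insert i S) = Matrix.single i i (M i i) := by
        ext a b
        simp only [hZ, Matrix.sub_apply, of_apply, Finset.mem_insert, Matrix.single_apply]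
        by_cases hab : a = b
        · subst hab
          by_cases hai : a = i
          · subst hai; simp [hi]
          · simp [hai, Ne.symm hai]
        · have : ¬ (i = a ∧ i = b) := fun h => hab (h.1.symm.trans h.2)
          simp [hab, this]
      have h1 : ‖(matrixResolvent (Z (insert i S)) z).trace - (matrixResolvent (Z S) z).trace‖ ≤
          min (4 * z.im⁻¹) (‖M i i‖ * z.im⁻¹ ^ 2) := by
        refine le_min ?_ ?_
        · have hr : (Z S - Z (insert i S)).rank ≤ 2 := by
            rw [hdiff]
            refine rank_le_two_of_cross i fun a b ha _ => ?_
            rw [Matrix.single_apply, if_neg fun h => ha h.1.symm]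
          have := norm_trace_matrixResolvent_sub_le (hZh _) (hZh _) hz hr
          push_cast at this
          linarith
        · exact norm_trace_matrixResolvent_sub_le_of_diag (hZh _) (hZh _) hz i _ hdiff
      calc _ = ‖((matrixResolvent (Z (insert i S)) z).trace - (matrixResolvent (Z S) z).trace) +
            ((matrixResolvent (Z S) z).trace - (matrixResolvent M z).trace)‖ := by
            congr 1; ring
        _ ≤ _ := (norm_add_le _ _).trans (add_le_add h1 ih)
  have h := key Finset.univ
  have : Z Finset.univ = zeroDiag M := by ext a b; simp [hZ, zeroDiag]
  rwa [this] at h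

end Diagonal

/-- The error made by replacing the diagonal of a Wigner matrix by zero. -/
noncomputable def diagError (ζ : Measure ℝ) (y : ℝ) (n : ℕ) : ℝ :=
  ∫ x, min (4 * y) (|x| / √(n : ℝ) * y ^ 2) ∂ζ

/-- The integrand is bounded by 4y, so no moment of ζ is required. -/
theorem tendsto_diagError (ζ : Measure ℝ) [IsFiniteMeasure ζ] {y : ℝ} (hy : 0 ≤ y) :
    Tendsto (diagError ζ y) atTop (𝓝 0) := by
  have hsqrt : Tendsto (fun n : ℕ => √(n : ℝ)) atTop atTop :=
    Real.tendsto_sqrt_atTop.comp tendsto_natCast_atTop_atTop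
  have h := tendsto_integral_of_dominated_convergence (μ := ζ)
    (F := fun (n : ℕ) x => min (4 * y) (|x| / √(n : ℝ) * y ^ 2)) (f := fun _ => (0 : ℝ))
    (fun x => 4 * y) (fun n => by fun_prop) (integrable_const _)
    (fun n => Eventually.of_forall fun x => ?_) (Eventually.of_forall fun x => ?_)
  · simp only [integral_zero] at h
    exact h
  · rw [Real.norm_of_nonneg (by positivity)]
    exact min_le_left _ _
  · have h1 : Tendsto (fun n : ℕ => |x| / √(n : ℝ)) atTop (𝓝 0) :=
      tendsto_const_nhds.div_atTop hsqrt
    have h2 := (tendsto_const_nhds (x := 4 * y)).min (h1.mul_const (y ^ 2))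
    rwa [zero_mul, min_eq_right (by positivity)] at h2

theorem IsWigner.norm_integral_resolventMean_sub_zeroDiag_le {n : ℕ} {v : ℝ} {ξ : Measure ℂ}
    {ζ : Measure ℝ} {A : Ω → Matrix (Fin n) (Fin n) ℂ} (hA : IsWigner P n v ξ ζ A) (hn : 0 < n)
    {z : ℂ} (hz : 0 < z.im) :
    ‖∫ ω, resolventMean (_root_.zeroDiag (A ω)) z ∂P - ∫ ω, resolventMean (A ω) z ∂P‖ ≤
      diagError ζ z.im⁻¹ n := by
  have hn' : (0 : ℝ) < n := by exact_mod_cast hn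
  have hs : √(n : ℝ) ≠ 0 := (Real.sqrt_pos.2 hn').ne'
  have hi : 0 ≤ z.im⁻¹ := inv_nonneg.2 hz.le
  have hbi : ∀ i, Integrable (fun ω => min (4 * z.im⁻¹) (‖A ω i i‖ * z.im⁻¹ ^ 2)) P := fun i => by
    have hm := hA.measurable i i
    refine Integrable.of_bound (by fun_prop) (4 * z.im⁻¹) (Eventually.of_forall fun ω => ?_)
    rw [Real.norm_of_nonneg (by positivity)]
    exact min_le_left _ _
  have hint : ∀ i, ∫ ω, min (4 * z.im⁻¹) (‖A ω i i‖ * z.im⁻¹ ^ 2) ∂P = diagError ζ z.im⁻¹ n := by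
    intro i
    have hm := hA.measurable i i
    rw [diagError, ← hA.map_diag i, integral_map (by fun_prop) (by fun_prop)]
    refine integral_congr_ae (Eventually.of_forall fun ω => ?_)
    have h1 : A ω i i = ((A ω i i).re : ℂ) := ((hA.isHermitian ω).coe_re_apply_self i).symm
    have h2 : ‖A ω i i‖ = |(A ω i i).re| := by
      rw [h1, Complex.norm_real, Real.norm_eq_abs, Complex.ofReal_re]
    simp only
    rw [h2, abs_mul, abs_of_nonneg (Real.sqrt_nonneg _), mul_div_cancel_left₀ _ hs]
  rw [← integral_sub (hA.zeroDiag.integrable_resolventMean hn hz)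
    (hA.integrable_resolventMean hn hz)]
  calc _ ≤ ∫ ω, (n : ℝ)⁻¹ * ∑ i, min (4 * z.im⁻¹) (‖A ω i i‖ * z.im⁻¹ ^ 2) ∂P := by
        refine norm_integral_le_of_norm_le ((integrable_finsetSum _ fun i _ => hbi i).const_mul _)
          (Eventually.of_forall fun ω => ?_)
        rw [resolventMean, resolventMean, ← mul_sub, norm_mul, norm_inv, Complex.norm_natCast,
          Fintype.card_fin]
        gcongr
        exact norm_trace_matrixResolvent_zeroDiag_sub_le (hA.isHermitian ω) hz
    _ = _ := by
        rw [integral_const_mul, integral_finsetSum _ fun i _ => hbi i]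
        simp only [hint, Finset.sum_const, Finset.card_univ, Fintype.card_fin, nsmul_eq_mul]
        field_simp

/-- The tails at each level ε are geometrically small, hence summable; Borel–Cantelli needs no
relation between different n. -/
theorem ae_tendsto_zero_of_hasSubgaussianMGF {X : ℕ → Ω → ℝ} {K : ℝ≥0}
    (h : ∀ n : ℕ, HasSubgaussianMGF (X n) (K / (n + 1 : ℕ)) P) :
    ∀ᵐ ω ∂P, Tendsto (fun n => X n ω) atTop (𝓝 0) := by
  have key : ∀ k : ℕ, ∀ᵐ ω ∂P, ∀ᶠ n in atTop, |X n ω| < 1 / ((k : ℝ) + 1) := by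
    intro k
    set ε : ℝ := 1 / ((k : ℝ) + 1) with hε
    have hε0 : 0 < ε := by positivity
    -- Enlarging K to K + 1 keeps the exponent meaningful when K = 0.
    set r : ℝ := Real.exp (-(ε ^ 2 / (2 * (K + 1)))) with hr
    have hr1 : r < 1 := by
      rw [hr, Real.exp_lt_one_iff]
      have : 0 < ε ^ 2 / (2 * ((K : ℝ) + 1)) := by positivity
      linarith
    have hbound : ∀ n {Y : Ω → ℝ}, HasSubgaussianMGF Y (K / (n + 1 : ℕ)) P →
        P.real {ω | ε ≤ Y ω} ≤ r ^ n := by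
      intro n Y hY
      have hY' : HasSubgaussianMGF Y ((K + 1) / (n + 1 : ℕ)) P := by
        refine ⟨hY.integrable_exp_mul, fun t => (hY.mgf_le t).trans ?_⟩
        rw [Real.exp_le_exp]
        gcongr
        simp
      refine (hY'.measure_ge_le hε0.le).trans ?_
      rw [hr, ← Real.exp_nat_mul, Real.exp_le_exp]
      have hK : (0 : ℝ) < K + 1 := by positivity
      have : -ε ^ 2 / (2 * (((K + 1) / (n + 1 : ℕ) : ℝ≥0) : ℝ)) =
          ((n : ℝ) + 1) * -(ε ^ 2 / (2 * (K + 1))) := by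
        push_cast
        field_simp
      rw [this]
      have h0 : 0 ≤ ε ^ 2 / (2 * ((K : ℝ) + 1)) := by positivity
      nlinarith
    have hsum : ∑' n, P {ω | ε ≤ |X n ω|} ≠ ∞ := by
      have hs : Summable fun n : ℕ => 2 * r ^ n :=
        (summable_geometric_of_lt_one (Real.exp_pos _).le hr1).mul_left 2
      refine ne_top_of_le_ne_top hs.tsum_ofReal_ne_top (ENNReal.tsum_le_tsum fun n => ?_)
      rw [← ofReal_measureReal]
      refine ENNReal.ofReal_le_ofReal ?_
      have hsub : {ω | ε ≤ |X n ω|} ⊆ {ω | ε ≤ X n ω} ∪ {ω | ε ≤ (-X n) ω} := by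
        intro ω hω
        exact le_abs.1 (Set.mem_ofPred.1 hω)
      calc _ ≤ P.real ({ω | ε ≤ X n ω} ∪ {ω | ε ≤ (-X n) ω}) := measureReal_mono hsub
        _ ≤ _ := measureReal_union_le _ _
        _ ≤ 2 * r ^ n := by linarith [hbound n (h n), hbound n (h n).neg]
    filter_upwards [ae_eventually_notMem hsum] with ω hω
    filter_upwards [hω] with n hn
    exact not_le.1 hn
  filter_upwards [ae_all_iff.2 key] with ω hω
  rw [Metric.tendsto_atTop]
  intro ε hε
  obtain ⟨k, hk⟩ := exists_nat_one_div_lt hε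
  obtain ⟨N, hN⟩ := eventually_atTop.1 (hω k)
  exact ⟨N, fun n hn => by rw [Real.dist_eq, sub_zero]; exact (hN n hn).trans hk⟩

theorem tendsto_comp_succPNat_iff {α : Type*} {l : Filter α} {f : ℕ+ → α} :
    Tendsto (fun n : ℕ => f n.succPNat) atTop l ↔ Tendsto f atTop l := by
  have h : map Nat.succPNat atTop = atTop := OrderIso.map_atTop OrderIso.pnatIsoNat.symm
  rw [← h, tendsto_map'_iff]
  rfl

/-- **Wigner's theorem** for the resolvent: the normalized trace of the resolvent of a Wigner
matrix converges almost surely to the Stieltjes transform of the semicircle law. -/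
theorem ae_tendsto_resolventMean_of_isWigner {v : ℝ} (hv : 0 < v) {ξ : Measure ℂ} {ζ : Measure ℝ}
    {A : (n : ℕ+) → Ω → Matrix (Fin n) (Fin n) ℂ} (hA : ∀ n : ℕ+, IsWigner P n v ξ ζ (A n)) {z : ℂ}
    (hz : 0 < z.im) :
    ∀ᵐ ω ∂P, Tendsto (fun n : ℕ+ => resolventMean (A n ω) z) atTop
      (𝓝 (stieltjes (semicircleLaw 0 v) z)) := by
  have hcast : Tendsto (fun n : ℕ+ => (n : ℕ)) atTop atTop :=
    tendsto_comp_succPNat_iff.1 (by simpa using tendsto_add_atTop_nat 1)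
  have hξ : MemLp id 2 ξ := (hA 1).memLp
  have : IsProbabilityMeasure ζ := by
    rw [← (hA 1).map_diag ⟨0, by simp⟩]
    have := (hA 1).measurable ⟨0, by simp⟩ ⟨0, by simp⟩
    exact Measure.isProbabilityMeasure_map (by fun_prop)
  have hi : 0 ≤ z.im⁻¹ := inv_nonneg.2 hz.le
  -- Expectations are treated first without the diagonal, where the approximate quadratic equation
  -- holds; the diagonal is then restored by `diagError`.
  have hE0 : Tendsto (fun n : ℕ+ => ∫ ω, resolventMean (zeroDiag (A n ω)) z ∂P) atTop
      (𝓝 (stieltjes (semicircleLaw 0 v) z)) := by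
    refine tendsto_stieltjes_semicircleLaw hv hz (fun n => ?_) ?_
    · have hne : Nonempty (Fin n) := ⟨⟨0, n.pos⟩⟩
      have h := (hA n).zeroDiag.integrable_resolventMean n.pos hz
      have h2 := integral_im h
      simp only [RCLike.im_to_complex] at h2
      rw [← h2]
      exact integral_nonneg fun ω => im_resolventMean_nonneg ((hA n).zeroDiag.isHermitian ω) hz
    · refine squeeze_zero_norm (fun n => (hA n).zeroDiag.norm_quadratic_integral_le hv.le n.pos
        (fun ω i => by simp [zeroDiag]) hz) ?_
      have h1 := (tendsto_wignerError ξ hξ v z.im⁻¹)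
      have h2 : Tendsto (fun n : ℕ => 2 * v * z.im⁻¹ ^ 2 / (n : ℝ)) atTop (𝓝 0) :=
        tendsto_const_nhds.div_atTop tendsto_natCast_atTop_atTop
      have h3 : Tendsto (fun n : ℕ => 8 * z.im⁻¹ ^ 2 / (n : ℝ)) atTop (𝓝 0) :=
        tendsto_const_nhds.div_atTop tendsto_natCast_atTop_atTop
      have h4 := ((((Real.continuous_exp.tendsto 0).comp h3).sub_const 1).const_mul 8).const_mul v
      have h5 := ((h1.add h2).add h4).comp hcast
      simpa [Function.comp_def] using h5
  have hE : Tendsto (fun n : ℕ+ => ∫ ω, resolventMean (A n ω) z ∂P) atTop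
      (𝓝 (stieltjes (semicircleLaw 0 v) z)) := by
    have hd : Tendsto (fun n : ℕ+ => ∫ ω, resolventMean (zeroDiag (A n ω)) z ∂P -
        ∫ ω, resolventMean (A n ω) z ∂P) atTop (𝓝 0) :=
      squeeze_zero_norm (fun n => (hA n).norm_integral_resolventMean_sub_zeroDiag_le n.pos hz)
        ((tendsto_diagError ζ hi).comp hcast)
    simpa using hE0.sub hd
  have hlre : LipschitzWith 1 Complex.re := by
    refine LipschitzWith.of_dist_le_mul fun a b => ?_
    rw [Real.dist_eq, dist_eq_norm, NNReal.coe_one, one_mul, ← Complex.sub_re]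
    exact Complex.abs_re_le_norm _
  have hlim : LipschitzWith 1 Complex.im := by
    refine LipschitzWith.of_dist_le_mul fun a b => ?_
    rw [Real.dist_eq, dist_eq_norm, NNReal.coe_one, one_mul, ← Complex.sub_im]
    exact Complex.abs_im_le_norm _
  -- Concentration is applied to the real and imaginary parts; the shift `succPNat` matches the
  -- proxy K/(n+1).
  have hconc : ∀ {φ : ℂ → ℝ}, LipschitzWith 1 φ → φ 0 = 0 →
      ∀ᵐ ω ∂P, Tendsto (fun n : ℕ => φ (resolventMean (A n.succPNat ω) z) -
        ∫ ω, φ (resolventMean (A n.succPNat ω) z) ∂P) atTop (𝓝 0) := fun hφ hφ0 =>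
    ae_tendsto_zero_of_hasSubgaussianMGF (K := 16 * (z.im.toNNReal⁻¹) ^ 2) fun n =>
      (hA n.succPNat).hasSubgaussianMGF_resolventMean n.succPNat.pos hz hφ hφ0
  filter_upwards [hconc hlre rfl, hconc hlim rfl] with ω h1 h2
  rw [← tendsto_comp_succPNat_iff] at hE ⊢
  have hre : ∀ n : ℕ, ∫ ω, (resolventMean (A n.succPNat ω) z).re ∂P =
      (∫ ω, resolventMean (A n.succPNat ω) z ∂P).re := fun n =>
    integral_re ((hA n.succPNat).integrable_resolventMean n.succPNat.pos hz)
  have him : ∀ n : ℕ, ∫ ω, (resolventMean (A n.succPNat ω) z).im ∂P =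
      (∫ ω, resolventMean (A n.succPNat ω) z ∂P).im := fun n =>
    integral_im ((hA n.succPNat).integrable_resolventMean n.succPNat.pos hz)
  simp_rw [hre] at h1
  simp_rw [him] at h2
  have h3 := ((Complex.continuous_ofReal.tendsto 0).comp h1).add
    (((Complex.continuous_ofReal.tendsto 0).comp h2).mul_const Complex.I)
  have h4 := h3.add hE
  simp only [Complex.ofReal_zero, zero_mul, add_zero, zero_add] at h4
  refine h4.congr fun n => ?_
  simp only [Function.comp_apply]
  apply Complex.ext <;> simp

end AlmostSure

/-! ### Real linear combinations of independent Wigner matrices. -/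

section LinearCombination

variable {L : Type*} [Fintype L] {Ω : Type*} [MeasurableSpace Ω] {P : Measure Ω}

/-- The law of a linear combination of independent variables with laws `ξ l`. -/
noncomputable def linearCombinationLaw {𝕜 : Type*} [MeasurableSpace 𝕜] [Semiring 𝕜]
    (c : L → 𝕜) (ξ : L → Measure 𝕜) : Measure 𝕜 :=
  (Measure.pi ξ).map fun x => ∑ l, c l * x l

theorem measurable_sum_mul {𝕜 : Type*} [MeasurableSpace 𝕜] [Semiring 𝕜] [MeasurableAdd₂ 𝕜]
    [MeasurableMul 𝕜] (c : L → 𝕜) : Measurable fun x : L → 𝕜 => ∑ l, c l * x l :=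
  Finset.measurable_fun_sum _ fun l _ => (measurable_pi_apply l).const_mul _

theorem memLp_eval_pi {ξ : L → Measure ℂ} [∀ l, IsProbabilityMeasure (ξ l)]
    (hξ : ∀ l, MemLp id 2 (ξ l)) (l : L) : MemLp (fun x : L → ℂ => x l) 2 (Measure.pi ξ) :=
  (hξ l).comp_measurePreserving (measurePreserving_eval ξ l)

theorem memLp_linearCombinationLaw {ξ : L → Measure ℂ} [∀ l, IsProbabilityMeasure (ξ l)]
    (hξ : ∀ l, MemLp id 2 (ξ l)) (c : L → ℂ) : MemLp id 2 (linearCombinationLaw c ξ) := by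
  rw [linearCombinationLaw, memLp_map_measure_iff (by fun_prop) (measurable_sum_mul c).aemeasurable]
  exact memLp_finsetSum _ fun l _ => (memLp_eval_pi hξ l).const_mul (c l)

theorem integral_eval_pi {ξ : L → Measure ℂ} [∀ l, IsProbabilityMeasure (ξ l)] (l : L)
    {g : ℂ → ℂ} (hg : Continuous g) : ∫ x : L → ℂ, g (x l) ∂(Measure.pi ξ) = ∫ x, g x ∂(ξ l) := by
  have h := (measurePreserving_eval ξ l).map_eq
  conv_rhs => rw [← h]
  rw [integral_map (measurePreserving_eval ξ l).measurable.aemeasurable hg.aestronglyMeasurable]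

theorem integral_linearCombinationLaw {ξ : L → Measure ℂ} [∀ l, IsProbabilityMeasure (ξ l)]
    (hξ : ∀ l, MemLp id 2 (ξ l)) (hmean : ∀ l, ∫ z, z ∂(ξ l) = 0) (c : L → ℂ) :
    ∫ z, z ∂(linearCombinationLaw c ξ) = 0 := by
  rw [linearCombinationLaw, integral_map (measurable_sum_mul c).aemeasurable (by fun_prop),
    integral_finsetSum _ fun l _ => ((memLp_eval_pi hξ l).integrable (by norm_num)).const_mul _]
  refine Finset.sum_eq_zero fun l _ => ?_
  rw [integral_const_mul, integral_eval_pi l (g := fun z => z) continuous_id, hmean, mul_zero]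

/-- Expand |Σ c_l x_l|² as a double sum; independence and zero means remove the cross terms. -/
theorem integral_norm_sq_linearCombinationLaw [DecidableEq L] {ξ : L → Measure ℂ}
    [∀ l, IsProbabilityMeasure (ξ l)] (hξ : ∀ l, MemLp id 2 (ξ l))
    (hmean : ∀ l, ∫ z, z ∂(ξ l) = 0) (hvar : ∀ l, ∫ z, ‖z‖ ^ 2 ∂(ξ l) = 1) (c : L → ℝ) :
    ∫ z, ‖z‖ ^ 2 ∂(linearCombinationLaw (fun l => (c l : ℂ)) ξ) = ∑ l, c l ^ 2 := by
  set π := Measure.pi ξ with hπ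
  rw [linearCombinationLaw, integral_map (measurable_sum_mul _).aemeasurable (by fun_prop)]
  have hi : ∀ l m, Integrable (fun x : L → ℂ => x l * (starRingEnd ℂ) (x m)) π := fun l m =>
    (memLp_eval_pi hξ l).integrable_mul (memLp_eval_pi hξ m).star
  have hlm : ∀ l m, ∫ x : L → ℂ, x l * (starRingEnd ℂ) (x m) ∂π = if l = m then 1 else 0 := by
    intro l m
    split_ifs with h
    · subst h
      have h1 : ∀ x : L → ℂ, x l * (starRingEnd ℂ) (x l) = ((‖x l‖ ^ 2 : ℝ) : ℂ) := fun x => by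
        rw [Complex.mul_conj, Complex.normSq_eq_norm_sq]
      simp_rw [h1]
      rw [integral_eval_pi l (g := fun z => ((‖z‖ ^ 2 : ℝ) : ℂ)) (by fun_prop),
        integral_complex_ofReal, hvar, Complex.ofReal_one]
    · have hind : iIndepFun (fun (l : L) (x : L → ℂ) => x l) π :=
        iIndepFun_pi (X := fun _ => id) fun l => aemeasurable_id
      have h2 := ((hind.indepFun h).comp (φ := id) (ψ := starRingEnd ℂ) measurable_id
        Complex.continuous_conj.measurable).integral_fun_mul_eq_mul_integral
        (by exact (measurable_pi_apply l).aestronglyMeasurable)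
        (by exact (Complex.continuous_conj.measurable.comp
          (measurable_pi_apply m)).aestronglyMeasurable)
      simp only [Function.comp_def, id_eq] at h2
      rw [h2, integral_eval_pi l (g := fun z => z) continuous_id, hmean, zero_mul]
  apply Complex.ofReal_injective
  rw [← integral_complex_ofReal]
  have hpt : ∀ x : L → ℂ, ((‖∑ l, (c l : ℂ) * x l‖ ^ 2 : ℝ) : ℂ) =
      ∑ l, ∑ m, (c l * c m : ℂ) * (x l * (starRingEnd ℂ) (x m)) := by
    intro x
    rw [← Complex.normSq_eq_norm_sq, ← Complex.mul_conj, map_sum, Finset.sum_mul_sum]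
    refine Finset.sum_congr rfl fun l _ => Finset.sum_congr rfl fun m _ => ?_
    rw [map_mul, Complex.conj_ofReal]
    ring
  simp_rw [hpt]
  rw [integral_finsetSum _ fun l _ => integrable_finsetSum _ fun m _ => (hi l m).const_mul _]
  simp_rw [integral_finsetSum _ fun m _ => (hi _ m).const_mul _, integral_const_mul, hlm]
  simp [sq]

/-- A real linear combination of independent Wigner matrices is a Wigner matrix. -/
theorem IsWigner.linearCombination {n : ℕ} {ξ : L → Measure ℂ} {ζ : L → Measure ℝ}
    [∀ l, IsProbabilityMeasure (ξ l)] [∀ l, IsProbabilityMeasure (ζ l)]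
    {A : L → Ω → Matrix (Fin n) (Fin n) ℂ} (hA : ∀ l, IsWigner P n 1 (ξ l) (ζ l) (A l))
    (hindep : iIndepFun (fun l ω (i j : Fin n) => A l ω i j) P) (c : L → ℝ) :
    IsWigner P n (∑ l, c l ^ 2) (linearCombinationLaw (fun l => (c l : ℂ)) ξ)
      (linearCombinationLaw c ζ) fun ω => ∑ l, (c l : ℂ) • A l ω where
  measurable i j := by
    have := fun l => (hA l).measurable i j
    simp only [Matrix.sum_apply, Matrix.smul_apply, smul_eq_mul]
    exact Finset.measurable_fun_sum _ fun l _ => (this l).const_mul _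
  isHermitian ω := by
    ext i j
    rw [Matrix.conjTranspose_apply]
    simp only [Matrix.sum_apply, Matrix.smul_apply, smul_eq_mul, star_sum, star_mul',
      Complex.star_def, Complex.conj_ofReal]
    refine Finset.sum_congr rfl fun l _ => ?_
    rw [(hA l).entry_conj ω i j, Complex.conj_conj]
  map_offDiag i j hij := by
    have hm := fun l => ((hA l).measurable i j).const_mul (√(n : ℝ) : ℂ)
    have h := (hindep.comp (fun _ x => (√(n : ℝ) : ℂ) * x i j)
      (fun _ => by fun_prop)).map_fun_eq_pi_map (fun l => by
        exact (hm l).aemeasurable)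
    simp only [Function.comp_def] at h
    simp_rw [(hA _).map_offDiag i j hij] at h
    rw [linearCombinationLaw, ← h, Measure.map_map (measurable_sum_mul _) (measurable_pi_iff.2 hm)]
    congr 1
    funext ω
    simp only [Function.comp_apply, Matrix.sum_apply, Matrix.smul_apply, smul_eq_mul,
      Finset.mul_sum]
    exact Finset.sum_congr rfl fun l _ => by ring
  map_diag i := by
    have hm : ∀ l, Measurable fun ω => √(n : ℝ) * (A l ω i i).re := fun l =>
      (Complex.measurable_re.comp ((hA l).measurable i i)).const_mul _
    have h := (hindep.comp (fun _ x => √(n : ℝ) * (x i i).re)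
      (fun _ => by fun_prop)).map_fun_eq_pi_map (fun l => by
        exact (hm l).aemeasurable)
    simp only [Function.comp_def] at h
    simp_rw [(hA _).map_diag i] at h
    rw [linearCombinationLaw, ← h, Measure.map_map (measurable_sum_mul _) (measurable_pi_iff.2 hm)]
    congr 1
    funext ω
    simp only [Function.comp_apply, Matrix.sum_apply, Matrix.smul_apply, smul_eq_mul,
      Finset.mul_sum, Complex.re_sum, Complex.re_ofReal_mul]
    exact Finset.sum_congr rfl fun l _ => by ring
  indep := by
    have h1 : iIndepFun (fun l ω (p : {p : Fin n × Fin n // p.1 ≤ p.2}) => A l ω p.1.1 p.1.2) P :=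
      hindep.comp (fun _ x (p : {p : Fin n × Fin n // p.1 ≤ p.2}) => x p.1.1 p.1.2)
        (fun _ => by fun_prop)
    -- Independence of the matrices and of the entries within each gives one independent family
    -- indexed by (l, p). Regrouped by the position p, it shows that the combined entries are
    -- independent.
    have h2 := iIndepFun_uncurry'
      (X := fun l (p : {p : Fin n × Fin n // p.1 ≤ p.2}) ω => A l ω p.1.1 p.1.2)
      (fun l p => (hA l).measurable _ _) h1 (fun l => (hA l).indep)
    have h3 := h2.precomp
      (g := fun q : (_ : {p : Fin n × Fin n // p.1 ≤ p.2}) × L => (q.2, q.1))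
      (by
        rintro ⟨a, b⟩ ⟨a', b'⟩ h
        simp only [Prod.mk.injEq] at h
        obtain ⟨rfl, rfl⟩ := h
        rfl)
    have h4 := iIndepFun_curry
      (X := fun (p : {p : Fin n × Fin n // p.1 ≤ p.2}) (l : L) ω => A l ω p.1.1 p.1.2)
      (fun p l => (hA l).measurable _ _) h3
    have h5 := h4.comp (fun _ x => ∑ l, (c l : ℂ) * x l) (fun _ => by fun_prop)
    convert h5 using 1
    funext p ω
    simp [Matrix.sum_apply]
  memLp := memLp_linearCombinationLaw (fun l => (hA l).memLp) _
  mean := integral_linearCombinationLaw (fun l => (hA l).memLp) (fun l => (hA l).mean) _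
  variance := by
    classical
    exact integral_norm_sq_linearCombinationLaw (fun l => (hA l).memLp) (fun l => (hA l).mean)
      (fun l => (hA l).variance) c

end LinearCombination

/-! ### Fourier block-diagonalisation of the symmetric circulant. -/

section Circulant

open Matrix

variable {k : ℕ}

/-- The index `min d (k - d)` of the matrix in position `d` of a symmetric circulant. -/
def foldIndex (d : Fin k) : Fin (k / 2 + 1) := ⟨min (d : ℕ) (k - d), by omega⟩

theorem foldIndex_eq_iff {d e : Fin k} :
    foldIndex e = foldIndex d ↔ e = d ∨ (e : ℕ) + d = k := by
  have := d.2
  have := e.2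
  simp only [foldIndex, Fin.ext_iff]
  omega

theorem conj_pow_mul_pow {η : ℂ} (hη : ‖η‖ = 1) (d : ℕ) : (starRingEnd ℂ) (η ^ d) * η ^ d = 1 := by
  rw [mul_comm, Complex.mul_conj, Complex.normSq_eq_norm_sq, norm_pow, hη]
  simp

theorem pow_eq_conj_pow {η : ℂ} (hη : ‖η‖ = 1) {a b : ℕ} (h : η ^ (a + b) = 1) :
    η ^ a = (starRingEnd ℂ) (η ^ b) := by
  have h0 : η ^ b ≠ 0 := pow_ne_zero _ (norm_pos_iff.1 (by rw [hη]; exact one_pos))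
  apply mul_right_cancel₀ h0
  rw [← pow_add, h, conj_pow_mul_pow hη]

/-- The coefficient of the matrix `l` in the block of the block-diagonalised symmetric circulant
that belongs to the root of unity `η`. -/
noncomputable def circulantCoeff (k : ℕ) (η : ℂ) (l : Fin (k / 2 + 1)) : ℝ :=
  1 / √(k : ℝ) * ∑ d : Fin k with foldIndex d = l, (η ^ (d : ℕ)).re

theorem sum_pow_val_eq {η : ℂ} (hη : η ^ k = 1) :
    ∑ d : Fin k, η ^ (d : ℕ) = if η = 1 then (k : ℂ) else 0 := by
  rw [Fin.sum_univ_eq_sum_range]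
  split_ifs with h
  · simp [h]
  · rw [geom_sum_eq h, hη, sub_self, zero_div]

variable [NeZero k]

theorem pow_val_sub_mul_pow_val {η : ℂ} (hη : η ^ k = 1) (a b : Fin k) :
    η ^ ((a - b : Fin k) : ℕ) * η ^ (b : ℕ) = η ^ (a : ℕ) := by
  conv_rhs => rw [← sub_add_cancel a b, Fin.val_add, ← pow_eq_pow_mod _ hη]
  rw [pow_add]

/-- The symmetric sequence is invariant under d ↦ -d, which conjugates η^d. Averaging the two forms
of the sum leaves real coefficients Re η^d, which are then grouped by the folded index. -/
theorem sum_circulantCoeff_smul {M : Type*} [AddCommGroup M] [Module ℂ M] {η : ℂ}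
    (hη : η ^ k = 1) (A : Fin (k / 2 + 1) → M) :
    ∑ l, (circulantCoeff k η l : ℂ) • A l =
      ((1 / √(k : ℝ) : ℝ) : ℂ) • ∑ d : Fin k, η ^ (d : ℕ) • symmExtend k A d := by
  have hη1 : ‖η‖ = 1 := Complex.norm_eq_one_of_pow_eq_one hη (NeZero.ne k)
  have hsymm : ∑ d : Fin k, η ^ (d : ℕ) • symmExtend k A d =
      ∑ d : Fin k, (starRingEnd ℂ) (η ^ (d : ℕ)) • symmExtend k A d := by
    rw [← Equiv.sum_comp (Equiv.neg (Fin k))]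
    refine Finset.sum_congr rfl fun d _ => ?_
    have h1 : symmExtend k A (-d) = symmExtend k A d := by
      have := symmExtend_sub_comm k A 0 d
      rwa [zero_sub, sub_zero] at this
    have h2 := pow_val_sub_mul_pow_val hη 0 d
    rw [zero_sub, ← pow_add, Fin.val_zero, pow_zero] at h2
    rw [Equiv.neg_apply, h1, pow_eq_conj_pow hη1 h2]
  have hre : ∑ d : Fin k, η ^ (d : ℕ) • symmExtend k A d =
      ∑ d : Fin k, (((η ^ (d : ℕ)).re : ℝ) : ℂ) • A (foldIndex d) := by
    have h2 : (2 : ℂ) • ∑ d : Fin k, η ^ (d : ℕ) • symmExtend k A d =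
        (2 : ℂ) • ∑ d : Fin k, (((η ^ (d : ℕ)).re : ℝ) : ℂ) • A (foldIndex d) := by
      rw [two_smul]
      nth_rewrite 2 [hsymm]
      rw [← Finset.sum_add_distrib, Finset.smul_sum]
      refine Finset.sum_congr rfl fun d _ => ?_
      rw [← add_smul, Complex.add_conj, smul_smul]
      push_cast
      rfl
    exact smul_right_injective M (two_ne_zero (α := ℂ)) h2
  rw [hre, Finset.smul_sum, ← Finset.sum_fiberwise _ (foldIndex (k := k))]
  refine Finset.sum_congr rfl fun l _ => ?_
  rw [circulantCoeff, Complex.ofReal_mul, Complex.ofReal_sum, mul_smul, Finset.sum_smul,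
    Finset.smul_sum]
  refine Finset.sum_congr rfl fun d hd => ?_
  rw [(Finset.mem_filter.1 hd).2]

/-- The solutions of 2d ≡ 0 mod k are 0 and, for even k, k/2. The count is used twice: for positions
d paired with themselves, and for frequencies m with (r^m)² = 1. -/
theorem card_dvd_two_mul : ({d : Fin k | k ∣ 2 * (d : ℕ)} : Finset (Fin k)).card =
    if Odd k then 1 else 2 := by
  have hk : 0 < k := Nat.pos_of_ne_zero (NeZero.ne k)
  split_ifs with h
  · rw [Finset.card_eq_one]
    refine ⟨0, ?_⟩
    ext d
    have := d.2
    rw [Finset.mem_filter, Finset.mem_singleton, Fin.ext_iff, Fin.val_zero]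
    refine ⟨fun hd => ?_, fun hd => by simp [hd]⟩
    exact Nat.eq_zero_of_dvd_of_lt
      ((Nat.coprime_two_right.2 h).dvd_of_dvd_mul_left hd.2) d.2
  · have h := Nat.not_odd_iff_even.1 h
    rw [Finset.card_eq_two]
    refine ⟨0, ⟨k / 2, by omega⟩, ?_, ?_⟩
    · rw [Ne, Fin.ext_iff, Fin.val_zero]
      have := h.two_dvd
      simp only
      omega
    · ext d
      have := d.2
      have := h.two_dvd
      simp only [Finset.mem_filter, Finset.mem_univ, true_and, Finset.mem_insert,
        Finset.mem_singleton, Fin.ext_iff, Fin.val_zero]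
      constructor
      · rintro ⟨c, hc⟩
        have : c < 2 := by
          by_contra hc2
          have : k * 2 ≤ k * c := Nat.mul_le_mul_left _ (by omega)
          omega
        interval_cases c <;> omega
      · rintro (h | h)
        · simp [h]
        · exact ⟨1, by omega⟩

/-- A fibre is {d, k - d}, reduced to one point when d is paired with itself; conjugate powers have
equal real parts. -/
theorem sum_foldIndex_eq {η : ℂ} (hη : η ^ k = 1) (d : Fin k) :
    ∑ e : Fin k with foldIndex e = foldIndex d, (η ^ (e : ℕ)).re =
      (if k ∣ 2 * (d : ℕ) then 1 else 2) * (η ^ (d : ℕ)).re := by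
  have hη1 : ‖η‖ = 1 := Complex.norm_eq_one_of_pow_eq_one hη (NeZero.ne k)
  have hd := d.2
  simp only [foldIndex_eq_iff]
  split_ifs with h
  · have : ({e : Fin k | e = d ∨ (e : ℕ) + d = k} : Finset (Fin k)) = {d} := by
      ext e
      have := e.2
      obtain ⟨c, hc⟩ := h
      have : c < 2 := by
        by_contra hc2
        have : k * 2 ≤ k * c := Nat.mul_le_mul_left _ (by omega)
        omega
      simp only [Finset.mem_filter, Finset.mem_univ, true_and, Finset.mem_singleton, Fin.ext_iff]
      interval_cases c <;> omega
    rw [this, Finset.sum_singleton, one_mul]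
  · have hd0 : (d : ℕ) ≠ 0 := fun h0 => h (by simp [h0])
    have hdk : 2 * (d : ℕ) ≠ k := fun h0 => h (by simp [h0])
    have : ({e : Fin k | e = d ∨ (e : ℕ) + d = k} : Finset (Fin k)) =
        {d, ⟨k - d, by omega⟩} := by
      ext e
      have := e.2
      simp only [Finset.mem_filter, Finset.mem_univ, true_and, Finset.mem_singleton,
        Finset.mem_insert, Fin.ext_iff]
      omega
    rw [this, Finset.sum_pair (by rw [Ne, Fin.ext_iff]; simp only; omega),
      pow_eq_conj_pow hη1 (a := k - d) (b := d) (by rw [Nat.sub_add_cancel hd.le, hη]),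
      Complex.conj_re]
    ring

/-- With η^d = e^{iθ}, each d contributes 2 cos² θ = 1 + cos 2θ, or one less at a self-paired d,
where cos² θ = 1 has weight one. The sum of Re η^{2d} is k or 0 according to whether η² = 1. -/
theorem sum_circulantCoeff_sq {η : ℂ} (hη : η ^ k = 1) :
    ∑ l, circulantCoeff k η l ^ 2 =
      (k + (if η ^ 2 = 1 then (k : ℝ) else 0) - if Odd k then 1 else 2) / k := by
  have hη1 : ‖η‖ = 1 := Complex.norm_eq_one_of_pow_eq_one hη (NeZero.ne k)
  have hk : (0 : ℝ) < k := by exact_mod_cast Nat.pos_of_ne_zero (NeZero.ne k)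
  -- One factor of the square stays a sum over the fibre; the other is replaced by its value, which
  -- is a multiple of Re η^d for each d in the fibre.
  have h1 : ∀ l, circulantCoeff k η l ^ 2 = 1 / k * ∑ d : Fin k with foldIndex d = l,
      (if k ∣ 2 * (d : ℕ) then 1 else 2) * (η ^ (d : ℕ)).re ^ 2 := by
    intro l
    rw [circulantCoeff, mul_pow, div_pow, Real.sq_sqrt hk.le, one_pow, sq (∑ d with _, _),
      Finset.sum_mul]
    congr 1
    refine Finset.sum_congr rfl fun d hd => ?_
    rw [← (Finset.mem_filter.1 hd).2, sum_foldIndex_eq hη]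
    ring
  have h2 : ∀ d : Fin k, (if k ∣ 2 * (d : ℕ) then 1 else 2) * (η ^ (d : ℕ)).re ^ 2 =
      1 + ((η ^ 2) ^ (d : ℕ)).re - if k ∣ 2 * (d : ℕ) then 1 else 0 := by
    intro d
    have hn : (η ^ (d : ℕ)).re ^ 2 + (η ^ (d : ℕ)).im ^ 2 = 1 := by
      have := Complex.normSq_eq_norm_sq (η ^ (d : ℕ))
      rw [norm_pow, hη1, Complex.normSq_apply] at this
      simp only [one_pow] at this
      linarith
    have hre : ((η ^ 2) ^ (d : ℕ)).re = (η ^ (d : ℕ)).re ^ 2 - (η ^ (d : ℕ)).im ^ 2 := by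
      rw [← pow_mul, mul_comm, pow_mul, sq, Complex.mul_re]
      ring
    split_ifs with h
    · have : ((η ^ 2) ^ (d : ℕ)) = 1 := by
        obtain ⟨c, hc⟩ := h
        rw [← pow_mul, hc, pow_mul, hη, one_pow]
      rw [this, Complex.one_re] at hre
      rw [this, Complex.one_re]
      linarith
    · rw [hre]
      linarith
  have h3 : ∑ d : Fin k, ((η ^ 2) ^ (d : ℕ)).re = if η ^ 2 = 1 then (k : ℝ) else 0 := by
    rw [← Complex.re_sum, sum_pow_val_eq (by rw [← pow_mul, mul_comm, pow_mul, hη, one_pow])]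
    split_ifs <;> simp
  have h4 : ∑ d : Fin k, (if k ∣ 2 * (d : ℕ) then (1 : ℝ) else 0) = if Odd k then 1 else 2 := by
    rw [Finset.sum_boole, card_dvd_two_mul]
    split_ifs <;> norm_num
  simp_rw [h1]
  rw [← Finset.mul_sum, Finset.sum_fiberwise, Finset.sum_congr rfl fun d _ => h2 d,
    Finset.sum_sub_distrib, Finset.sum_add_distrib, h3, h4]
  simp only [Finset.sum_const, Finset.card_univ, Fintype.card_fin, nsmul_eq_mul, mul_one]
  ring

/-- The coefficient of index 0 is 1/√k. So no block is degenerate: for k ≤ 2 the law γ_{0,0} enters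
the limit with weight zero. -/
theorem sum_circulantCoeff_sq_pos (η : ℂ) : 0 < ∑ l, circulantCoeff k η l ^ 2 := by
  have hk : (0 : ℝ) < k := by exact_mod_cast Nat.pos_of_ne_zero (NeZero.ne k)
  refine Finset.sum_pos' (fun l _ => sq_nonneg _) ⟨foldIndex (0 : Fin k), Finset.mem_univ _, ?_⟩
  have : ({e : Fin k | foldIndex e = foldIndex (0 : Fin k)} : Finset (Fin k)) = {0} := by
    ext e
    have := e.2
    rw [Finset.mem_filter, foldIndex_eq_iff, Finset.mem_singleton, Fin.val_zero]
    exact ⟨fun h => h.2.resolve_right (by omega), fun h => ⟨Finset.mem_univ _, Or.inl h⟩⟩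
  rw [circulantCoeff, this, Finset.sum_singleton, Fin.val_zero, pow_zero, Complex.one_re]
  positivity

/-- The characters of `ℤ/k`, tensored with the identity matrix. -/
def fourierBlock (k n : ℕ) (r : ℂ) : Matrix (Fin k × Fin n) (Fin n × Fin k) ℂ :=
  Matrix.of fun a b => if a.2 = b.1 then (r ^ (b.2 : ℕ)) ^ (a.1 : ℕ) else 0

/-- The inverse of `fourierBlock k n r` for a primitive `k`-th root of unity `r`. -/
noncomputable def fourierBlockInv (k n : ℕ) (r : ℂ) : Matrix (Fin n × Fin k) (Fin k × Fin n) ℂ :=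
  Matrix.of fun b a => if b.1 = a.2 then (k : ℂ)⁻¹ * (r⁻¹ ^ (b.2 : ℕ)) ^ (a.1 : ℕ) else 0

/-- Characters are eigenvectors of circulants: writing j = d + i in the row sum pulls out η^i and
leaves a sum independent of i. -/
theorem circulantBlockMatrix_mul_fourierBlock {n : ℕ} {r : ℂ} (hr : r ^ k = 1)
    (A : Fin (k / 2 + 1) → Matrix (Fin n) (Fin n) ℂ) :
    circulantBlockMatrix k n A * fourierBlock k n r = fourierBlock k n r *
      blockDiagonal fun m : Fin k => ∑ l, (circulantCoeff k (r ^ (m : ℕ)) l : ℂ) • A l := by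
  ext ⟨i, p⟩ ⟨q, m⟩
  have hη : (r ^ (m : ℕ)) ^ k = 1 := by rw [← pow_mul, mul_comm, pow_mul, hr, one_pow]
  have h1 : (circulantBlockMatrix k n A * fourierBlock k n r) (i, p) (q, m) =
      ∑ j : Fin k, ((1 / √(k : ℝ) : ℝ) : ℂ) *
        (symmExtend k A (j - i) p q * (r ^ (m : ℕ)) ^ (j : ℕ)) := by
    rw [mul_apply, Fintype.sum_prod_type]
    simp only [fourierBlock, of_apply, circulantBlockMatrix, Matrix.smul_apply, comp_apply,
      rowCirculant, smul_eq_mul, mul_ite, mul_zero, Finset.sum_ite_eq', Finset.mem_univ, if_true,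
      mul_assoc]
  have h2 : (fourierBlock k n r * blockDiagonal fun m : Fin k =>
      ∑ l, (circulantCoeff k (r ^ (m : ℕ)) l : ℂ) • A l) (i, p) (q, m) =
      (r ^ (m : ℕ)) ^ (i : ℕ) * ∑ d : Fin k, ((1 / √(k : ℝ) : ℝ) : ℂ) *
        ((r ^ (m : ℕ)) ^ (d : ℕ) * symmExtend k A d p q) := by
    rw [mul_apply, Fintype.sum_prod_type]
    simp only [fourierBlock, of_apply, blockDiagonal_apply, mul_ite, ite_mul, mul_zero, zero_mul,
      Finset.sum_ite_eq, Finset.sum_ite_eq', Finset.mem_univ, if_true]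
    rw [sum_circulantCoeff_smul hη]
    simp only [Matrix.smul_apply, Matrix.sum_apply, smul_eq_mul, Finset.mul_sum]
  rw [h1, h2, Finset.mul_sum, ← Equiv.sum_comp (Equiv.addRight i)]
  refine Finset.sum_congr rfl fun d _ => ?_
  have := pow_val_sub_mul_pow_val hη (d + i) i
  rw [add_sub_cancel_right] at this
  rw [Equiv.coe_addRight, add_sub_cancel_right, ← this]
  ring

/-- Orthogonality of characters; primitivity of r gives r^i = r^j only for i = j. -/
theorem fourierBlock_mul_fourierBlockInv {n : ℕ} {r : ℂ} (hr : IsPrimitiveRoot r k) :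
    fourierBlock k n r * fourierBlockInv k n r = 1 := by
  have hk : (k : ℂ) ≠ 0 := by exact_mod_cast NeZero.ne k
  have hr0 : r ≠ 0 := hr.ne_zero (NeZero.ne k)
  ext ⟨i, p⟩ ⟨j, q⟩
  have h1 : (fourierBlock k n r * fourierBlockInv k n r) (i, p) (j, q) =
      if p = q then (k : ℂ)⁻¹ * ∑ m : Fin k, (r ^ (i : ℕ) * r⁻¹ ^ (j : ℕ)) ^ (m : ℕ) else 0 := by
    rw [mul_apply, Fintype.sum_prod_type]
    simp only [fourierBlock, fourierBlockInv, of_apply, mul_ite, ite_mul, mul_zero, zero_mul]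
    rw [Finset.sum_comm]
    simp only [Finset.sum_ite_eq', Finset.mem_univ, if_true]
    split_ifs
    · rw [Finset.mul_sum]
      refine Finset.sum_congr rfl fun m _ => ?_
      rw [← pow_mul, ← pow_mul, mul_pow, ← pow_mul, ← pow_mul, mul_comm (i : ℕ), mul_comm (j : ℕ)]
      ring
    · simp
  have h2 : r ^ (i : ℕ) * r⁻¹ ^ (j : ℕ) = 1 ↔ i = j := by
    rw [inv_pow, mul_inv_eq_one₀ (pow_ne_zero _ hr0), Fin.ext_iff]
    exact ⟨fun h => hr.pow_inj i.2 j.2 h, fun h => by rw [h]⟩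
  have h3 : (r ^ (i : ℕ) * r⁻¹ ^ (j : ℕ)) ^ k = 1 := by
    rw [mul_pow, ← pow_mul, ← pow_mul, mul_comm (i : ℕ), mul_comm (j : ℕ), pow_mul, pow_mul,
      inv_pow, hr.pow_eq_one]
    simp
  rw [h1, sum_pow_val_eq h3, one_apply]
  simp only [h2, Prod.mk.injEq]
  by_cases hp : p = q <;> by_cases hi : i = j <;> simp [hp, hi, hk]

/-- The trace of the resolvent of a symmetric circulant block matrix is the sum of those of the
blocks of its block-diagonalisation. -/
theorem trace_matrixResolvent_circulantBlockMatrix {n : ℕ} {r : ℂ} (hr : IsPrimitiveRoot r k)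
    {A : Fin (k / 2 + 1) → Matrix (Fin n) (Fin n) ℂ} (hA : ∀ l, (A l).IsHermitian) {z : ℂ}
    (hz : 0 < z.im) :
    (matrixResolvent (circulantBlockMatrix k n A) z).trace = ∑ m : Fin k,
      (matrixResolvent (∑ l, (circulantCoeff k (r ^ (m : ℕ)) l : ℂ) • A l) z).trace := by
  set B : Fin k → Matrix (Fin n) (Fin n) ℂ := fun m =>
    ∑ l, (circulantCoeff k (r ^ (m : ℕ)) l : ℂ) • A l with hB
  have hBH : ∀ m, (B m).IsHermitian := by
    intro m
    refine isSelfAdjoint_sum _ fun l _ => ?_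
    exact IsSelfAdjoint.smul (Complex.conj_ofReal _) (hA l)
  set F := fourierBlock k n r
  set F' := fourierBlockInv k n r
  set G := blockDiagonal fun m => matrixResolvent (B m) z
  have hFF' : F * F' = 1 := fourierBlock_mul_fourierBlockInv hr
  have hF'F : F' * F = 1 := (mul_eq_one_comm_of_equiv (Equiv.prodComm _ _)).1 hFF'
  have hG : (blockDiagonal B - z • 1) * G = 1 := by
    have : blockDiagonal B - z • (1 : Matrix (Fin n × Fin k) (Fin n × Fin k) ℂ) =
        blockDiagonal fun m => B m - z • (1 : Matrix (Fin n) (Fin n) ℂ) := by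
      rw [← blockDiagonal_one, ← blockDiagonal_smul, ← blockDiagonal_sub]
      rfl
    rw [this, ← blockDiagonal_mul, ← blockDiagonal_one]
    congr 1
    funext m
    exact sub_mul_matrixResolvent (hBH m) hz
  -- An explicit right inverse identifies the resolvent of the circulant; cyclicity of the trace
  -- then removes F and F'.
  have hC : (circulantBlockMatrix k n A - z • 1) * (F * G * F') = 1 := by
    rw [← Matrix.mul_assoc, ← Matrix.mul_assoc, Matrix.sub_mul,
      circulantBlockMatrix_mul_fourierBlock hr.pow_eq_one, Matrix.smul_mul, Matrix.one_mul]
    have : F * blockDiagonal B - z • F = F * (blockDiagonal B - z • 1) := by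
      rw [Matrix.mul_sub, Matrix.mul_smul, Matrix.mul_one]
    rw [this, Matrix.mul_assoc F, hG, Matrix.mul_one, hFF']
  rw [matrixResolvent, inv_eq_right_inv hC, trace_mul_comm, ← Matrix.mul_assoc, hF'F,
    Matrix.one_mul, trace_blockDiagonal]

end Circulant

/-! ### The limiting mixture and the conclusion. -/

theorem circulantLimit_eq (k : ℕ) :
    circulantLimit k =
      ENNReal.ofReal (((k : ℝ) - if Odd k then 1 else 2) / k) •
        semicircleLaw 0 (((k : ℝ) - if Odd k then 1 else 2) / k) +
      ENNReal.ofReal ((if Odd k then 1 else 2) / (k : ℝ)) •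
        semicircleLaw 0 ((2 * (k : ℝ) - if Odd k then 1 else 2) / k) := by
  unfold circulantLimit
  split_ifs <;> rfl

/-- The w frequencies with η² = 1 carry variance (2k - w)/k and the other k - w carry (k - w)/k, so
averaging over m reproduces the weights of the mixture. -/
theorem stieltjes_circulantLimit (k : ℕ) [NeZero k] {r : ℂ} (hr : IsPrimitiveRoot r k) {z : ℂ}
    (hz : 0 < z.im) :
    stieltjes (circulantLimit k) z = (k : ℂ)⁻¹ * ∑ m : Fin k,
      stieltjes (semicircleLaw 0 (∑ l, circulantCoeff k (r ^ (m : ℕ)) l ^ 2)) z := by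
  have hk : (0 : ℝ) < k := by exact_mod_cast Nat.pos_of_ne_zero (NeZero.ne k)
  have hk' : (k : ℂ) ≠ 0 := by exact_mod_cast NeZero.ne k
  set w : ℝ := if Odd k then 1 else 2 with hw
  have hw0 : 0 ≤ w := by rw [hw]; split_ifs <;> norm_num
  have hcard : (({d : Fin k | k ∣ 2 * (d : ℕ)} : Finset (Fin k)).card : ℝ) = w := by
    rw [card_dvd_two_mul, hw]
    split_ifs <;> norm_num
  have hcard' : (({d : Fin k | ¬ k ∣ 2 * (d : ℕ)} : Finset (Fin k)).card : ℝ) = k - w := by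
    have := Finset.card_filter_add_card_filter_not (s := (Finset.univ : Finset (Fin k)))
      (fun d => k ∣ 2 * (d : ℕ))
    rw [Finset.card_univ, Fintype.card_fin] at this
    have h := congrArg (Nat.cast : ℕ → ℝ) this
    push_cast at h
    linarith
  have hwk : w ≤ k := by
    have : (0 : ℝ) ≤ k - w := hcard' ▸ Nat.cast_nonneg _
    linarith
  have hterm : ∀ m : Fin k,
      stieltjes (semicircleLaw 0 (∑ l, circulantCoeff k (r ^ (m : ℕ)) l ^ 2)) z =
        if k ∣ 2 * (m : ℕ) then stieltjes (semicircleLaw 0 ((2 * (k : ℝ) - w) / k)) z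
        else stieltjes (semicircleLaw 0 (((k : ℝ) - w) / k)) z := by
    intro m
    have hη : (r ^ (m : ℕ)) ^ k = 1 := by
      rw [← pow_mul, mul_comm, pow_mul, hr.pow_eq_one, one_pow]
    have h2 : (r ^ (m : ℕ)) ^ 2 = 1 ↔ k ∣ 2 * (m : ℕ) := by
      rw [← pow_mul, mul_comm, hr.pow_eq_one_iff_dvd]
    rw [sum_circulantCoeff_sq hη]
    simp only [h2, ← hw]
    split_ifs
    · rw [two_mul]
    · rw [add_zero]
  have h1 := isProbabilityMeasure_semicircleLaw 0 (v := ((k : ℝ) - w) / k)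
    (div_nonneg (by linarith) hk.le)
  have h2 := isProbabilityMeasure_semicircleLaw 0 (v := (2 * (k : ℝ) - w) / k)
    (div_nonneg (by linarith) hk.le)
  rw [Finset.sum_congr rfl fun m _ => hterm m, Finset.sum_ite, Finset.sum_const, Finset.sum_const,
    nsmul_eq_mul, nsmul_eq_mul, ← Complex.ofReal_natCast (Finset.card _),
    ← Complex.ofReal_natCast (Finset.card _), hcard, hcard', circulantLimit_eq, ← hw]
  unfold stieltjes
  rw [integral_add_measure ((integrable_inv_ofReal_sub _ hz).smul_measure ENNReal.ofReal_ne_top)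
    ((integrable_inv_ofReal_sub _ hz).smul_measure ENNReal.ofReal_ne_top),
    integral_smul_measure, integral_smul_measure,
    ENNReal.toReal_ofReal (div_nonneg (by linarith) hk.le),
    ENNReal.toReal_ofReal (div_nonneg hw0 hk.le), Complex.real_smul, Complex.real_smul]
  push_cast
  field_simp
  ring

/-- That ξ is a probability law is read off from an entry above the diagonal, which exists only from
order 2 on. -/
theorem IsWigner.isProbabilityMeasure_offDiag {Ω : Type*} [MeasurableSpace Ω] {P : Measure Ω}
    [IsProbabilityMeasure P] {n : ℕ} {v : ℝ} {ξ : Measure ℂ} {ζ : Measure ℝ}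
    {A : Ω → Matrix (Fin n) (Fin n) ℂ} (hA : IsWigner P n v ξ ζ A) (hn : 1 < n) :
    IsProbabilityMeasure ξ := by
  rw [← hA.map_offDiag ⟨0, by omega⟩ ⟨1, hn⟩ (by simp)]
  exact Measure.isProbabilityMeasure_map ((hA.measurable _ _).const_mul _).aemeasurable

theorem IsWigner.isProbabilityMeasure_diag {Ω : Type*} [MeasurableSpace Ω] {P : Measure Ω}
    [IsProbabilityMeasure P] {n : ℕ} {v : ℝ} {ξ : Measure ℂ} {ζ : Measure ℝ}
    {A : Ω → Matrix (Fin n) (Fin n) ℂ} (hA : IsWigner P n v ξ ζ A) (hn : 0 < n) :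
    IsProbabilityMeasure ζ := by
  rw [← hA.map_diag ⟨0, hn⟩]
  exact Measure.isProbabilityMeasure_map
    ((Complex.measurable_re.comp (hA.measurable _ _)).const_mul _).aemeasurable

theorem proposition3 (k : ℕ) [NeZero k]
    {Ω : Type*} [MeasurableSpace Ω] (P : Measure Ω) [IsProbabilityMeasure P]
    (ξ : Fin (k / 2 + 1) → Measure ℂ) (ζ : Fin (k / 2 + 1) → Measure ℝ)
    (A : (n : ℕ+) → Fin (k / 2 + 1) → Ω → Matrix (Fin n) (Fin n) ℂ)
    (hA : ∀ (n : ℕ+) (l : Fin (k / 2 + 1)), IsWigner P n 1 (ξ l) (ζ l) (A n l))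
    (hindep : ∀ n : ℕ+, iIndepFun (fun (l : Fin (k / 2 + 1)) ω (i j : Fin n) => A n l ω i j) P) :
    ∀ᵐ ω ∂P, Tendsto (β := ProbabilityMeasure ℝ)
      (fun n : ℕ+ =>
        ⟨spectralMeasure (circulantBlockMatrix k n fun l => A n l ω)
            (isHermitian_circulantBlockMatrix fun l => (hA n l).isHermitian ω),
          inferInstance⟩)
      atTop (𝓝 ⟨circulantLimit k, inferInstance⟩) := by
  have hξ : ∀ l, IsProbabilityMeasure (ξ l) := fun l =>
    (hA 2 l).isProbabilityMeasure_offDiag (by norm_num)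
  have hζ : ∀ l, IsProbabilityMeasure (ζ l) := fun l =>
    (hA 1 l).isProbabilityMeasure_diag (by norm_num)
  have hr := Complex.isPrimitiveRoot_exp k (NeZero.ne k)
  set r := Complex.exp (2 * Real.pi * Complex.I / k)
  -- Wigner's theorem holds outside a null set depending on z and on the block m; countably many z
  -- and finitely many m leave one null set.
  obtain ⟨S, hSc, hSd⟩ := TopologicalSpace.exists_countable_dense ℂ
  have hae : ∀ᵐ ω ∂P, ∀ z ∈ S, 0 < z.im → ∀ m : Fin k, Tendsto (fun n : ℕ+ => resolventMean
      (∑ l, (circulantCoeff k (r ^ (m : ℕ)) l : ℂ) • A n l ω) z) atTop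
      (𝓝 (stieltjes (semicircleLaw 0 (∑ l, circulantCoeff k (r ^ (m : ℕ)) l ^ 2)) z)) := by
    rw [ae_ball_iff hSc]
    intro z _
    by_cases hz : 0 < z.im
    · have : ∀ m : Fin k, ∀ᵐ ω ∂P, Tendsto (fun n : ℕ+ => resolventMean
          (∑ l, (circulantCoeff k (r ^ (m : ℕ)) l : ℂ) • A n l ω) z) atTop
          (𝓝 (stieltjes (semicircleLaw 0 (∑ l, circulantCoeff k (r ^ (m : ℕ)) l ^ 2)) z)) :=
        fun m => ae_tendsto_resolventMean_of_isWigner (sum_circulantCoeff_sq_pos _)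
          (fun n => IsWigner.linearCombination (hA n) (hindep n) _) hz
      filter_upwards [ae_all_iff.2 this] with ω hω _ using hω
    · exact Eventually.of_forall fun ω h => absurd h hz
  filter_upwards [hae] with ω hω
  refine tendsto_of_tendsto_stieltjes fun z hz =>
    tendsto_stieltjes_of_dense hSd (fun z hzS hz => ?_) hz
  simp only [ProbabilityMeasure.coe_mk]
  rw [stieltjes_circulantLimit k hr hz]
  refine Tendsto.congr (fun n => ?_) ((tendsto_finsetSum Finset.univ
    fun m _ => hω z hzS hz m).const_mul (k : ℂ)⁻¹)
  rw [stieltjes_spectralMeasure _ hz, trace_matrixResolvent_circulantBlockMatrix hr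
    (fun l => (hA n l).isHermitian ω) hz]
  simp only [resolventMean, Fintype.card_prod, Fintype.card_fin, ← Finset.mul_sum]
  push_cast
  rw [mul_inv, mul_assoc]
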